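/- Conventions. All modules are left modules and $\Lambda$ denotes a $\mathbb{Z}$-order in a finite-dimensional semisimple $\mathbb{Q}$-algebra; $\Lambda^{(k)}$ is the direct sum of $k$ copies of $\Lambda$. The order $\Lambda$ has \emph{stably free cancellation} (SFC) if for every finitely generated $\Lambda$-module $X$ and all $m,n\geq 0$, $X\oplus\Lambda^{(m)}\cong\Lambda^{(m+n)}$ implies $X\cong\Lambda^{(n)}$. A \emph{locally free $\Lambda$-lattice of rank $1$} is a $\Lambda$-module $X$ that is finitely generated and torsion-free over $\mathbb{Z}$ and satisfies $\mathbb{Z}_{(p)}\otimes_{\mathbb{Z}}X\cong\mathbb{Z}_{(p)}\otimes_{\mathbb{Z}}\Lambda$ as $(\mathbb{Z}_{(p)}\otimes_{\mathbb{Z}}\Lambda)$-modules for every prime number $p$. Two such lattices $X,Y$ are stably isomorphic if $X\oplus\Lambda^{(m)}\cong Y\oplus\Lambda^{(m)}$ for some $m\geq 0$. The underlying set of the (finite) locally free class group $\mathrm{Cl}(\Lambda)$ is the set of stable isomorphism classes of locally free $\Lambda$-lattices of rank $1$. Proposition. Let $G$ be a finite group with a normal subgroup $N$ of order $2$, let $H=G/N$,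 let $C_2$ be the cyclic group of order $2$, let $\mathrm{Tr}_N=\sum_{\tau\in N}\tau\in\mathbb{Z}[G]$, and let $\Gamma=\mathbb{Z}[G]/\mathrm{Tr}_N\mathbb{Z}[G]$. Suppose that $\mathbb{Z}[H\times C_2]$ has SFC and that \[ \frac{|\mathrm{Cl}(\mathbb{Z}[H\times C_2])|}{|\mathrm{Cl}(\mathbb{Z}[H])|}=\frac{|\mathrm{Cl}(\mathbb{Z}[G])|}{|\mathrm{Cl}(\Gamma)|}. \] Then $\mathbb{Z}[G]$ has SFC if and only if $\Gamma$ has SFC. -/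

import Mathlib

open scoped TensorProduct

universe u v

/-- A ring `Λ` has stably free cancellation if, for every finitely generated left `Λ`-module `X`,
`X ⊕ Λ^m ≅ Λ^(m+n)` for some `m, n ≥ 0` implies `X ≅ Λ^n`. -/
def HasSFC (Λ : Type u) [Ring Λ] : Prop :=
  ∀ (X : Type u) [AddCommGroup X] [Module Λ X], Module.Finite Λ X →
    ∀ m n : ℕ, Nonempty ((X × (Fin m → Λ)) ≃ₗ[Λ] (Fin (m + n) → Λ)) →
      Nonempty (X ≃ₗ[Λ] (Fin n → Λ))

/-- `X` and `Y` are stably isomorphic: `X ⊕ Λ^m ≅ Y ⊕ Λ^m` for some `m ≥ 0`. -/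
def StablyIsomorphic (Λ : Type u) [Ring Λ] (X Y : Type v) [AddCommGroup X] [Module Λ X]
    [AddCommGroup Y] [Module Λ Y] : Prop :=
  ∃ m : ℕ, Nonempty ((X × (Fin m → Λ)) ≃ₗ[Λ] (Y × (Fin m → Λ)))

/-- A `Λ`-lattice, for a `ℤ`-order `Λ`: a left `Λ`-module that is finitely generated and
torsion-free over `ℤ`. -/
def IsLatticeOver (Λ : Type u) [Ring Λ] (X : Type v) [AddCommGroup X] [Module Λ X] : Prop :=
  Module.Finite ℤ X ∧ Module.IsTorsionFree ℤ X

/-- The scalar extension `Z ⊗ Λ` of the ring `Λ` along `ℤ → Z`; for `Z = ℤ_p` (the localisation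
of `ℤ` at `p`) this is the localisation `Λ_p`. -/
abbrev BaseChangeRing (Z : Type) [CommRing Z] (Λ : Type u) [Ring Λ] : Type u :=
  Z ⊗[ℤ] Λ

/-- The scalar extension `Z ⊗ X` of the abelian group `X` along `ℤ → Z`; for `Z = ℤ_p` this is the
localisation `X_p`. -/
def BaseChangeMod (Z : Type) [CommRing Z] (X : Type v) [AddCommGroup X] : Type v :=
  Z ⊗[ℤ] X

noncomputable instance BaseChangeMod.instAddCommGroup (Z : Type) [CommRing Z] (X : Type v)
    [AddCommGroup X] : AddCommGroup (BaseChangeMod Z X) :=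
  inferInstanceAs (AddCommGroup (Z ⊗[ℤ] X))

/-- The action of `Z ⊗ Λ` on `Z ⊗ X`, determined by `(a ⊗ l) • (b ⊗ x) = (a * b) ⊗ (l • x)`
(see `BaseChangeMod.smul_tmul`). -/
noncomputable def BaseChangeMod.action (Z : Type) [CommRing Z] (Λ : Type u) [Ring Λ] (X : Type v)
    [AddCommGroup X] [Module Λ X] : BaseChangeRing Z Λ →ₐ[ℤ] Module.End ℤ (Z ⊗[ℤ] X) :=
  (Module.endTensorEndAlgHom (R := ℤ) (A := ℤ) (M := Z) (N := X)).comp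
    (Algebra.TensorProduct.map (Algebra.lmul ℤ Z)
      (Module.toModuleEnd ℤ X : Λ →+* Module.End ℤ X).toIntAlgHom)

/-- `Z ⊗ X` is a left module over `Z ⊗ Λ`. -/
noncomputable instance BaseChangeMod.instModule (Z : Type) [CommRing Z] (Λ : Type u) [Ring Λ]
    (X : Type v) [AddCommGroup X] [Module Λ X] :
    Module (BaseChangeRing Z Λ) (BaseChangeMod Z X) :=
  Module.compHom (Z ⊗[ℤ] X) (BaseChangeMod.action Z Λ X).toRingHom

theorem BaseChangeMod.smul_tmul (Z : Type) [CommRing Z] (Λ : Type u) [Ring Λ]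
    (X : Type v) [AddCommGroup X] [Module Λ X] (a b : Z) (l : Λ) (x : X) :
    (a ⊗ₜ[ℤ] l : BaseChangeRing Z Λ) • (id (b ⊗ₜ[ℤ] x) : BaseChangeMod Z X) =
      (id ((a * b) ⊗ₜ[ℤ] (l • x)) : BaseChangeMod Z X) :=
  rfl

/-- `Z ⊗ X` and `Z ⊗ Y` are isomorphic as `Z ⊗ Λ`-modules. -/
def IsoAfterBaseChange (Z : Type) [CommRing Z] (Λ : Type u) [Ring Λ] (X Y : Type v)
    [AddCommGroup X] [Module Λ X] [AddCommGroup Y] [Module Λ Y] : Prop :=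
  Nonempty (BaseChangeMod Z X ≃ₗ[BaseChangeRing Z Λ] BaseChangeMod Z Y)

/-- `X` and `Y` are in the same genus: `X_p ≅ Y_p` as `Λ_p`-modules for every maximal ideal `p`
of `ℤ`. -/
def SameGenus (Λ : Type u) [Ring Λ] (X Y : Type v) [AddCommGroup X] [Module Λ X]
    [AddCommGroup Y] [Module Λ Y] : Prop :=
  ∀ (p : Ideal ℤ) [p.IsMaximal], IsoAfterBaseChange (Localization.AtPrime p) Λ X Y

/-- The principal genus `g(Λ)`: the `Λ`-lattices that are locally free of rank one. -/
structure PrincipalGenus (Λ : Type u) [Ring Λ] where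
  carrier : Type u
  [addCommGroup : AddCommGroup carrier]
  [module : Module Λ carrier]
  isLattice : IsLatticeOver Λ carrier
  sameGenus : SameGenus Λ carrier Λ

attribute [instance] PrincipalGenus.addCommGroup PrincipalGenus.module

theorem StablyIsomorphic.trans {Λ : Type u} [Ring Λ] {X Y Z : Type v} [AddCommGroup X]
    [Module Λ X] [AddCommGroup Y] [Module Λ Y] [AddCommGroup Z] [Module Λ Z]
    (h₁ : StablyIsomorphic Λ X Y) (h₂ : StablyIsomorphic Λ Y Z) : StablyIsomorphic Λ X Z := by
  obtain ⟨m, ⟨e⟩⟩ := h₁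
  obtain ⟨k, ⟨f⟩⟩ := h₂
  let s : (Fin (m + k) → Λ) ≃ₗ[Λ] (Fin m → Λ) × (Fin k → Λ) :=
    (LinearEquiv.funCongrLeft Λ Λ finSumFinEquiv).trans
      (LinearEquiv.sumArrowLequivProdArrow (Fin m) (Fin k) Λ Λ)
  let c := LinearEquiv.prodComm Λ (Fin m → Λ) (Fin k → Λ)
  refine ⟨m + k, ⟨?_⟩⟩
  exact ((LinearEquiv.refl Λ X).prodCongr s).trans <|
    (LinearEquiv.prodAssoc Λ X _ _).symm.trans <|
    (e.prodCongr (LinearEquiv.refl Λ _)).trans <|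
    (LinearEquiv.prodAssoc Λ Y _ _).trans <|
    ((LinearEquiv.refl Λ Y).prodCongr c).trans <|
    (LinearEquiv.prodAssoc Λ Y _ _).symm.trans <|
    (f.prodCongr (LinearEquiv.refl Λ _)).trans <|
    (LinearEquiv.prodAssoc Λ Z _ _).trans <|
    ((LinearEquiv.refl Λ Z).prodCongr c.symm).trans
    ((LinearEquiv.refl Λ Z).prodCongr s.symm)

/-- Stable isomorphism on the principal genus. -/
instance PrincipalGenus.setoid (Λ : Type u) [Ring Λ] : Setoid (PrincipalGenus Λ) where
  r X Y := StablyIsomorphic Λ X.carrier Y.carrier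
  iseqv :=
    { refl := fun _ => ⟨0, ⟨LinearEquiv.refl Λ _⟩⟩
      symm := fun ⟨m, ⟨e⟩⟩ => ⟨m, ⟨e.symm⟩⟩
      trans := fun h₁ h₂ => h₁.trans h₂ }

/-- The (underlying set of the) locally free class group `Cl(Λ)` of a `ℤ`-order `Λ`: the stable
isomorphism classes of locally free `Λ`-lattices of rank one. -/
def LocallyFreeClassGroup (Λ : Type u) [Ring Λ] : Type (u + 1) :=
  Quotient (PrincipalGenus.setoid Λ)

/-- The trace element `Tr_N = ∑_{τ ∈ N} τ` of `ℤ[G]`. -/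
noncomputable def traceElement {G : Type u} [Group G] (N : Subgroup G) : MonoidAlgebra ℤ G :=
  ∑ᶠ τ : N, MonoidAlgebra.of ℤ G (τ : G)

theorem traceElement_comm {G : Type u} [Group G] [Finite G] (N : Subgroup G) [N.Normal]
    (x : MonoidAlgebra ℤ G) : x * traceElement N = traceElement N * x := by
  have key : ∀ g : G, Commute (MonoidAlgebra.of ℤ G g) (traceElement N) := by
    intro g
    have := Fintype.ofFinite N
    rw [traceElement, finsum_eq_sum_of_fintype, Commute, SemiconjBy, Finset.mul_sum,
      Finset.sum_mul]
    refine Fintype.sum_equiv (MulAut.conjNormal g).toEquiv _ _ fun τ => ?_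
    rw [← map_mul, ← map_mul]
    simp [MulAut.conjNormal_apply]
  induction x using MonoidAlgebra.induction_on with
  | of g => exact key g
  | add a b ha hb => rw [add_mul, mul_add, ha, hb]
  | smul r a ha => rw [smul_mul_assoc, mul_smul_comm, ha]

/-- The ideal `Tr_N ℤ[G]` (see `mem_traceIdeal`). -/
noncomputable def traceIdeal {G : Type u} [Group G] (N : Subgroup G) :
    Ideal (MonoidAlgebra ℤ G) :=
  Ideal.span {traceElement N}

theorem mem_traceIdeal {G : Type u} [Group G] [Finite G] (N : Subgroup G) [N.Normal]
    (y : MonoidAlgebra ℤ G) : y ∈ traceIdeal N ↔ ∃ x, traceElement N * x = y := by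
  simp only [traceIdeal, Ideal.mem_span_singleton', traceElement_comm]

instance traceIdeal_isTwoSided {G : Type u} [Group G] [Finite G] (N : Subgroup G) [N.Normal] :
    (traceIdeal N).IsTwoSided where
  mul_mem_of_left {a} b ha := by
    rw [mem_traceIdeal] at ha ⊢
    obtain ⟨x, rfl⟩ := ha
    exact ⟨x * b, (mul_assoc _ _ _).symm⟩

/-- The ring `Γ = ℤ[G] / Tr_N ℤ[G]`. -/
abbrev GammaRing {G : Type u} [Group G] (N : Subgroup G) : Type u :=
  MonoidAlgebra ℤ G ⧸ traceIdeal N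

/-! Let R = 𝔽₂[H]. Both ℤ[G] = Γ ×_R ℤ[H] and ℤ[H × C₂] = ℤ[H] ×_R ℤ[H] are fibre squares in which R
is the reduction modulo two of both factors. Everything is Milnor gluing over such a square Λ = Λ₁
×_R Λ₂, controlled by units of R, here viewed as automorphisms of the left module R.

Since R is finite, it has stable range one. Hence an isomorphism K × Rᵐ ≅ M × Rᵐ, where M has a
unimodular element, becomes diagonal after composition with a product of shears. Shears lift along
every reduction of a projective module, so they can be absorbed on either side of the square, and
only a unit of R survives (`exists_univLiftable_mul_eq`). Let P(Λᵢ) be the group of units of R that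
lift stably to Λᵢ (`stablyLiftable`); Whitehead's lemma makes it normal. Gluing two fixed locally
free lattices of rank one along units v and w gives stably isomorphic modules exactly when w⁻¹v lies
in P(Λ₁)P(Λ₂). This yields the class number formula |Cl(Λ)| = |Cl(Λ₁)| |Cl(Λ₂)| [Rˣ : P(Λ₁)P(Λ₂)]
(`card_locallyFreeClassGroup`). The class numbers are nonzero by a Jordan–Zassenhaus argument with
minimal vectors, so they may be cancelled. The hypothesis on class numbers then says that
P(Γ)P(ℤ[H]) and P(ℤ[H]) have the same index, that is, P(Γ) ≤ P(ℤ[H]).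

SFC passes from Λ to Λ₁ for every such square: a stably free Λ₁-module can be glued with a free
Λ₂-module to a stably free Λ-module (`hasSFC_fst`). This gives one implication, and also SFC for
ℤ[H]. Moreover, SFC for ℤ[H × C₂] forces every unit in P(ℤ[H]) to lift to a unit of ℤ[H]
(`stablyLiftable_le_of_hasSFC`). If Γ has SFC, a stably free ℤ[G]-module of positive rank is
therefore glued from free modules, up to free summands along a single unit of R. That unit lies in
P(Γ)P(ℤ[H]) = P(ℤ[H]), hence lifts to ℤ[H], and the module is free (`hasSFC_of_factors`). -/

/-! ### Stable range one for finite rings -/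

/-- Right multiplication by `a`, as an endomorphism of the left module `S`. -/
abbrev rightMul {S : Type*} [Ring S] (a : S) : S →ₗ[S] S := LinearMap.toSpanSingleton S S a

/-- Cancellation by counting: |Hom(K, -)| is multiplicative on direct sums and positive, so no
Krull–Schmidt theorem is needed. It is applied below to produce a nonzero homomorphism. -/
theorem card_linearMap_eq_of_isCompl {S E K : Type*} [Ring S] [AddCommGroup E] [Module S E]
    [AddCommGroup K] [Module S K] [Finite E] [Finite K] {A B C D : Submodule S E}
    (hAB : IsCompl A B) (hCD : IsCompl C D) (e : B ≃ₗ[S] C) :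
    Nat.card (K →ₗ[S] A) = Nat.card (K →ₗ[S] D) := by
  have count : ∀ {P Q : Submodule S E}, IsCompl P Q →
      Nat.card (K →ₗ[S] P) * Nat.card (K →ₗ[S] Q) = Nat.card (K →ₗ[S] E) := by
    intro P Q h
    rw [← Nat.card_prod]
    exact Nat.card_congr ((LinearMap.prodEquiv ℕ).toEquiv.trans
      { toFun f := (Submodule.prodEquivOfIsCompl P Q h).toLinearMap ∘ₗ f
        invFun f := (Submodule.prodEquivOfIsCompl P Q h).symm.toLinearMap ∘ₗ f
        left_inv f := by ext x <;> simp
        right_inv f := LinearMap.ext fun x =>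
          (Submodule.prodEquivOfIsCompl P Q h).apply_symm_apply (f x) })
  have h₁ := count hAB
  have h₂ := count hCD
  have h₃ : Nat.card (K →ₗ[S] B) = Nat.card (K →ₗ[S] C) := Nat.card_congr
      { toFun f := e.toLinearMap ∘ₗ f
        invFun f := e.symm.toLinearMap ∘ₗ f
        left_inv f := by ext x; simp
        right_inv f := by ext x; simp }
  have : Finite (K →ₗ[S] C) := DFunLike.finite _
  have hpos : 0 < Nat.card (K →ₗ[S] C) := Nat.card_pos
  rw [h₃, mul_comm] at h₁
  exact Nat.eq_of_mul_eq_mul_left hpos (h₁.trans h₂.symm)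

/-- Choose c so that the kernel K of right multiplication by a + cb is smallest. If K ≠ 0, counting
homomorphisms gives a nonzero map from K to a complement of the image inside Sb; adding it to the
multiplication shrinks the kernel. -/
theorem exists_add_mul_isUnit_of_isSemisimpleRing {S : Type*} [Ring S] [Finite S]
    [IsSemisimpleRing S] (a b : S) (h : ∃ x y, x * a + y * b = 1) :
    ∃ c, IsUnit (a + c * b) := by
  obtain ⟨c, hc⟩ := Finite.exists_min fun c : S =>
    Nat.card (LinearMap.ker (rightMul (a + c * b)))
  refine ⟨c, ?_⟩
  set a' := a + c * b with ha'
  obtain ⟨x₀, y₀, h₀⟩ := h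
  have h' : x₀ * a' + (y₀ - x₀ * c) * b = 1 := by rw [ha', ← h₀]; noncomm_ring
  suffices hker : LinearMap.ker (rightMul a') = ⊥ by
    have hinj : Function.Injective (rightMul a') := LinearMap.ker_eq_bot.mp hker
    obtain ⟨x, hx⟩ := Finite.surjective_of_injective hinj 1
    have hx : x * a' = 1 := hx
    refine ⟨⟨a', x, hinj ?_, hx⟩, rfl⟩
    change a' * x * a' = 1 * a'
    rw [mul_assoc, hx, mul_one, one_mul]
  by_contra hne
  set K := LinearMap.ker (rightMul a') with hK
  set I := LinearMap.range (rightMul a') with hI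
  set B : Submodule S S := Submodule.span S {b} with hB
  have hIB : I ⊔ B = ⊤ := by
    rw [Ideal.eq_top_iff_one, ← h']
    exact Submodule.add_mem_sup ⟨x₀, rfl⟩ (Submodule.mem_span_singleton.mpr ⟨_, rfl⟩)
  obtain ⟨K', hK'⟩ := exists_isCompl K
  obtain ⟨C', hC'⟩ := exists_isCompl (I ⊓ B)
  -- The complement of the image can be taken inside Sb, because the image and Sb together span S.
  have hC : IsCompl I (C' ⊓ B) := by
    constructor
    · rw [disjoint_iff, ← inf_assoc, inf_right_comm]; exact hC'.inf_eq_bot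
    · rw [codisjoint_iff]
      have h₁ : (I ⊓ B) ⊔ (C' ⊓ B) = B := by
        rw [← sup_inf_assoc_of_le C' (inf_le_right : I ⊓ B ≤ B), hC'.sup_eq_top, top_inf_eq]
      rw [eq_top_iff, ← hIB]
      refine sup_le le_sup_left ?_
      conv_lhs => rw [← h₁]
      exact sup_le_sup_right inf_le_left _
  have e : K' ≃ₗ[S] I := (Submodule.quotientEquivOfIsCompl K K' hK').symm.trans
    (LinearMap.quotKerEquivRange _)
  have hcard := card_linearMap_eq_of_isCompl (K := K) hK' hC e
  have : Nontrivial K := Submodule.nontrivial_iff_ne_bot.mpr hne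
  have : Finite (K →ₗ[S] K) := DFunLike.finite _
  have : Finite (K →ₗ[S] (C' ⊓ B : Submodule S S)) := DFunLike.finite _
  have : Nontrivial (K →ₗ[S] (C' ⊓ B : Submodule S S)) := by
    rw [← Finite.one_lt_card_iff_nontrivial, ← hcard, Finite.one_lt_card_iff_nontrivial]
    infer_instance
  obtain ⟨φ, hφ⟩ := exists_ne (0 : K →ₗ[S] (C' ⊓ B : Submodule S S))
  let pr : S →ₗ[S] K := K.projectionOnto K' hK'
  -- A left linear endomorphism of S is right multiplication by the image of 1, and this image lies
  -- in Sb.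
  obtain ⟨c', hc'⟩ := Submodule.mem_span_singleton.mp (φ (pr 1)).2.2
  have hval : ∀ x, x * (a + (c + c') * b) = x * a' + (φ (pr x) : S) := by
    intro x
    have : (φ (pr x) : S) = x * (φ (pr 1) : S) := by
      conv_lhs => rw [← mul_one x, ← smul_eq_mul, map_smul, map_smul]
      rfl
    rw [this, ← hc', ha', smul_eq_mul]
    noncomm_ring
  have hle := hc (c + c')
  have hlt : LinearMap.ker (rightMul (a + (c + c') * b)) < K := by
    have hmem : ∀ x, x ∈ LinearMap.ker (rightMul (a + (c + c') * b)) →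
        x ∈ K ∧ φ (pr x) = 0 := by
      intro x hx
      have hx : x * (a + (c + c') * b) = 0 := hx
      rw [hval] at hx
      have h1 : x * a' ∈ I := ⟨x, rfl⟩
      have h2 : (φ (pr x) : S) ∈ C' ⊓ B := (φ (pr x)).2
      have h3 : x * a' = 0 := by
        have : x * a' = -(φ (pr x) : S) := eq_neg_of_add_eq_zero_left hx
        exact Submodule.disjoint_def.mp hC.disjoint _ h1 (this ▸ neg_mem h2)
      refine ⟨h3, ?_⟩
      rw [h3, zero_add] at hx
      exact Subtype.ext hx
    refine lt_of_le_of_ne (fun x hx => (hmem x hx).1) fun heq => hφ ?_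
    ext k
    have := (hmem k (heq.ge k.2)).2
    rw [show pr k = k from Submodule.projectionOnto_apply_left hK' k] at this
    rw [this]; rfl
  have : Nat.card (LinearMap.ker (rightMul (a + (c + c') * b))) < Nat.card K :=
    Set.Finite.card_lt_card (Set.toFinite _) (SetLike.coe_ssubset_coe.mpr hlt)
  exact absurd this (not_lt.mpr hle)

theorem isUnit_of_isUnit_mk_jacobson {R : Type*} [Ring R] [Finite R] (a : R)
    (h : IsUnit (Ideal.Quotient.mk (Ring.jacobson R) a)) : IsUnit a := by
  obtain ⟨v, hv⟩ := Ideal.Quotient.mk_surjective (↑h.unit⁻¹ : R ⧸ Ring.jacobson R)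
  have h1 : v * a - 1 ∈ Ideal.jacobson (⊥ : Ideal R) := by
    rw [Ideal.jacobson_bot, ← Ideal.Quotient.eq_zero_iff_mem, map_sub, map_mul, hv, map_one,
      sub_eq_zero]
    exact h.val_inv_mul
  obtain ⟨s, hs⟩ := Ideal.exists_mul_sub_mem_of_sub_one_mem_jacobson _ h1
  rw [Ideal.mem_bot, sub_eq_zero, ← mul_assoc] at hs
  have hinj : Function.Surjective (rightMul a) := fun y => ⟨y * (s * v), by
    change y * (s * v) * a = y
    rw [mul_assoc, hs, mul_one]⟩
  refine ⟨⟨a, s * v, Finite.injective_iff_surjective.mpr hinj ?_, hs⟩, rfl⟩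
  change a * (s * v) * a = 1 * a
  rw [mul_assoc, hs, mul_one, one_mul]

/-- A finite ring has stable range one. -/
theorem exists_add_mul_isUnit {R : Type*} [Ring R] [Finite R] (a b : R)
    (h : ∃ x y, x * a + y * b = 1) : ∃ c, IsUnit (a + c * b) := by
  obtain ⟨x, y, hxy⟩ := h
  have : IsArtinianRing R := inferInstance
  have : Finite (R ⧸ Ring.jacobson R) := Quotient.finite _
  let π := Ideal.Quotient.mk (Ring.jacobson R)
  obtain ⟨c, hc⟩ := exists_add_mul_isUnit_of_isSemisimpleRing (π a) (π b)
    ⟨π x, π y, by rw [← map_mul, ← map_mul, ← map_add, hxy, map_one]⟩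
  obtain ⟨c, rfl⟩ := Ideal.Quotient.mk_surjective c
  exact ⟨c, isUnit_of_isUnit_mk_jacobson _ (by rwa [map_add, map_mul])⟩

/-- A finite ring has stable range one; the version for right ideals. -/
theorem exists_add_mul_isUnit' {R : Type*} [Ring R] [Finite R] (a b : R)
    (h : ∃ x y, a * x + b * y = 1) : ∃ c, IsUnit (a + b * c) := by
  obtain ⟨x, y, hxy⟩ := h
  have : Finite Rᵐᵒᵖ := Finite.of_equiv R MulOpposite.opEquiv
  obtain ⟨c, hc⟩ := exists_add_mul_isUnit (MulOpposite.op a) (MulOpposite.op b)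
    ⟨MulOpposite.op x, MulOpposite.op y, by rw [← MulOpposite.op_mul, ← MulOpposite.op_mul,
      ← MulOpposite.op_add, hxy, MulOpposite.op_one]⟩
  refine ⟨c.unop, ?_⟩
  simpa using hc.unop

/-! ### Reduction modulo two -/

section Reduction

variable {S R : Type u} [Ring S] [Ring R] {q : S →+* R}

/-- A semilinear map `π : Y → M` exhibiting `M` as `Y / 2Y`. -/
structure IsReduction {Y M : Type*} [AddCommGroup Y] [Module S Y] [AddCommGroup M] [Module R M]
    (π : Y →ₛₗ[q] M) : Prop where
  surjective : Function.Surjective π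
  map_eq_zero : ∀ y, π y = 0 ↔ ∃ w, y = w + w

/-- The ring homomorphism `q : S → R` exhibits `R` as `S / 2S`. -/
def IsModTwo (q : S →+* R) : Prop := IsReduction q.toSemilinearMap

variable {Y Y' M M' : Type*} [AddCommGroup Y] [Module S Y] [AddCommGroup Y'] [Module S Y']
  [AddCommGroup M] [Module R M] [AddCommGroup M'] [Module R M']

/-- The product of two semilinear maps. -/
def semiProd (π : Y →ₛₗ[q] M) (π' : Y' →ₛₗ[q] M') : (Y × Y') →ₛₗ[q] (M × M') where
  toFun x := (π x.1, π' x.2)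
  map_add' x y := by simp
  map_smul' a x := by simp

@[simp] theorem semiProd_apply (π : Y →ₛₗ[q] M) (π' : Y' →ₛₗ[q] M') (x : Y × Y') :
    semiProd π π' x = (π x.1, π' x.2) := rfl

/-- The coordinatewise semilinear map `Sⁿ → Rⁿ` given by `q`. -/
def semiPi (q : S →+* R) (n : ℕ) : (Fin n → S) →ₛₗ[q] (Fin n → R) where
  toFun x := fun i => q (x i)
  map_add' x y := by ext; simp
  map_smul' a x := by ext; simp

@[simp] theorem semiPi_apply (q : S →+* R) (n : ℕ) (x : Fin n → S) (i : Fin n) :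
    semiPi q n x i = q (x i) := rfl

/-- A semilinear map followed by a linear equivalence. -/
def semiComp (a : M ≃ₗ[R] M') (π : Y →ₛₗ[q] M) : Y →ₛₗ[q] M' := a.toLinearMap.comp π

@[simp] theorem semiComp_apply (a : M ≃ₗ[R] M') (π : Y →ₛₗ[q] M) (y : Y) :
    semiComp a π y = a (π y) := rfl

theorem IsReduction.semiProd {π : Y →ₛₗ[q] M} {π' : Y' →ₛₗ[q] M'} (h : IsReduction π)
    (h' : IsReduction π') : IsReduction (semiProd π π') where
  surjective := fun ⟨m, m'⟩ => by
    obtain ⟨y, rfl⟩ := h.surjective m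
    obtain ⟨y', rfl⟩ := h'.surjective m'
    exact ⟨(y, y'), rfl⟩
  map_eq_zero := fun ⟨y, y'⟩ => by
    rw [semiProd_apply, Prod.mk_eq_zero, h.map_eq_zero, h'.map_eq_zero]
    constructor
    · rintro ⟨⟨a, rfl⟩, b, rfl⟩
      exact ⟨(a, b), rfl⟩
    · rintro ⟨⟨a, b⟩, h⟩
      exact ⟨⟨a, congrArg Prod.fst h⟩, b, congrArg Prod.snd h⟩

theorem IsReduction.semiPi (h : IsModTwo q) (n : ℕ) : IsReduction (semiPi q n) where
  surjective := fun m => by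
    choose y hy using fun i => h.surjective (m i)
    exact ⟨y, funext hy⟩
  map_eq_zero := fun y => by
    constructor
    · intro hy
      choose w hw using fun i => (h.map_eq_zero (y i)).mp (congrFun hy i)
      exact ⟨w, funext hw⟩
    · rintro ⟨w, rfl⟩
      ext i
      exact (h.map_eq_zero _).mpr ⟨w i, rfl⟩

theorem IsReduction.semiComp {π : Y →ₛₗ[q] M} (h : IsReduction π) (a : M ≃ₗ[R] M') :
    IsReduction (semiComp a π) where
  surjective := a.surjective.comp h.surjective
  map_eq_zero y := by simp [h.map_eq_zero]

/-- A linear map between reduced modules induces a linear map of the reductions. -/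
theorem IsReduction.exists_desc {π : Y →ₛₗ[q] M} {π' : Y' →ₛₗ[q] M'} (h : IsReduction π)
    (h' : IsReduction π') (hq : Function.Surjective q) (f : Y →ₗ[S] Y') :
    ∃ c : M →ₗ[R] M', ∀ y, π' (f y) = c (π y) := by
  have key : ∀ y z, π y = π z → π' (f y) = π' (f z) := by
    intro y z hyz
    rw [← sub_eq_zero, ← map_sub, h.map_eq_zero] at hyz
    obtain ⟨w, hw⟩ := hyz
    rw [← sub_eq_zero, ← map_sub, ← map_sub, hw, h'.map_eq_zero]
    exact ⟨f w, map_add _ _ _⟩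
  refine ⟨{ toFun := fun m => π' (f (Function.surjInv h.surjective m))
            map_add' := fun a b => ?_
            map_smul' := fun r a => ?_ }, fun y => key _ _ ?_⟩
  · rw [← map_add, ← map_add]
    exact key _ _ (by simp [Function.surjInv_eq])
  · obtain ⟨s, rfl⟩ := hq r
    rw [RingHom.id_apply, ← map_smulₛₗ, ← map_smul]
    exact key _ _ (by simp [Function.surjInv_eq])
  · exact (Function.surjInv_eq h.surjective _).symm

/-- Isomorphic modules have isomorphic reductions. -/
theorem IsReduction.exists_equiv {π : Y →ₛₗ[q] M} {π' : Y' →ₛₗ[q] M'} (h : IsReduction π)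
    (h' : IsReduction π') (hq : Function.Surjective q) (f : Y ≃ₗ[S] Y') :
    ∃ c : M ≃ₗ[R] M', ∀ y, π' (f y) = c (π y) := by
  obtain ⟨c, hc⟩ := h.exists_desc h' hq f.toLinearMap
  obtain ⟨d, hd⟩ := h'.exists_desc h hq f.symm.toLinearMap
  refine ⟨LinearEquiv.ofLinearMap c d ?_ ?_, hc⟩
  · ext m
    obtain ⟨y, rfl⟩ := h'.surjective m
    simp [← hd, ← hc]
  · ext m
    obtain ⟨y, rfl⟩ := h.surjective m
    simp [← hc, ← hd]

/-- Restricting scalars along `q` turns `M` into an S-module, and projectivity of `Y'` lifts f ∘ π'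
through π. -/
theorem IsReduction.exists_lift {π : Y →ₛₗ[q] M} (h : IsReduction π) (π' : Y' →ₛₗ[q] M')
    [Module.Projective S Y'] (f : M' →ₗ[R] M) : ∃ F : Y' →ₗ[S] Y, ∀ y, π (F y) = f (π' y) := by
  let _ : Module S M := Module.compHom M q
  let πl : Y →ₗ[S] M :=
    { toFun := π, map_add' := map_add π, map_smul' := fun s y => map_smulₛₗ π s y }
  let gl : Y' →ₗ[S] M :=
    { toFun := fun y => f (π' y)
      map_add' := by simp
      map_smul' := fun s y => by
        rw [map_smulₛₗ, map_smul]; rfl }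
  obtain ⟨F, hF⟩ := Module.projective_lifting_property πl gl h.surjective
  exact ⟨F, fun y => LinearMap.congr_fun hF y⟩

/-- The automorphisms of `M` induced by automorphisms of `Y` along `π : Y → M`. -/
def liftable (π : Y →ₛₗ[q] M) : Subgroup (M ≃ₗ[R] M) where
  carrier := {a | ∃ A : Y ≃ₗ[S] Y, ∀ y, π (A y) = a (π y)}
  mul_mem' := by
    rintro a b ⟨A, hA⟩ ⟨B, hB⟩
    exact ⟨A * B, fun y => by rw [LinearEquiv.mul_apply, hA, hB]; rfl⟩
  one_mem' := ⟨1, fun y => rfl⟩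
  inv_mem' := by
    rintro a ⟨A, hA⟩
    exact ⟨A⁻¹, fun y => a.injective (by
      rw [← hA]
      change π (A (A.symm y)) = a (a.symm (π y))
      simp)⟩

/-- Transport of structure; it is used throughout to permute and regroup the factors of a product.
-/
theorem conj_mem_liftable {π : Y →ₛₗ[q] M} {π' : Y' →ₛₗ[q] M'} (σ : Y ≃ₗ[S] Y')
    (τ : M ≃ₗ[R] M') (h : ∀ y, π' (σ y) = τ (π y)) {a : M ≃ₗ[R] M} (ha : a ∈ liftable π)
    {b : M' ≃ₗ[R] M'} (hb : ∀ m, b (τ m) = τ (a m)) : b ∈ liftable π' := by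
  obtain ⟨A, hA⟩ := ha
  refine ⟨σ.symm.trans (A.trans σ), fun y => ?_⟩
  obtain ⟨y, rfl⟩ := σ.surjective y
  simp [h, hA, hb]

theorem prodCongr_mem_liftable {π : Y →ₛₗ[q] M} {π' : Y' →ₛₗ[q] M'} {a : M ≃ₗ[R] M}
    {b : M' ≃ₗ[R] M'} (ha : a ∈ liftable π) (hb : b ∈ liftable π') :
    a.prodCongr b ∈ liftable (semiProd π π') := by
  obtain ⟨A, hA⟩ := ha
  obtain ⟨B, hB⟩ := hb
  exact ⟨A.prodCongr B, fun y => by simp [hA, hB]⟩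

end Reduction

/-! ### Elementary automorphisms -/

section Elementary

variable {R : Type*} [Ring R] {M N K : Type*} [AddCommGroup M] [Module R M] [AddCommGroup N]
  [Module R N] [AddCommGroup K] [Module R K]

/-- The automorphism `(m, n) ↦ (m + f n, n)`. -/
def shearFst (f : N →ₗ[R] M) : (M × N) ≃ₗ[R] (M × N) where
  toFun x := (x.1 + f x.2, x.2)
  invFun x := (x.1 - f x.2, x.2)
  map_add' x y := by simp [add_add_add_comm]
  map_smul' a x := by simp
  left_inv x := by simp
  right_inv x := by simp

/-- The automorphism `(m, n) ↦ (m, n + f m)`. -/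
def shearSnd (f : M →ₗ[R] N) : (M × N) ≃ₗ[R] (M × N) where
  toFun x := (x.1, x.2 + f x.1)
  invFun x := (x.1, x.2 - f x.1)
  map_add' x y := by simp [add_add_add_comm]
  map_smul' a x := by simp
  left_inv x := by simp
  right_inv x := by simp

@[simp] theorem shearFst_apply (f : N →ₗ[R] M) (x : M × N) :
    shearFst f x = (x.1 + f x.2, x.2) := rfl

@[simp] theorem shearSnd_apply (f : M →ₗ[R] N) (x : M × N) :
    shearSnd f x = (x.1, x.2 + f x.1) := rfl

variable (R M N) in
/-- The group generated by the shears of `M × N`. -/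
def elementary : Subgroup ((M × N) ≃ₗ[R] (M × N)) :=
  Subgroup.closure (Set.range shearFst ∪ Set.range shearSnd)

theorem shearFst_mem (f : N →ₗ[R] M) : shearFst f ∈ elementary R M N :=
  Subgroup.subset_closure (Or.inl ⟨f, rfl⟩)

theorem shearSnd_mem (f : M →ₗ[R] N) : shearSnd f ∈ elementary R M N :=
  Subgroup.subset_closure (Or.inr ⟨f, rfl⟩)

/-- Whitehead's lemma. -/
theorem prodCongr_inv_mem_elementary (a : N ≃ₗ[R] N) :
    a.prodCongr a⁻¹ ∈ elementary R N N := by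
  have hinv : ∀ x, a⁻¹ x = a.symm x := fun _ => rfl
  have key : ∀ b : N ≃ₗ[R] N, shearFst b.toLinearMap * shearSnd (-b.symm.toLinearMap) *
      shearFst b.toLinearMap ∈ elementary R N N := fun b =>
    mul_mem (mul_mem (shearFst_mem _) (shearSnd_mem _)) (shearFst_mem _)
  -- The product in `key b` is the antidiagonal matrix w(b) with entries b and -b⁻¹, and diag(a,
  -- a⁻¹) = w(a) w(-1).
  convert! mul_mem (key a) (key (LinearEquiv.neg R)) using 1
  ext x <;> simp [hinv]

/-- Over a finite ring, an isomorphism `K × R ≅ M × R` becomes diagonal after composing with an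
elementary automorphism, if `M` has a unimodular element. -/
theorem exists_elementary_mul_eq [Finite R] (ε : M) (ε' : M →ₗ[R] R) (hε : ε' ε = 1)
    (e : (K × R) ≃ₗ[R] (M × R)) :
    ∃ h ∈ elementary R M R, ∃ κ : K ≃ₗ[R] M, ∀ k r, h (e (k, r)) = (κ k, r) := by
  obtain ⟨h, hh, h01⟩ : ∃ h ∈ elementary R M R, h (e (0, 1)) = (0, 1) := by
    obtain ⟨a, b, hab⟩ : ∃ a b, e (0, 1) = (a, b) := ⟨_, _, rfl⟩
    -- Applying the last coordinate of e⁻¹ to (a, b) = e(0, 1) gives b c + φ(a) = 1, which is the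
    -- input for stable range one.
    let φ : M →ₗ[R] R := LinearMap.snd R K R ∘ₗ e.symm.toLinearMap ∘ₗ LinearMap.inl R M R
    obtain ⟨c, hc⟩ : ∃ c, b * c + φ a * 1 = 1 := by
      refine ⟨(e.symm (0, 1)).2, ?_⟩
      have h1 : (e.symm (a, b)).2 = 1 := by rw [← hab]; simp
      have h2 : ((a, b) : M × R) = b • ((0, 1) : M × R) + (a, 0) := by simp
      rw [h2, map_add, map_smul] at h1
      simpa [φ] using h1
    obtain ⟨t, v, hv⟩ := exists_add_mul_isUnit' b (φ a) ⟨c, 1, hc⟩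
    let rm : R → (R →ₗ[R] R) := fun t => LinearMap.toSpanSingleton R R t
    -- Read from right to left, the shears send (a, b) to (a, v), (ε, v), (ε, 1) and (0, 1). The
    -- unimodular element ε is what allows the unit v to be replaced by 1.
    refine ⟨shearFst (LinearMap.toSpanSingleton R M (-ε)) *
      shearSnd (LinearMap.toSpanSingleton R R (1 - v) ∘ₗ ε') *
      shearFst (LinearMap.toSpanSingleton R M ((↑v⁻¹ : R) • (ε - a))) *
      shearSnd (LinearMap.toSpanSingleton R R t ∘ₗ φ), mul_mem (mul_mem (mul_mem
        (shearFst_mem _) (shearSnd_mem _)) (shearFst_mem _)) (shearSnd_mem _), ?_⟩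
    rw [hab]
    have hv' : b + φ a * t = v := hv.symm
    simp [hv', smul_smul, hε]
  have hhe : ∀ k r, h (e (k, r)) = ((h (e (k, 0))).1, (h (e (k, 0))).2 + r) := by
    intro k r
    have : ((k, r) : K × R) = (k, 0) + r • (0, 1) := by simp
    rw [this, map_add, map_smul, map_add, map_smul, h01]
    ext <;> simp
  let he : (K × R) ≃ₗ[R] (M × R) := e.trans h
  have hhe' : ∀ k r, he (k, r) = ((h (e (k, 0))).1, (h (e (k, 0))).2 + r) := hhe
  let κl : K →ₗ[R] M := LinearMap.fst R M R ∘ₗ he.toLinearMap ∘ₗ LinearMap.inl R K R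
  have hκ : Function.Bijective κl := by
    constructor
    · rw [injective_iff_map_eq_zero]
      intro k hk
      have hk : (h (e (k, 0))).1 = 0 := hk
      have : he (k, -(h (e (k, 0))).2) = 0 := by rw [hhe', hk]; simp
      rw [he.map_eq_zero_iff] at this
      exact congrArg Prod.fst this
    · intro m
      obtain ⟨⟨k, r⟩, hk⟩ := he.surjective (m, 0)
      exact ⟨k, by rw [hhe'] at hk; exact congrArg Prod.fst hk⟩
  let κ := LinearEquiv.ofBijective κl hκ
  let χ : K →ₗ[R] R := LinearMap.snd R M R ∘ₗ he.toLinearMap ∘ₗ LinearMap.inl R K R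
  -- With the last basis vector fixed, h ∘ e is block triangular; this final shear removes the
  -- off-diagonal block χ.
  refine ⟨shearSnd (-(χ ∘ₗ κ.symm.toLinearMap)) * h, mul_mem (shearSnd_mem _) hh, κ, ?_⟩
  intro k r
  rw [LinearEquiv.mul_apply, hhe k r]
  have h1 : κ k = (h (e (k, 0))).1 := rfl
  have h2 : χ k = (h (e (k, 0))).2 := rfl
  rw [← h1, ← h2]
  simp

end Elementary

section UniversallyLiftable

variable {S R : Type u} [Ring S] [Ring R] {q : S →+* R}

theorem elementary_le_liftable {Y Y' M N : Type*} [AddCommGroup Y] [Module S Y]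
    [AddCommGroup Y'] [Module S Y'] [AddCommGroup M] [Module R M] [AddCommGroup N] [Module R N]
    [Module.Projective S Y] [Module.Projective S Y'] {π : Y →ₛₗ[q] M} {π' : Y' →ₛₗ[q] N}
    (h : IsReduction π) (h' : IsReduction π') :
    elementary R M N ≤ liftable (semiProd π π') := by
  rw [elementary, Subgroup.closure_le]
  rintro _ (⟨f, rfl⟩ | ⟨f, rfl⟩)
  · obtain ⟨F, hF⟩ := h.exists_lift π' f
    exact ⟨shearFst F, fun y => by simp [hF]⟩
  · obtain ⟨F, hF⟩ := h'.exists_lift π f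
    exact ⟨shearSnd F, fun y => by simp [hF]⟩

/-- The automorphisms of `M × Rᵐ` that lift along `π × qᵐ` for every reduction `π : Y → M` of a
projective module. -/
def univLiftable (R : Type u) [Ring R] (M : Type u) [AddCommGroup M] [Module R M] (m : ℕ) :
    Subgroup ((M × (Fin m → R)) ≃ₗ[R] (M × (Fin m → R))) where
  carrier := {h | ∀ ⦃S : Type u⦄ [Ring S] (q : S →+* R), IsModTwo q →
    ∀ ⦃Y : Type u⦄ [AddCommGroup Y] [Module S Y] [Module.Projective S Y] (π : Y →ₛₗ[q] M),
      IsReduction π → h ∈ liftable (semiProd π (semiPi q m))}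
  mul_mem' ha hb _ _ _ hq _ _ _ _ _ hπ := mul_mem (ha _ hq _ hπ) (hb _ hq _ hπ)
  one_mem' _ _ _ _ _ _ _ _ _ _ := one_mem _
  inv_mem' ha _ _ _ hq _ _ _ _ _ hπ := inv_mem (ha _ hq _ hπ)

/-- Conjugating by `a` amounts to replacing the reduction π by a⁻¹ ∘ π, which is again a reduction.
-/
theorem univLiftable_conj {M : Type u} [AddCommGroup M] [Module R M] {m : ℕ}
    {h : (M × (Fin m → R)) ≃ₗ[R] (M × (Fin m → R))} (hh : h ∈ univLiftable R M m)
    (a : M ≃ₗ[R] M) :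
    (a.prodCongr (LinearEquiv.refl R (Fin m → R))) * h *
      (a.prodCongr (LinearEquiv.refl R (Fin m → R)))⁻¹ ∈ univLiftable R M m := by
  intro S _ q hq Y _ _ _ π hπ
  refine conj_mem_liftable (LinearEquiv.refl S _) (a.prodCongr (LinearEquiv.refl R _)) ?_
    (hh q hq (semiComp a.symm π) (hπ.semiComp _)) ?_
  · intro y; simp
  · intro x
    change (a.prodCongr (LinearEquiv.refl R (Fin m → R)))
      (h ((a.prodCongr (LinearEquiv.refl R (Fin m → R))).symm
        ((a.prodCongr (LinearEquiv.refl R (Fin m → R))) x))) = _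
    rw [LinearEquiv.symm_apply_apply]

/-- `A × Aᵐ ≅ Aᵐ⁺¹`, placed behind a further factor. -/
def prodConsEquiv (A Y : Type*) [Ring A] [AddCommGroup Y] [Module A Y] (m : ℕ) :
    ((Y × (Fin m → A)) × A) ≃ₗ[A] (Y × (Fin (m + 1) → A)) :=
  (LinearEquiv.prodAssoc A Y (Fin m → A) A).trans <|
    (LinearEquiv.refl A Y).prodCongr <| (LinearEquiv.prodComm A (Fin m → A) A).trans <|
      Fin.consLinearEquiv A fun _ : Fin (m + 1) => A

@[simp] theorem prodConsEquiv_apply (A Y : Type*) [Ring A] [AddCommGroup Y] [Module A Y] (m : ℕ)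
    (y : Y) (x : Fin m → A) (a : A) :
    prodConsEquiv A Y m ((y, x), a) = (y, Fin.cons a x) := rfl

/-- Induction on `m`, stripping one copy of R at a time by stable range one. As the correction `h`
lifts for every ring with reduction R, the same `h` can later be realised over either factor of a
fibre square. -/
theorem exists_univLiftable_mul_eq [Finite R] {M : Type u} {K : Type*} [AddCommGroup M]
    [Module R M] [AddCommGroup K] [Module R K] (ε : M) (ε' : M →ₗ[R] R) (hε : ε' ε = 1) (m : ℕ)
    (e : (K × (Fin m → R)) ≃ₗ[R] (M × (Fin m → R))) :
    ∃ h ∈ univLiftable R M m, ∃ κ : K ≃ₗ[R] M, ∀ k x, h (e (k, x)) = (κ k, x) := by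
  induction m with
  | zero =>
    refine ⟨1, one_mem _, (LinearEquiv.prodUnique (M₂ := Fin 0 → R)).symm.trans (e.trans
      (LinearEquiv.prodUnique (M₂ := Fin 0 → R))), fun k x => ?_⟩
    ext i
    · simp [Subsingleton.elim x default]
    · exact i.elim0
  | succ m ih =>
    obtain ⟨h₁, hh₁, κ₁, hκ₁⟩ := exists_elementary_mul_eq (M := M × (Fin m → R))
      (K := K × (Fin m → R)) (ε, 0) (ε' ∘ₗ LinearMap.fst R _ _) hε
      ((prodConsEquiv R K m).trans (e.trans (prodConsEquiv R M m).symm))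
    obtain ⟨h₂, hh₂, κ, hκ⟩ := ih κ₁
    refine ⟨(prodConsEquiv R M m).symm.trans
      ((h₂.prodCongr (LinearEquiv.refl R R) * h₁).trans (prodConsEquiv R M m)), ?_, κ, ?_⟩
    · intro S _ q hq Y _ _ _ π hπ
      refine conj_mem_liftable (prodConsEquiv S Y m) (prodConsEquiv R M m) ?_
        (a := h₂.prodCongr (LinearEquiv.refl R R) * h₁)
        (π := semiProd (semiProd π (semiPi q m)) q.toSemilinearMap) ?_ ?_
      · rintro ⟨⟨y, x⟩, a⟩
        refine Prod.ext rfl ?_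
        ext i
        refine Fin.cases ?_ (fun i => ?_) i <;> simp
      · exact mul_mem (prodCongr_mem_liftable (hh₂ q hq π hπ) (one_mem _))
          (elementary_le_liftable (hπ.semiProd (.semiPi hq m)) hq hh₁)
      · intro x; simp
    · intro k x
      have := hκ₁ (k, Fin.tail x) (x 0)
      simp only [LinearEquiv.trans_apply, prodConsEquiv_apply, Fin.cons_self_tail] at this ⊢
      rw [LinearEquiv.mul_apply, this]
      simp [hκ]

end UniversallyLiftable

/-! ### Stably liftable automorphisms -/

section StablyLiftable

variable {S R : Type u} [Ring S] [Ring R] {q : S →+* R}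

/-- The exchange of the last two factors of a triple product. -/
def prodRightComm (A B C D : Type*) [Ring A] [AddCommGroup B] [Module A B] [AddCommGroup C]
    [Module A C] [AddCommGroup D] [Module A D] : ((B × C) × D) ≃ₗ[A] ((B × D) × C) where
  toFun x := ((x.1.1, x.2), x.1.2)
  invFun x := ((x.1.1, x.2), x.1.2)
  map_add' _ _ := rfl
  map_smul' _ _ := rfl
  left_inv _ := rfl
  right_inv _ := rfl

variable {Y Y' Y'' M M' M'' : Type*} [AddCommGroup Y] [Module S Y] [AddCommGroup Y'] [Module S Y']
  [AddCommGroup M] [Module R M] [AddCommGroup M'] [Module R M']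
  [AddCommGroup Y''] [Module S Y''] [AddCommGroup M''] [Module R M'']

theorem insert_mem_liftable {π : Y →ₛₗ[q] M} (π' : Y' →ₛₗ[q] M') {ρ : Y'' →ₛₗ[q] M''}
    {a : M ≃ₗ[R] M} {b : M'' ≃ₗ[R] M''} (h : a.prodCongr b ∈ liftable (semiProd π ρ)) :
    (a.prodCongr (LinearEquiv.refl R M')).prodCongr b ∈
      liftable (semiProd (semiProd π π') ρ) :=
  conj_mem_liftable (prodRightComm S Y Y'' Y') (prodRightComm R M M'' M') (fun _ => rfl)
    (prodCongr_mem_liftable h (one_mem (liftable π'))) (fun _ => rfl)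

/-- `Y` is a direct summand of some Sⁿ, and an automorphism of `Y × S` extends by the identity on
the complement. Thus testing stable liftability on finitely generated projective modules instead of
free ones gives nothing new. -/
theorem exists_free_mem_liftable [Module.Projective S Y] [Module.Finite S Y]
    {π : Y →ₛₗ[q] M} (hπ : IsReduction π) (hq : IsModTwo q) {a : R ≃ₗ[R] R}
    (h : (LinearEquiv.refl R M).prodCongr a ∈ liftable (semiProd π q.toSemilinearMap)) :
    ∃ n, (LinearEquiv.refl R (Fin n → R)).prodCongr a ∈
      liftable (semiProd (semiPi q n) q.toSemilinearMap) := by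
  obtain ⟨n, f, g, -, -, hfg⟩ := Module.Finite.exists_comp_eq_id_of_projective S Y
  have hfg : ∀ y, f (g y) = y := fun y => LinearMap.congr_fun hfg y
  obtain ⟨A, hA⟩ := h
  let ext (A : (Y × S) ≃ₗ[S] (Y × S)) : ((Fin n → S) × S) →ₗ[S] ((Fin n → S) × S) :=
    { toFun := fun x => (x.1 - g (f x.1) + g (A (f x.1, x.2)).1, (A (f x.1, x.2)).2)
      map_add' := fun x y => by
        have : (f (x + y).1, (x + y).2) = (f x.1, x.2) + (f y.1, y.2) := by simp
        rw [this, map_add]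
        ext i
        · simp; abel
        · simp
      map_smul' := fun s x => by
        have : (f (s • x).1, (s • x).2) = s • (f x.1, x.2) := by simp
        rw [this, map_smul]
        ext i
        · simp [mul_sub]
        · simp }
  have hext : ∀ A x, ext A x = (x.1 - g (f x.1) + g (A (f x.1, x.2)).1, (A (f x.1, x.2)).2) :=
    fun A x => rfl
  have hinv : ∀ A x, ext A.symm (ext A x) = x := by
    intro A x
    have : f (x.1 - g (f x.1) + g (A (f x.1, x.2)).1) = (A (f x.1, x.2)).1 := by
      simp [hfg]
    rw [hext A x, hext, this]
    ext i <;> simp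
  let E : ((Fin n → S) × S) ≃ₗ[S] ((Fin n → S) × S) := LinearEquiv.ofLinearMap (ext A) (ext A.symm)
    (LinearMap.ext fun x => hinv A.symm x) (LinearMap.ext fun x => hinv A x)
  refine ⟨n, E, fun x => ?_⟩
  have hAx := hA (f x.1, x.2)
  simp only [semiProd_apply, LinearEquiv.prodCongr_apply, LinearEquiv.refl_apply] at hAx
  have h1 := congrArg Prod.fst hAx
  have h2 := congrArg Prod.snd hAx
  dsimp only at h1 h2
  rw [← sub_eq_zero, ← map_sub, hπ.map_eq_zero] at h1
  obtain ⟨w, hw⟩ := h1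
  refine Prod.ext ?_ h2
  change semiPi q n (x.1 - g (f x.1) + g (A (f x.1, x.2)).1) = semiPi q n x.1
  rw [← sub_eq_zero, ← map_sub, (IsReduction.semiPi hq n).map_eq_zero]
  -- The lift changes the `Y`-component by w + w, so its extension changes the Sⁿ-component by g w +
  -- g w.
  refine ⟨g w, ?_⟩
  rw [← map_add, ← hw, map_sub]
  abel

/-- The automorphisms `a` of `R` such that `1 × a` on `Rⁿ × R` is induced from an automorphism of
`Sⁿ × S` for some `n`. -/
def stablyLiftable (q : S →+* R) (hq : IsModTwo q) : Subgroup (R ≃ₗ[R] R) where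
  carrier := {a | ∃ n, (LinearEquiv.refl R (Fin n → R)).prodCongr a ∈
      liftable (semiProd (semiPi q n) q.toSemilinearMap)}
  one_mem' := ⟨0, one_mem _⟩
  inv_mem' := by
    rintro a ⟨n, h⟩
    exact ⟨n, inv_mem h⟩
  mul_mem' := by
    rintro a b ⟨m, ha⟩ ⟨n, hb⟩
    -- Both lifts are enlarged to the common module Sᵐ × Sⁿ before they are multiplied.
    refine exists_free_mem_liftable (π := semiProd (semiPi q m) (semiPi q n))
      ((IsReduction.semiPi hq m).semiProd (.semiPi hq n)) hq ?_
    have h₁ := insert_mem_liftable (semiPi q n) ha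
    have h₂ : ((LinearEquiv.refl R (Fin m → R)).prodCongr (LinearEquiv.refl R (Fin n → R))).prodCongr
        b ∈ liftable (semiProd (semiProd (semiPi q m) (semiPi q n)) q.toSemilinearMap) :=
      conj_mem_liftable
        ((LinearEquiv.prodComm S (Fin n → S) (Fin m → S)).prodCongr (LinearEquiv.refl S S))
        ((LinearEquiv.prodComm R (Fin n → R) (Fin m → R)).prodCongr (LinearEquiv.refl R R))
        (fun _ => rfl) (insert_mem_liftable (semiPi q m) hb) (fun _ => rfl)
    exact mul_mem h₁ h₂

/-- Multiplying by the liftable automorphism diag(κ⁻¹, κ) moves κ from the factor under `Y` to an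
extra factor R, so stable liftability does not depend on `Y`. -/
theorem mem_stablyLiftable_of_prodCongr [Module.Projective S Y] [Module.Finite S Y]
    {π : Y →ₛₗ[q] R} (hπ : IsReduction π) (hq : IsModTwo q) {m : ℕ} {κ : R ≃ₗ[R] R}
    (h : κ.prodCongr (LinearEquiv.refl R (Fin m → R)) ∈ liftable (semiProd π (semiPi q m))) :
    κ ∈ stablyLiftable q hq := by
  refine exists_free_mem_liftable (π := semiProd π (semiPi q m))
    (hπ.semiProd (.semiPi hq m)) hq ?_
  have h₁ := prodCongr_mem_liftable h (one_mem (liftable q.toSemilinearMap))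
  have h₂ := insert_mem_liftable (semiPi q m)
    (elementary_le_liftable hπ hq (prodCongr_inv_mem_elementary κ⁻¹))
  convert! mul_mem h₁ h₂ using 1
  ext x <;> simp [LinearEquiv.mul_apply]

theorem exists_prodCongr_mem_liftable [Module.Projective S Y]
    {π : Y →ₛₗ[q] R} (hπ : IsReduction π) (hq : IsModTwo q) {κ : R ≃ₗ[R] R}
    (h : κ ∈ stablyLiftable q hq) :
    ∃ m, κ.prodCongr (LinearEquiv.refl R (Fin m → R)) ∈ liftable (semiProd π (semiPi q m)) := by
  obtain ⟨n, hn⟩ := h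
  refine ⟨n + 1, ?_⟩
  have h₁ := insert_mem_liftable (semiPi q n)
    (elementary_le_liftable hπ hq (prodCongr_inv_mem_elementary κ))
  have h₂ : ((LinearEquiv.refl R R).prodCongr (LinearEquiv.refl R (Fin n → R))).prodCongr κ ∈
      liftable (semiProd (semiProd π (semiPi q n)) q.toSemilinearMap) :=
    conj_mem_liftable (LinearEquiv.prodAssoc S Y (Fin n → S) S).symm
      (LinearEquiv.prodAssoc R R (Fin n → R) R).symm (fun _ => rfl)
      (prodCongr_mem_liftable (one_mem (liftable π)) hn) (fun _ => rfl)
  refine conj_mem_liftable (prodConsEquiv S Y n) (prodConsEquiv R R n) ?_ (mul_mem h₁ h₂) ?_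
  · rintro ⟨⟨y, x⟩, a⟩
    refine Prod.ext rfl ?_
    ext i
    refine Fin.cases ?_ (fun i => ?_) i <;> simp
  · rintro ⟨⟨y, x⟩, a⟩
    simp [LinearEquiv.mul_apply]

/-- Matrices diag(c⁻¹, c) lift by Whitehead's lemma, and multiplying those for a, b and a⁻¹b⁻¹ gives
diag(1, aba⁻¹b⁻¹). Normality of `stablyLiftable` follows. -/
theorem commutator_mem_stablyLiftable (hq : IsModTwo q) (a b : R ≃ₗ[R] R) :
    a * b * a⁻¹ * b⁻¹ ∈ stablyLiftable q hq := by
  refine exists_free_mem_liftable (π := q.toSemilinearMap) hq hq ?_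
  have key : ∀ c : R ≃ₗ[R] R, c⁻¹.prodCongr c ∈
      liftable (semiProd q.toSemilinearMap q.toSemilinearMap) := fun c =>
    elementary_le_liftable hq hq (by simpa using prodCongr_inv_mem_elementary c⁻¹)
  convert! mul_mem (mul_mem (key a) (key b)) (key (a⁻¹ * b⁻¹)) using 1
  ext <;> simp [LinearEquiv.mul_apply]

theorem normal_of_commutator_mem {G : Type*} [Group G] (P : Subgroup G)
    (h : ∀ a b : G, a * b * a⁻¹ * b⁻¹ ∈ P) : P.Normal :=
  ⟨fun n hn g => by simpa [mul_assoc] using mul_mem (h g n) hn⟩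

end StablyLiftable

/-! ### Fibre squares of rings and glued modules -/

/-- A pullback square of rings `Λ = Λ₁ ×_R Λ₂` in which `R` is the reduction modulo two of both
`Λ₁` and `Λ₂`. -/
structure FiberSquare (Λ Λ₁ Λ₂ R : Type u) [Ring Λ] [Ring Λ₁] [Ring Λ₂] [Ring R] where
  p₁ : Λ →+* Λ₁
  p₂ : Λ →+* Λ₂
  q₁ : Λ₁ →+* R
  q₂ : Λ₂ →+* R
  comm : ∀ x, q₁ (p₁ x) = q₂ (p₂ x)
  inj : ∀ x, p₁ x = 0 → p₂ x = 0 → x = 0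
  lift : ∀ a b, q₁ a = q₂ b → ∃ x, p₁ x = a ∧ p₂ x = b
  red₁ : IsModTwo q₁
  red₂ : IsModTwo q₂

/-- `Y` has no element of order two. -/
def NoTwoTorsion (Y : Type*) [AddCommGroup Y] : Prop := ∀ y : Y, y + y = 0 → y = 0

theorem NoTwoTorsion.prod {Y Z : Type*} [AddCommGroup Y] [AddCommGroup Z] (hY : NoTwoTorsion Y)
    (hZ : NoTwoTorsion Z) : NoTwoTorsion (Y × Z) := fun _ h =>
  Prod.ext (hY _ (congrArg Prod.fst h)) (hZ _ (congrArg Prod.snd h))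

theorem NoTwoTorsion.pi {Y : Type*} [AddCommGroup Y] (hY : NoTwoTorsion Y) (n : ℕ) :
    NoTwoTorsion (Fin n → Y) := fun _ h => funext fun i => hY _ (congrFun h i)

theorem NoTwoTorsion.of_injective {Y Z F : Type*} [AddCommGroup Y] [AddCommGroup Z] [FunLike F Y Z]
    [AddMonoidHomClass F Y Z] (hZ : NoTwoTorsion Z) (f : F) (hf : Function.Injective f) :
    NoTwoTorsion Y := fun y hy => (map_eq_zero_iff f hf).mp (hZ _ (by rw [← map_add, hy, map_zero]))

namespace FiberSquare

variable {Λ Λ₁ Λ₂ R : Type u} [Ring Λ] [Ring Λ₁] [Ring Λ₂] [Ring R]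

/-- The square with the roles of `Λ₁` and `Λ₂` exchanged. -/
abbrev symm (D : FiberSquare Λ Λ₁ Λ₂ R) : FiberSquare Λ Λ₂ Λ₁ R where
  p₁ := D.p₂
  p₂ := D.p₁
  q₁ := D.q₂
  q₂ := D.q₁
  comm x := (D.comm x).symm
  inj x h₁ h₂ := D.inj x h₂ h₁
  lift a b h := (D.lift b a h.symm).imp fun _ h => h.symm
  red₁ := D.red₂
  red₂ := D.red₁

variable (D : FiberSquare Λ Λ₁ Λ₂ R)

theorem surjective_p₁ : Function.Surjective D.p₁ := fun a => by
  obtain ⟨b, hb⟩ := D.red₂.surjective (D.q₁ a)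
  obtain ⟨x, hx, -⟩ := D.lift a b hb.symm
  exact ⟨x, hx⟩

theorem surjective_p₂ : Function.Surjective D.p₂ := D.symm.surjective_p₁

theorem ext {x y : Λ} (h₁ : D.p₁ x = D.p₁ y) (h₂ : D.p₂ x = D.p₂ y) : x = y :=
  sub_eq_zero.mp (D.inj _ (by rw [map_sub, h₁, sub_self]) (by rw [map_sub, h₂, sub_self]))

theorem exists_t₁ : ∃ t, D.p₁ t = 2 ∧ D.p₂ t = 0 :=
  D.lift 2 0 (by rw [map_zero]; exact (D.red₁.map_eq_zero 2).mpr ⟨1, one_add_one_eq_two.symm⟩)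

/-- The element of `Λ` with components `(2, 0)`. -/
noncomputable def t₁ : Λ := D.exists_t₁.choose

/-- The element of `Λ` with components `(0, 2)`. -/
noncomputable def t₂ : Λ := D.symm.t₁

@[simp] theorem p₁_t₁ : D.p₁ D.t₁ = 2 := D.exists_t₁.choose_spec.1
@[simp] theorem p₂_t₁ : D.p₂ D.t₁ = 0 := D.exists_t₁.choose_spec.2
@[simp] theorem p₁_t₂ : D.p₁ D.t₂ = 0 := D.symm.p₂_t₁
@[simp] theorem p₂_t₂ : D.p₂ D.t₂ = 2 := D.symm.p₁_t₁

theorem t₁_comm (x : Λ) : D.t₁ * x = x * D.t₁ :=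
  D.ext (by simp [two_mul, mul_two]) (by simp)

theorem t₂_comm (x : Λ) : D.t₂ * x = x * D.t₂ := D.symm.t₁_comm x

theorem t₁_mul_t₂ : D.t₁ * D.t₂ = 0 := D.ext (by simp) (by simp)

theorem t₂_mul_t₁ : D.t₂ * D.t₁ = 0 := D.ext (by simp) (by simp)

theorem t₁_mul_t₁ : D.t₁ * D.t₁ = D.t₁ + D.t₁ := D.ext (by simp [two_mul]) (by simp)

theorem t₂_mul_t₂ : D.t₂ * D.t₂ = D.t₂ + D.t₂ := D.symm.t₁_mul_t₁

theorem t₁_add_t₂ : D.t₁ + D.t₂ = 1 + 1 := D.ext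
  (by simp [← one_add_one_eq_two]) (by simp [← one_add_one_eq_two])

/-- An element killed by (2, 0) has first component 0, so its second component reduces to 0 in R and
is a double. -/
theorem exists_eq_t₂_mul (h₁ : NoTwoTorsion Λ₁) {a : Λ} (ha : D.t₁ * a = 0) :
    ∃ b, a = D.t₂ * b := by
  have := congrArg D.p₁ ha
  simp only [map_mul, p₁_t₁, map_zero, two_mul] at this
  have e₁ := h₁ _ this
  obtain ⟨b, hb⟩ := (D.red₂.map_eq_zero (D.p₂ a)).mp ((D.comm a).symm.trans (by rw [e₁, map_zero]))
  obtain ⟨b, rfl⟩ := D.surjective_p₂ b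
  exact ⟨b, D.ext (by simp [e₁]) (by simp [hb, two_mul])⟩

section Glue

variable {Y Y' Z Z' M M' : Type u} [AddCommGroup Y] [Module Λ₁ Y] [AddCommGroup Z] [Module Λ₂ Z]
  [AddCommGroup M] [Module R M] [AddCommGroup Y'] [Module Λ₁ Y'] [AddCommGroup Z'] [Module Λ₂ Z']
  [AddCommGroup M'] [Module R M']

/-- The subgroup of `Y × Z` underlying the glued module. -/
def glueSubgroup (α : Y →ₛₗ[D.q₁] M) (β : Z →ₛₗ[D.q₂] M) : AddSubgroup (Y × Z) where
  carrier := {x | α x.1 = β x.2}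
  add_mem' {x y} (hx : _ = _) (hy : _ = _) := by
    change α (x.1 + y.1) = β (x.2 + y.2)
    rw [map_add, map_add, hx, hy]
  zero_mem' := by simp
  neg_mem' {x} (hx : _ = _) := by
    change α (-x.1) = β (-x.2)
    rw [map_neg, map_neg, hx]

/-- The `Λ`-module `Y ×_M Z` obtained by gluing a `Λ₁`-module and a `Λ₂`-module. -/
def Glue (α : Y →ₛₗ[D.q₁] M) (β : Z →ₛₗ[D.q₂] M) : Type u :=
  D.glueSubgroup α β

instance (α : Y →ₛₗ[D.q₁] M) (β : Z →ₛₗ[D.q₂] M) : AddCommGroup (D.Glue α β) :=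
  inferInstanceAs (AddCommGroup (D.glueSubgroup α β))

instance (α : Y →ₛₗ[D.q₁] M) (β : Z →ₛₗ[D.q₂] M) : Module Λ (D.Glue α β) where
  smul a x := ⟨(D.p₁ a • x.1.1, D.p₂ a • x.1.2), by
    change α (D.p₁ a • x.1.1) = β (D.p₂ a • x.1.2)
    rw [map_smulₛₗ, map_smulₛₗ, D.comm, show α x.1.1 = β x.1.2 from x.2]⟩
  one_smul x := Subtype.ext (Prod.ext (by
    change D.p₁ 1 • x.1.1 = x.1.1; simp) (by change D.p₂ 1 • x.1.2 = x.1.2; simp))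
  mul_smul a b x := Subtype.ext (Prod.ext (by
    change D.p₁ (a * b) • x.1.1 = D.p₁ a • D.p₁ b • x.1.1; rw [map_mul, mul_smul]) (by
    change D.p₂ (a * b) • x.1.2 = D.p₂ a • D.p₂ b • x.1.2; rw [map_mul, mul_smul]))
  smul_zero a := Subtype.ext (Prod.ext (smul_zero (D.p₁ a)) (smul_zero (D.p₂ a)))
  smul_add a x y := Subtype.ext (Prod.ext (smul_add (D.p₁ a) _ _) (smul_add (D.p₂ a) _ _))
  add_smul a b x := Subtype.ext (Prod.ext (by
    change D.p₁ (a + b) • x.1.1 = D.p₁ a • x.1.1 + D.p₁ b • x.1.1; rw [map_add, add_smul]) (by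
    change D.p₂ (a + b) • x.1.2 = D.p₂ a • x.1.2 + D.p₂ b • x.1.2; rw [map_add, add_smul]))
  zero_smul x := Subtype.ext (Prod.ext (by
    change D.p₁ 0 • x.1.1 = 0; simp) (by change D.p₂ 0 • x.1.2 = 0; simp))

variable {D}

namespace Glue

variable {α : Y →ₛₗ[D.q₁] M} {β : Z →ₛₗ[D.q₂] M} {α' : Y' →ₛₗ[D.q₁] M'} {β' : Z' →ₛₗ[D.q₂] M'}

/-- The element `(y, z)` of the glued module. -/
def mk (y : Y) (z : Z) (h : α y = β z) : D.Glue α β := ⟨(y, z), h⟩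

/-- The first component of an element of the glued module. -/
def fst (x : D.Glue α β) : Y := x.1.1

/-- The second component of an element of the glued module. -/
def snd (x : D.Glue α β) : Z := x.1.2

theorem condition (x : D.Glue α β) : α x.fst = β x.snd := x.2

@[ext] theorem ext {x y : D.Glue α β} (h₁ : x.fst = y.fst) (h₂ : x.snd = y.snd) : x = y :=
  Subtype.ext (Prod.ext h₁ h₂)

@[simp] theorem fst_mk (y : Y) (z : Z) (h : α y = β z) : (mk y z h : D.Glue α β).fst = y := rfl
@[simp] theorem snd_mk (y : Y) (z : Z) (h : α y = β z) : (mk y z h : D.Glue α β).snd = z := rfl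
@[simp] theorem fst_add (x y : D.Glue α β) : (x + y).fst = x.fst + y.fst := rfl
@[simp] theorem snd_add (x y : D.Glue α β) : (x + y).snd = x.snd + y.snd := rfl
@[simp] theorem fst_sub (x y : D.Glue α β) : (x - y).fst = x.fst - y.fst := rfl
@[simp] theorem snd_sub (x y : D.Glue α β) : (x - y).snd = x.snd - y.snd := rfl
@[simp] theorem fst_zero : (0 : D.Glue α β).fst = 0 := rfl
@[simp] theorem snd_zero : (0 : D.Glue α β).snd = 0 := rfl
@[simp] theorem fst_smul (a : Λ) (x : D.Glue α β) : (a • x).fst = D.p₁ a • x.fst := rfl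
@[simp] theorem snd_smul (a : Λ) (x : D.Glue α β) : (a • x).snd = D.p₂ a • x.snd := rfl

/-- Compatible linear maps induce a linear map of glued modules. -/
def map (φ : Y →ₗ[Λ₁] Y') (ψ : Z →ₗ[Λ₂] Z')
    (h : ∀ y z, α y = β z → α' (φ y) = β' (ψ z)) : D.Glue α β →ₗ[Λ] D.Glue α' β' where
  toFun x := mk (φ x.fst) (ψ x.snd) (h _ _ x.condition)
  map_add' x y := by ext <;> simp
  map_smul' a x := by ext <;> simp

@[simp] theorem fst_map (φ : Y →ₗ[Λ₁] Y') (ψ : Z →ₗ[Λ₂] Z')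
    (h : ∀ y z, α y = β z → α' (φ y) = β' (ψ z)) (x : D.Glue α β) :
    (map φ ψ h x).fst = φ x.fst := rfl

@[simp] theorem snd_map (φ : Y →ₗ[Λ₁] Y') (ψ : Z →ₗ[Λ₂] Z')
    (h : ∀ y z, α y = β z → α' (φ y) = β' (ψ z)) (x : D.Glue α β) :
    (map φ ψ h x).snd = ψ x.snd := rfl

/-- Compatible isomorphisms induce an isomorphism of glued modules. -/
def congr (φ : Y ≃ₗ[Λ₁] Y') (ψ : Z ≃ₗ[Λ₂] Z') (c : M ≃ₗ[R] M') (hφ : ∀ y, α' (φ y) = c (α y))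
    (hψ : ∀ z, β' (ψ z) = c (β z)) : D.Glue α β ≃ₗ[Λ] D.Glue α' β' :=
  LinearEquiv.ofLinearMap
    (map φ.toLinearMap ψ.toLinearMap fun y z h => by simp [hφ, hψ, h])
    (map φ.symm.toLinearMap ψ.symm.toLinearMap fun y z h => c.injective (by simp [← hφ, ← hψ, h]))
    (by ext x <;> simp) (by ext x <;> simp)

/-- Gluing commutes with products. -/
def prodEquiv : D.Glue (semiProd α α') (semiProd β β') ≃ₗ[Λ] (D.Glue α β × D.Glue α' β') where
  toFun x := (mk x.fst.1 x.snd.1 (congrArg Prod.fst x.condition),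
    mk x.fst.2 x.snd.2 (congrArg Prod.snd x.condition))
  invFun x := mk (x.1.fst, x.2.fst) (x.1.snd, x.2.snd) (Prod.ext x.1.condition x.2.condition)
  map_add' _ _ := rfl
  map_smul' _ _ := rfl
  left_inv _ := rfl
  right_inv _ := rfl

/-- Gluing exchanges its two arguments under the symmetry of the square. -/
def swap : D.Glue α β ≃ₗ[Λ] D.symm.Glue β α where
  toFun x := mk (D := D.symm) x.snd x.fst x.condition.symm
  invFun x := mk (D := D) x.snd x.fst x.condition.symm
  map_add' _ _ := rfl
  map_smul' _ _ := rfl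
  left_inv _ := rfl
  right_inv _ := rfl

variable (D) in
/-- The natural map from `Λⁿ` to the module glued from `Λ₁ⁿ` and `Λ₂ⁿ`. -/
def ofPi (n : ℕ) : (Fin n → Λ) →ₗ[Λ] D.Glue (semiPi D.q₁ n) (semiPi D.q₂ n) where
  toFun x := mk (fun i => D.p₁ (x i)) (fun i => D.p₂ (x i)) (funext fun i => D.comm (x i))
  map_add' x y := by ext i <;> simp
  map_smul' a x := by ext i <;> simp

variable (D) in
/-- `Λⁿ` is glued from `Λ₁ⁿ` and `Λ₂ⁿ`. -/
noncomputable def piEquiv (n : ℕ) :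
    D.Glue (semiPi D.q₁ n) (semiPi D.q₂ n) ≃ₗ[Λ] (Fin n → Λ) :=
  (LinearEquiv.ofBijective (ofPi D n) ⟨by
    intro x y h
    ext i
    exact D.ext (congrFun (congrArg fst h) i) (congrFun (congrArg snd h) i), by
    intro x
    choose y hy using fun i => D.lift (x.fst i) (x.snd i) (congrFun x.condition i)
    exact ⟨y, ext (funext fun i => (hy i).1) (funext fun i => (hy i).2)⟩⟩).symm

variable (D) in
/-- The natural map from `Λ` to the module glued from `Λ₁` and `Λ₂`. -/
def ofSelf : Λ →ₗ[Λ] D.Glue D.q₁.toSemilinearMap D.q₂.toSemilinearMap where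
  toFun x := mk (D.p₁ x) (D.p₂ x) (D.comm x)
  map_add' x y := ext (map_add D.p₁ x y) (map_add D.p₂ x y)
  map_smul' a x := ext (map_mul D.p₁ a x) (map_mul D.p₂ a x)

variable (D) in
/-- `Λ` is glued from `Λ₁` and `Λ₂`. -/
noncomputable def selfEquiv :
    D.Glue D.q₁.toSemilinearMap D.q₂.toSemilinearMap ≃ₗ[Λ] Λ :=
  (LinearEquiv.ofBijective (ofSelf D) ⟨by
    intro x y h
    exact D.ext (congrArg fst h) (congrArg snd h), by
    intro x
    obtain ⟨y, h₁, h₂⟩ := D.lift x.fst x.snd x.condition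
    exact ⟨y, ext h₁ h₂⟩⟩).symm

/-- Adding free summands to a glued module. -/
noncomputable def prodPiEquiv (m : ℕ) :
    D.Glue (semiProd α (semiPi D.q₁ m)) (semiProd β (semiPi D.q₂ m)) ≃ₗ[Λ]
      (D.Glue α β × (Fin m → Λ)) :=
  prodEquiv.trans ((LinearEquiv.refl Λ _).prodCongr (piEquiv D m))

/-- A linear map of glued modules induces a linear map of the first components. -/
theorem exists_fst (hβ : Function.Surjective β) (hY' : NoTwoTorsion Y')
    (φ : D.Glue α β →ₗ[Λ] D.Glue α' β') :
    ∃ φ₁ : Y →ₗ[Λ₁] Y', ∀ x, (φ x).fst = φ₁ x.fst := by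
  -- Multiplication by `t₁` kills elements with zero first component, and doubles first components
  -- in the target.
  have hzero : ∀ x : D.Glue α β, x.fst = 0 → (φ x).fst = 0 := by
    intro x hx
    have h₁ : D.t₁ • x = 0 := by ext <;> simp [hx]
    have h₂ := congrArg fst (congrArg φ h₁)
    rw [map_smul, fst_smul, p₁_t₁, map_zero, fst_zero, two_smul] at h₂
    exact hY' _ h₂
  have hwell : ∀ x x' : D.Glue α β, x.fst = x'.fst → (φ x).fst = (φ x').fst := by
    intro x x' h
    rw [← sub_eq_zero, ← fst_sub, ← map_sub]
    exact hzero _ (by rw [fst_sub, h, sub_self])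
  choose g hg using fun y => hβ (α y)
  let s : Y → D.Glue α β := fun y => mk y (g y) (hg y).symm
  refine ⟨{ toFun := fun y => (φ (s y)).fst
            map_add' := fun y y' => ?_
            map_smul' := fun a y => ?_ }, fun x => hwell _ _ rfl⟩
  · rw [← fst_add, ← map_add]
    exact hwell _ _ rfl
  · obtain ⟨a, rfl⟩ := D.surjective_p₁ a
    rw [RingHom.id_apply, ← fst_smul, ← map_smul]
    exact hwell _ _ rfl

theorem exists_fst_equiv (hβ : Function.Surjective β) (hβ' : Function.Surjective β') (hY : NoTwoTorsion Y)
    (hY' : NoTwoTorsion Y') (φ : D.Glue α β ≃ₗ[Λ] D.Glue α' β') :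
    ∃ φ₁ : Y ≃ₗ[Λ₁] Y', ∀ x, (φ x).fst = φ₁ x.fst := by
  obtain ⟨f, hf⟩ := exists_fst hβ hY' φ.toLinearMap
  obtain ⟨g, hg⟩ := exists_fst hβ' hY φ.symm.toLinearMap
  refine ⟨LinearEquiv.ofLinearMap f g ?_ ?_, hf⟩
  · ext y
    obtain ⟨z, hz⟩ := hβ' (α' y)
    have h₁ := hg (mk y z hz.symm)
    have h₂ := hf (φ.symm (mk y z hz.symm))
    simp only [LinearEquiv.coe_coe, LinearEquiv.apply_symm_apply, fst_mk] at h₁ h₂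
    simp [← h₁, ← h₂]
  · ext y
    obtain ⟨z, hz⟩ := hβ (α y)
    have h₁ := hf (mk y z hz.symm)
    have h₂ := hg (φ (mk y z hz.symm))
    simp only [LinearEquiv.coe_coe, LinearEquiv.symm_apply_apply, fst_mk] at h₁ h₂
    simp [← h₁, ← h₂]

/-- An isomorphism of glued modules comes from isomorphisms of the gluing data. -/
theorem exists_equivs (hα : IsReduction α) (hβ : IsReduction β)
    (hα' : IsReduction α') (hβ' : IsReduction β') (hY : NoTwoTorsion Y)
    (hY' : NoTwoTorsion Y') (hZ : NoTwoTorsion Z) (hZ' : NoTwoTorsion Z')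
    (φ : D.Glue α β ≃ₗ[Λ] D.Glue α' β') :
    ∃ (φ₁ : Y ≃ₗ[Λ₁] Y') (φ₂ : Z ≃ₗ[Λ₂] Z') (c : M ≃ₗ[R] M'),
      (∀ y, α' (φ₁ y) = c (α y)) ∧ ∀ z, β' (φ₂ z) = c (β z) := by
  obtain ⟨φ₁, h₁⟩ := exists_fst_equiv hβ.surjective hβ'.surjective hY hY' φ
  obtain ⟨φ₂, h₂⟩ := exists_fst_equiv (D := D.symm) hα.surjective hα'.surjective hZ hZ' (swap.symm.trans (φ.trans swap))
  obtain ⟨c, hc⟩ := hα.exists_equiv hα' D.red₁.surjective φ₁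
  refine ⟨φ₁, φ₂, c, hc, fun z => ?_⟩
  obtain ⟨y, hy⟩ := hα.surjective (β z)
  have e₁ := h₁ (mk y z hy)
  have e₂ : (φ (mk y z hy)).snd = φ₂ z := h₂ (swap (mk y z hy))
  rw [← e₂, ← condition, e₁, fst_mk, hc, hy]

end Glue

end Glue

/-! ### Decomposing a `Λ`-module -/

/-- The module structure over a quotient ring on a module killed by the kernel. -/
noncomputable abbrev moduleOfSurjective {A B : Type*} [Ring A] [Ring B] (p : A →+* B)
    (hp : Function.Surjective p) (X : Type*) [AddCommGroup X] [Module A X]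
    (h : ∀ a, p a = 0 → ∀ x : X, a • x = 0) : Module B X :=
  let _ : SMul B X := ⟨fun b x => Function.surjInv hp b • x⟩
  Function.Surjective.moduleLeft p hp fun a x => by
    change Function.surjInv hp (p a) • x = a • x
    rw [← sub_eq_zero, ← sub_smul]
    exact h _ (by rw [map_sub, Function.surjInv_eq hp, sub_self]) x

theorem moduleOfSurjective_smul {A B : Type*} [Ring A] [Ring B] (p : A →+* B)
    (hp : Function.Surjective p) (X : Type*) [AddCommGroup X] [Module A X]
    (h : ∀ a, p a = 0 → ∀ x : X, a • x = 0) (a : A) (x : X) :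
    (moduleOfSurjective p hp X h).smul (p a) x = a • x := by
  change Function.surjInv hp (p a) • x = a • x
  rw [← sub_eq_zero, ← sub_smul]
  exact h _ (by rw [map_sub, Function.surjInv_eq hp, sub_self]) x

/-- Recovers one component of a glued module as the quotient of `X` by the annihilator of t. It is
used with t = (2, 0) and t = (0, 2); `hwell` makes the reduction factor through the quotient, and
`hred` identifies its kernel with the doubles. -/
theorem exists_component {A B C X M : Type u} [Ring A] [Ring B] [Ring C] [AddCommGroup X]
    [Module A X] [AddCommGroup M] [Module A M] [Module C M] (p : A →+* B)
    (hp : Function.Surjective p) (q : B →+* C) (hM : ∀ a (m : M), q (p a) • m = a • m)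
    (μ : X →ₗ[A] M) (hμ : Function.Surjective μ) (t : A) (ht : ∀ a, t * a = a * t)
    (hker : ∀ a, p a = 0 → t * a = 0) (hX : NoTwoTorsion X) (hwell : ∀ x, t • x = 0 → μ x = 0)
    (hred : ∀ x, μ x = 0 → ∃ w : X, t • x = t • (w + w)) (htwo : ∀ w, μ (w + w) = 0) :
    ∃ (Y : Type u) (_ : AddCommGroup Y) (_ : Module B Y) (f : X →+ Y) (α : Y →ₛₗ[q] M),
      (∀ a x, f (a • x) = p a • f x) ∧ Function.Surjective f ∧ (∀ x, f x = 0 ↔ t • x = 0) ∧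
      (∀ x, α (f x) = μ x) ∧ IsReduction α ∧ NoTwoTorsion Y := by
  let L : X →ₗ[A] X :=
    { toFun := fun x => t • x
      map_add' := smul_add t
      map_smul' := fun a x => by simp [smul_smul, ht] }
  let Y := X ⧸ LinearMap.ker L
  let f : X →ₗ[A] Y := (LinearMap.ker L).mkQ
  have hfs : Function.Surjective f := Submodule.mkQ_surjective _
  have hf0 : ∀ x, f x = 0 ↔ t • x = 0 := fun x => by
    rw [← LinearMap.mem_ker, Submodule.ker_mkQ]; rfl
  have hk : ∀ a, p a = 0 → ∀ y : Y, a • y = 0 := by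
    intro a ha y
    obtain ⟨x, rfl⟩ := hfs y
    rw [← map_smul, hf0, smul_smul, hker a ha, zero_smul]
  let α₀ : Y →ₗ[A] M := (LinearMap.ker L).liftQ μ fun x hx => hwell x hx
  have hα₀ : ∀ x, α₀ (f x) = μ x := fun x => Submodule.liftQ_apply _ _ _
  let instB : Module B Y := moduleOfSurjective p hp Y hk
  have hsm : ∀ a (y : Y), p a • y = a • y := moduleOfSurjective_smul p hp Y hk
  let α : Y →ₛₗ[q] M :=
    { toFun := α₀
      map_add' := map_add α₀
      map_smul' := fun b y => by
        obtain ⟨a, rfl⟩ := hp b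
        rw [hsm, map_smul, hM] }
  refine ⟨Y, inferInstance, instB, f.toAddMonoidHom, α, fun a x => ?_, hfs, hf0, hα₀, ⟨?_, ?_⟩, ?_⟩
  · rw [hsm]; exact map_smul f a x
  · intro m
    obtain ⟨x, rfl⟩ := hμ m
    exact ⟨f x, hα₀ x⟩
  · intro y
    obtain ⟨x, rfl⟩ := hfs y
    constructor
    · intro h
      obtain ⟨w, hw⟩ := hred x ((hα₀ x).symm.trans h)
      refine ⟨f w, ?_⟩
      rw [← map_add, ← sub_eq_zero, ← map_sub, hf0, smul_sub, hw, sub_self]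
    · rintro ⟨w, hw⟩
      obtain ⟨w, rfl⟩ := hfs w
      change α₀ (f x) = 0
      rw [hw, ← map_add, hα₀, htwo]
  · intro y hy
    obtain ⟨x, rfl⟩ := hfs y
    rw [← map_add, hf0, smul_add] at hy
    exact (hf0 x).mpr (hX _ hy)

/-- A `Λ`-module on which the kernels of `t₁` and `t₂` are as in a free module is glued from a
`Λ₁`-module and a `Λ₂`-module. -/
theorem exists_glue_equiv (D : FiberSquare Λ Λ₁ Λ₂ R) (X : Type u) [AddCommGroup X] [Module Λ X]
    (hX : NoTwoTorsion X)
    (h₁ : ∀ x : X, D.t₁ • x = 0 → ∃ w : X, x = D.t₂ • w)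
    (h₂ : ∀ x : X, D.t₂ • x = 0 → ∃ w : X, x = D.t₁ • w) :
    ∃ (Y Z M : Type u) (_ : AddCommGroup Y) (_ : Module Λ₁ Y) (_ : AddCommGroup Z)
      (_ : Module Λ₂ Z) (_ : AddCommGroup M) (_ : Module R M) (α : Y →ₛₗ[D.q₁] M)
      (β : Z →ₛₗ[D.q₂] M), NoTwoTorsion Y ∧ NoTwoTorsion Z ∧ IsReduction α ∧ IsReduction β ∧
      Nonempty (X ≃ₗ[Λ] D.Glue α β) := by
  -- The common reduction will be X / (t₁X + t₂X): the kernel of Λ → R is t₁Λ + t₂Λ.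
  let T : Submodule Λ X :=
    { carrier := {x | ∃ y w : X, x = D.t₁ • y + D.t₂ • w}
      add_mem' := by
        rintro _ _ ⟨y, w, rfl⟩ ⟨y', w', rfl⟩
        exact ⟨y + y', w + w', by rw [smul_add, smul_add, add_add_add_comm]⟩
      zero_mem' := ⟨0, 0, by simp⟩
      smul_mem' := by
        rintro a _ ⟨y, w, rfl⟩
        exact ⟨a • y, a • w, by
          rw [smul_add, smul_smul, smul_smul, smul_smul, smul_smul, t₁_comm, t₂_comm]⟩ }
  let M := X ⧸ T
  let μ : X →ₗ[Λ] M := T.mkQ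
  have hμs : Function.Surjective μ := T.mkQ_surjective
  have hμ0 : ∀ x, μ x = 0 ↔ ∃ y w : X, x = D.t₁ • y + D.t₂ • w := fun x => by
    rw [← LinearMap.mem_ker, Submodule.ker_mkQ]; rfl
  have hsurj : Function.Surjective (D.q₁.comp D.p₁) :=
    D.red₁.surjective.comp D.surjective_p₁
  have hk : ∀ a, D.q₁.comp D.p₁ a = 0 → ∀ m : M, a • m = 0 := by
    intro a ha m
    obtain ⟨x, rfl⟩ := hμs m
    obtain ⟨b, hb⟩ := (D.red₁.map_eq_zero _).mp ha
    obtain ⟨c, hc⟩ := (D.red₂.map_eq_zero _).mp ((D.comm a).symm.trans ha)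
    obtain ⟨b, rfl⟩ := D.surjective_p₁ b
    obtain ⟨c, rfl⟩ := D.surjective_p₂ c
    have : a = D.t₁ * b + D.t₂ * c := D.ext (by simp [hb, two_mul]) (by simp [hc, two_mul])
    rw [← map_smul, hμ0]
    exact ⟨b • x, c • x, by rw [this, add_smul, mul_smul, mul_smul]⟩
  let instR : Module R M := moduleOfSurjective _ hsurj M hk
  have hsm : ∀ a (m : M), D.q₁ (D.p₁ a) • m = a • m := moduleOfSurjective_smul _ hsurj M hk
  have htwo : ∀ w, μ (w + w) = 0 := fun w => (hμ0 _).mpr ⟨w, w, by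
    rw [← add_smul, t₁_add_t₂, add_smul, one_smul]⟩
  obtain ⟨Y, iY, iY', f, α, hfl, hfs, hf0, hfα, hα, hY⟩ := exists_component D.p₁ D.surjective_p₁
    D.q₁ hsm μ hμs D.t₁ D.t₁_comm
    (fun a ha => D.ext (by simp [ha]) (by simp)) hX
    (fun x hx => by
      obtain ⟨w, rfl⟩ := h₁ x hx
      exact (hμ0 _).mpr ⟨0, w, by simp⟩)
    (fun x hx => by
      obtain ⟨y, w, rfl⟩ := (hμ0 x).mp hx
      exact ⟨y, by
        rw [smul_add, smul_smul, smul_smul, t₁_mul_t₂, t₁_mul_t₁, zero_smul, add_zero, add_smul,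
          smul_add]⟩) htwo
  obtain ⟨Z, iZ, iZ', g, β, hgl, hgs, hg0, hgβ, hβ, hZ⟩ := exists_component D.p₂ D.surjective_p₂
    D.q₂ (fun a m => by rw [← D.comm, hsm]) μ hμs D.t₂ D.t₂_comm
    (fun a ha => D.ext (by simp) (by simp [ha])) hX
    (fun x hx => by
      obtain ⟨w, rfl⟩ := h₂ x hx
      exact (hμ0 _).mpr ⟨w, 0, by simp⟩)
    (fun x hx => by
      obtain ⟨y, w, rfl⟩ := (hμ0 x).mp hx
      exact ⟨w, by
        rw [smul_add, smul_smul, smul_smul, t₂_mul_t₁, t₂_mul_t₂, zero_smul, zero_add, add_smul,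
          smul_add]⟩) htwo
  refine ⟨Y, Z, M, iY, iY', iZ, iZ', inferInstance, instR, α, β, hY, hZ, hα, hβ, ?_⟩
  let F : X →ₗ[Λ] D.Glue α β :=
    { toFun := fun x => Glue.mk (f x) (g x) (by rw [hfα, hgβ])
      map_add' := fun x y => by ext <;> simp
      map_smul' := fun a x => by ext <;> simp [hfl, hgl] }
  refine ⟨LinearEquiv.ofBijective F ⟨?_, ?_⟩⟩
  · rw [injective_iff_map_eq_zero]
    intro x hx
    have e₁ := (hf0 x).mp (congrArg Glue.fst hx)
    have e₂ := (hg0 x).mp (congrArg Glue.snd hx)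
    refine hX x ?_
    have : (D.t₁ + D.t₂) • x = 0 := by rw [add_smul, e₁, e₂, add_zero]
    rwa [t₁_add_t₂, add_smul, one_smul] at this
  · intro z
    obtain ⟨x, hx⟩ := hfs z.fst
    obtain ⟨x', hx'⟩ := hgs z.snd
    have : μ (x - x') = 0 := by
      rw [map_sub, sub_eq_zero, ← hfα, ← hgβ, hx, hx', z.condition]
    obtain ⟨y, w, hyw⟩ := (hμ0 _).mp this
    -- This element has the first component of x and the second component of x', since `t₂` acts as
    -- 0 on the first and `t₁` as 0 on the second.
    have e : x - D.t₂ • w = x' + D.t₁ • y := by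
      rw [sub_eq_iff_eq_add, add_assoc, ← hyw]; abel
    refine ⟨x - D.t₂ • w, Glue.ext ?_ ?_⟩
    · change f (x - D.t₂ • w) = z.fst
      rw [← hx, map_sub, hfl]; simp
    · change g (x - D.t₂ • w) = z.snd
      rw [e, ← hx', map_add, hgl]; simp

end FiberSquare

/-! ### Stable isomorphism of glued modules -/

/-- `Aᵐ⁺ⁿ ≅ Aⁿ × Aᵐ`. -/
def finAddEquiv (A : Type*) [Ring A] (m n : ℕ) :
    (Fin (m + n) → A) ≃ₗ[A] ((Fin n → A) × (Fin m → A)) :=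
  ((LinearEquiv.funCongrLeft A A finSumFinEquiv).trans
    (LinearEquiv.sumArrowLequivProdArrow (Fin m) (Fin n) A A)).trans
    (LinearEquiv.prodComm A _ _)

/-- `Aⁿ⁺¹ ≅ A × Aⁿ`. -/
def finConsEquiv (A : Type*) [Ring A] (n : ℕ) :
    (Fin (n + 1) → A) ≃ₗ[A] (A × (Fin n → A)) :=
  (Fin.consLinearEquiv A fun _ : Fin (n + 1) => A).symm

theorem IsModTwo.exists_reduction {S R : Type u} [Ring S] [Ring R] {q : S →+* R}
    (hq : IsModTwo q) (Y : Type u) [AddCommGroup Y] [Module S Y] :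
    ∃ (K : Type u) (_ : AddCommGroup K) (_ : Module R K) (π : Y →ₛₗ[q] K), IsReduction π := by
  let T : Submodule S Y :=
    { carrier := {y | ∃ w, y = w + w}
      add_mem' := by
        rintro _ _ ⟨a, rfl⟩ ⟨b, rfl⟩
        exact ⟨a + b, by abel⟩
      zero_mem' := ⟨0, by simp⟩
      smul_mem' := by
        rintro s _ ⟨a, rfl⟩
        exact ⟨s • a, smul_add _ _ _⟩ }
  have h0 : ∀ y, T.mkQ y = 0 ↔ ∃ w, y = w + w := fun y => by
    rw [← LinearMap.mem_ker, Submodule.ker_mkQ]; rfl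
  have hk : ∀ s, q s = 0 → ∀ k : Y ⧸ T, s • k = 0 := by
    intro s hs k
    obtain ⟨y, rfl⟩ := T.mkQ_surjective k
    obtain ⟨w, rfl⟩ := (hq.map_eq_zero s).mp hs
    rw [← map_smul, h0]
    exact ⟨w • y, add_smul _ _ _⟩
  let inst : Module R (Y ⧸ T) := FiberSquare.moduleOfSurjective q hq.surjective _ hk
  exact ⟨Y ⧸ T, inferInstance, inst,
    { toFun := T.mkQ
      map_add' := map_add _
      map_smul' := fun s y => by
        rw [map_smul]
        exact (FiberSquare.moduleOfSurjective_smul q hq.surjective _ hk s _).symm },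
    T.mkQ_surjective, h0⟩

/-- The projection Y × F → F becomes a surjective endomorphism of a Noetherian group, hence
injective. This settles stably free modules of rank zero. -/
theorem subsingleton_of_prod_equiv {A Y F : Type*} [Ring A] [AddCommGroup Y] [Module A Y]
    [AddCommGroup F] [Module A F] [Module.Finite ℤ F] (e : (Y × F) ≃ₗ[A] F) : Subsingleton Y := by
  let f : F →ₗ[ℤ] F := ((LinearMap.snd A Y F) ∘ₗ e.symm.toLinearMap).toAddMonoidHom.toIntLinearMap
  have hf : Function.Surjective f := fun x => ⟨e (0, x), by simp [f]⟩
  have hinj := IsNoetherian.injective_of_surjective_endomorphism f hf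
  refine subsingleton_of_forall_eq 0 fun y => ?_
  have h1 : f (e (y, 0)) = f 0 := by simp [f]
  have := hinj h1
  rw [LinearEquiv.map_eq_zero_iff] at this
  exact congrArg Prod.fst this

namespace FiberSquare

variable {Λ Λ₁ Λ₂ R : Type u} [Ring Λ] [Ring Λ₁] [Ring Λ₂] [Ring R] {D : FiberSquare Λ Λ₁ Λ₂ R}

/-- Stable cancellation descends from a fibre product to its factors. -/
theorem hasSFC_fst (D : FiberSquare Λ Λ₁ Λ₂ R) [Finite R] [Module.Finite ℤ Λ₁]
    (h₁ : NoTwoTorsion Λ₁) (hΛ : HasSFC Λ) : HasSFC Λ₁ := by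
  intro Y _ _ _ m n ⟨E⟩
  have hY : NoTwoTorsion Y := (h₁.pi (m + n)).of_injective
    (E.toLinearMap ∘ₗ LinearMap.inl Λ₁ Y (Fin m → Λ₁))
    (E.injective.comp LinearMap.inl_injective)
  -- Rank zero is separate because R⁰ has no unimodular element.
  obtain _ | n := n
  · have : Subsingleton Y := subsingleton_of_prod_equiv E
    exact ⟨LinearEquiv.ofSubsingleton Y _⟩
  obtain ⟨K, _, _, π, hπ⟩ := D.red₁.exists_reduction Y
  let E' := E.trans (finAddEquiv Λ₁ m (n + 1))
  obtain ⟨e, he⟩ := (hπ.semiProd (.semiPi D.red₁ m)).exists_equiv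
    ((IsReduction.semiPi D.red₁ (n + 1)).semiProd (.semiPi D.red₁ m)) D.red₁.surjective E'
  obtain ⟨h, hh, κ, hκ⟩ := exists_univLiftable_mul_eq (M := Fin (n + 1) → R) (Pi.single 0 1)
    (LinearMap.proj 0) (by simp) m e
  -- The correction h arises from the module over Λ₁ but is lifted over Λ₂. Thus `Y`, glued with a
  -- free Λ₂-module along κ, becomes stably free over Λ.
  obtain ⟨B, hB⟩ := inv_mem hh D.q₂ D.red₂ (semiPi D.q₂ (n + 1)) (.semiPi D.red₂ (n + 1))
  let X := D.Glue (semiComp κ π) (semiPi D.q₂ (n + 1))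
  have e₁ : (X × (Fin m → Λ)) ≃ₗ[Λ] (Fin (m + (n + 1)) → Λ) :=
    Glue.prodPiEquiv m |>.symm.trans <|
    (Glue.congr (α' := semiProd (semiPi D.q₁ (n + 1)) (semiPi D.q₁ m))
      (β' := semiProd (semiPi D.q₂ (n + 1)) (semiPi D.q₂ m)) E' B h⁻¹ (fun y => by
        rw [he]
        apply h.injective
        change _ = h (h.symm _)
        rw [h.apply_symm_apply]
        exact hκ _ _) hB).trans <|
    (Glue.prodPiEquiv m).trans <|
    ((Glue.piEquiv D (n + 1)).prodCongr (LinearEquiv.refl Λ _)).trans <|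
    (finAddEquiv Λ m (n + 1)).symm
  have : Module.Finite Λ X := Module.Finite.of_surjective
    (LinearMap.fst Λ X (Fin m → Λ) ∘ₗ e₁.symm.toLinearMap)
    (Prod.fst_surjective.comp e₁.symm.surjective)
  obtain ⟨e₂⟩ := hΛ X this m (n + 1) ⟨e₁⟩
  obtain ⟨φ, -⟩ := Glue.exists_fst_equiv (IsReduction.semiPi D.red₂ (n + 1)).surjective
    (IsReduction.semiPi D.red₂ (n + 1)).surjective hY (h₁.pi (n + 1))
    (e₂.trans (Glue.piEquiv D (n + 1)).symm)
  exact ⟨φ⟩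

section Units

variable {Y Z : Type u} [AddCommGroup Y] [Module Λ₁ Y] [AddCommGroup Z] [Module Λ₂ Z]
  {α : Y →ₛₗ[D.q₁] R} {β : Z →ₛₗ[D.q₂] R}

/-- The subgroup of automorphisms of `R` that do not change the stable class of a glued module. -/
def stableUnits (D : FiberSquare Λ Λ₁ Λ₂ R) : Subgroup (R ≃ₗ[R] R) :=
  stablyLiftable D.q₁ D.red₁ ⊔ stablyLiftable D.q₂ D.red₂

/-- A stable isomorphism induces automorphisms on both sides. After a shear correction the induced
map on R × Rᵐ is diag(κ, 1), which gives κ ∈ P(Λ₁) and w⁻¹κv ∈ P(Λ₂); normality of P(Λ₁) removes κ.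
-/
theorem inv_mul_mem_stableUnits [Finite R] [Module.Projective Λ₁ Y] [Module.Finite Λ₁ Y]
    [Module.Projective Λ₂ Z] [Module.Finite Λ₂ Z] (h₁ : NoTwoTorsion Λ₁) (h₂ : NoTwoTorsion Λ₂)
    (hY : NoTwoTorsion Y) (hZ : NoTwoTorsion Z) (hα : IsReduction α) (hβ : IsReduction β)
    {v w : R ≃ₗ[R] R}
    (h : StablyIsomorphic Λ (D.Glue α (semiComp v β)) (D.Glue α (semiComp w β))) :
    w⁻¹ * v ∈ D.stableUnits := by
  obtain ⟨m, ⟨e⟩⟩ := h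
  obtain ⟨φ₁, φ₂, c, hc₁, hc₂⟩ := Glue.exists_equivs
    (hα.semiProd (.semiPi D.red₁ m)) ((hβ.semiComp v).semiProd (.semiPi D.red₂ m))
    (hα.semiProd (.semiPi D.red₁ m)) ((hβ.semiComp w).semiProd (.semiPi D.red₂ m))
    (hY.prod (h₁.pi m)) (hY.prod (h₁.pi m)) (hZ.prod (h₂.pi m)) (hZ.prod (h₂.pi m))
    ((Glue.prodPiEquiv m).trans (e.trans (Glue.prodPiEquiv m).symm))
  obtain ⟨h, hh, κ, hκ⟩ := exists_univLiftable_mul_eq (M := R) 1 LinearMap.id rfl m c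
  have hκ' : h * c = κ.prodCongr (LinearEquiv.refl R (Fin m → R)) :=
    LinearEquiv.ext fun x => hκ x.1 x.2
  have m₁ : κ ∈ stablyLiftable D.q₁ D.red₁ := by
    refine mem_stablyLiftable_of_prodCongr hα D.red₁ (m := m) ?_
    rw [← hκ']
    exact mul_mem (hh D.q₁ D.red₁ α hα) ⟨φ₁, hc₁⟩
  have m₂ : w⁻¹ * κ * v ∈ stablyLiftable D.q₂ D.red₂ := by
    refine mem_stablyLiftable_of_prodCongr hβ D.red₂ (m := m) ?_
    let d : (R ≃ₗ[R] R) → ((R × (Fin m → R)) ≃ₗ[R] (R × (Fin m → R))) := fun a =>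
      a.prodCongr (LinearEquiv.refl R (Fin m → R))
    have hd : (d w)⁻¹ * c * d v ∈ liftable (semiProd β (semiPi D.q₂ m)) := by
      refine ⟨φ₂, fun z => (d w).injective ?_⟩
      change (d w) _ = (d w) ((d w).symm (c (d v (semiProd β (semiPi D.q₂ m) z))))
      rw [LinearEquiv.apply_symm_apply]
      exact hc₂ z
    have : d (w⁻¹ * κ * v) = ((d w⁻¹) * h * (d w⁻¹)⁻¹) * ((d w)⁻¹ * c * d v) := by
      have e₁ : d w⁻¹ = (d w)⁻¹ := rfl
      have e₂ : d (w⁻¹ * κ * v) = (d w)⁻¹ * d κ * d v := rfl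
      rw [e₁, e₂, show d κ = h * c from hκ'.symm]
      group
    change d (w⁻¹ * κ * v) ∈ _
    rw [this]
    exact mul_mem (univLiftable_conj hh w⁻¹ D.q₂ D.red₂ β hβ) hd
  have : (stablyLiftable D.q₁ D.red₁).Normal :=
    normal_of_commutator_mem _ (commutator_mem_stablyLiftable D.red₁)
  have e : w⁻¹ * v = (w⁻¹ * κ * v) * (v⁻¹ * κ⁻¹ * v⁻¹⁻¹) := by group
  rw [e]
  exact mul_mem (Subgroup.mem_sup_right m₂)
    (Subgroup.mem_sup_left (this.conj_mem _ (inv_mem m₁) _))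

/-- Write w⁻¹v = ab with a ∈ P(Λ₁) and b ∈ P(Λ₂). The conjugate waw⁻¹ is absorbed by a stable
automorphism of `Y`, and b by one of `Z`. -/
theorem stablyIsomorphic_of_mem [Module.Projective Λ₁ Y]
    [Module.Projective Λ₂ Z] (hα : IsReduction α) (hβ : IsReduction β)
    {v w : R ≃ₗ[R] R} (h : w⁻¹ * v ∈ D.stableUnits) :
    StablyIsomorphic Λ (D.Glue α (semiComp v β)) (D.Glue α (semiComp w β)) := by
  have hn : (stablyLiftable D.q₁ D.red₁).Normal :=
    normal_of_commutator_mem _ (commutator_mem_stablyLiftable D.red₁)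
  obtain ⟨a, ha, b, hb, hab⟩ := Subgroup.mem_sup_of_normal_left.mp h
  have hv : v = (w * a * w⁻¹) * (w * b) := by
    rw [eq_comm, ← mul_left_cancel_iff (a := w⁻¹), ← hab]; group
  have ha' := hn.conj_mem a ha w
  generalize w * a * w⁻¹ = a' at hv ha'
  subst hv
  refine StablyIsomorphic.trans (Y := D.Glue α (semiComp (w * b) β)) ?_ ?_
  · obtain ⟨m, hm⟩ := exists_prodCongr_mem_liftable hα D.red₁ ha'
    obtain ⟨A, hA⟩ := inv_mem hm
    let d := a'.prodCongr (LinearEquiv.refl R (Fin m → R))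
    have hd : ∀ z, semiProd (semiComp (w * b) β) (semiPi D.q₂ m) z =
        d⁻¹ (semiProd (semiComp (a' * (w * b)) β) (semiPi D.q₂ m) z) := fun z =>
      (d.symm_apply_apply (semiProd (semiComp (w * b) β) (semiPi D.q₂ m) z)).symm
    let F := Glue.congr (D := D) (β := semiProd (semiComp (a' * (w * b)) β) (semiPi D.q₂ m))
      (β' := semiProd (semiComp (w * b) β) (semiPi D.q₂ m)) A (LinearEquiv.refl Λ₂ _) d⁻¹ hA hd
    exact ⟨m, ⟨(Glue.prodPiEquiv m).symm.trans (F.trans (Glue.prodPiEquiv m))⟩⟩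
  · obtain ⟨m, B, hB⟩ := exists_prodCongr_mem_liftable hβ D.red₂ hb
    refine ⟨m, ⟨(Glue.prodPiEquiv m).symm.trans (LinearEquiv.trans (Glue.congr
      (LinearEquiv.refl _ _) B (LinearEquiv.refl R _) (fun _ => rfl) ?_)
      (Glue.prodPiEquiv m))⟩⟩
    intro z
    have := hB z
    simp only [semiProd_apply, LinearEquiv.prodCongr_apply, LinearEquiv.refl_apply,
      Prod.mk.injEq] at this
    simp [LinearEquiv.mul_apply, this]

/-- Gluing Λ₁ and Λ₂ along a ∈ P(Λ₂) gives a module stably isomorphic to Λ, hence isomorphic to Λ by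
SFC. The isomorphism splits a as c⁻¹(ca), with c lifting to Λ₁ and ca to Λ₂. -/
theorem stablyLiftable_le_of_hasSFC (h₁ : NoTwoTorsion Λ₁) (h₂ : NoTwoTorsion Λ₂)
    (hΛ : HasSFC Λ) : stablyLiftable D.q₂ D.red₂ ≤
      liftable D.q₁.toSemilinearMap ⊔ liftable D.q₂.toSemilinearMap := by
  intro a ha
  let X := D.Glue D.q₁.toSemilinearMap (semiComp a D.q₂.toSemilinearMap)
  obtain ⟨m, ⟨e⟩⟩ : StablyIsomorphic Λ X
      (D.Glue D.q₁.toSemilinearMap (semiComp 1 D.q₂.toSemilinearMap)) :=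
    stablyIsomorphic_of_mem D.red₁ D.red₂ (Subgroup.mem_sup_right (by simpa using ha))
  have s : D.Glue D.q₁.toSemilinearMap (semiComp 1 D.q₂.toSemilinearMap) ≃ₗ[Λ] (Fin 1 → Λ) :=
    (Glue.selfEquiv D).trans (LinearEquiv.funUnique (Fin 1) Λ Λ).symm
  have e₁ : (X × (Fin m → Λ)) ≃ₗ[Λ] (Fin (m + 1) → Λ) :=
    e.trans ((s.prodCongr (LinearEquiv.refl Λ _)).trans (finAddEquiv Λ m 1).symm)
  have : Module.Finite Λ X := Module.Finite.of_surjective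
    (LinearMap.fst Λ X (Fin m → Λ) ∘ₗ e₁.symm.toLinearMap)
    (Prod.fst_surjective.comp e₁.symm.surjective)
  obtain ⟨e₂⟩ := hΛ X this m 1 ⟨e₁⟩
  obtain ⟨φ₁, φ₂, c, hc₁, hc₂⟩ := Glue.exists_equivs D.red₁ (IsReduction.semiComp D.red₂ a) D.red₁
    (IsReduction.semiComp D.red₂ 1) h₁ h₁ h₂ h₂ (e₂.trans s.symm)
  have m₁ : c ∈ liftable D.q₁.toSemilinearMap := ⟨φ₁, hc₁⟩
  have m₂ : c * a ∈ liftable D.q₂.toSemilinearMap := ⟨φ₂, hc₂⟩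
  have : a = c⁻¹ * (c * a) := by group
  rw [this]
  exact mul_mem (Subgroup.mem_sup_left (inv_mem m₁)) (Subgroup.mem_sup_right m₂)

/-- Stable range one reduces k ∈ GLₙ₊₁(R) to diag(a, 1, …, 1), the correction being absorbed by an
automorphism of the free Λ₁-module. -/
theorem exists_equiv_glue_prod [Finite R] {n : ℕ} (k : (Fin (n + 1) → R) ≃ₗ[R] (Fin (n + 1) → R)) :
    ∃ a : R ≃ₗ[R] R, Nonempty (D.Glue (semiPi D.q₁ (n + 1)) (semiComp k (semiPi D.q₂ (n + 1))) ≃ₗ[Λ]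
      (D.Glue D.q₁.toSemilinearMap (semiComp a D.q₂.toSemilinearMap) × (Fin n → Λ))) := by
  let k' : (R × (Fin n → R)) ≃ₗ[R] (R × (Fin n → R)) :=
    (finConsEquiv R n).symm.trans (k.trans (finConsEquiv R n))
  obtain ⟨h, hh, a, ha⟩ := exists_univLiftable_mul_eq (M := R) 1 LinearMap.id rfl n k'
  obtain ⟨A, hA⟩ := hh D.q₁ D.red₁ D.q₁.toSemilinearMap D.red₁
  refine ⟨a, ⟨LinearEquiv.trans (Glue.congr ((finConsEquiv Λ₁ n).trans A) (finConsEquiv Λ₂ n)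
    ((finConsEquiv R n).trans h) (fun y => hA _) fun z => ?_) (Glue.prodPiEquiv n)⟩⟩
  have := ha (D.q₂ (z 0)) (fun i => D.q₂ (z i.succ))
  have hz : (finConsEquiv R n).symm (D.q₂ (z 0), fun i => D.q₂ (z i.succ)) =
      semiPi D.q₂ (n + 1) z := by
    rw [LinearEquiv.symm_apply_eq]; rfl
  simp only [k', LinearEquiv.trans_apply, hz] at this
  exact this.symm

/-- Stable cancellation for a fibre product, from stable cancellation for the factors. -/
theorem hasSFC_of_factors (D : FiberSquare Λ Λ₁ Λ₂ R) [Finite R] (h₁ : NoTwoTorsion Λ₁)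
    (h₂ : NoTwoTorsion Λ₂) (hΛ₁ : HasSFC Λ₁) (hΛ₂ : HasSFC Λ₂)
    (hP : stablyLiftable D.q₁ D.red₁ ≤ stablyLiftable D.q₂ D.red₂)
    (hW : stablyLiftable D.q₂ D.red₂ ≤ liftable D.q₂.toSemilinearMap) : HasSFC Λ := by
  intro X _ _ _ m n ⟨E⟩
  have hΛ : NoTwoTorsion Λ := fun x hx => D.inj x
    (h₁ _ (by rw [← map_add, hx, map_zero])) (h₂ _ (by rw [← map_add, hx, map_zero]))
  let i := E.toLinearMap ∘ₗ LinearMap.inl Λ X (Fin m → Λ)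
  let r := LinearMap.fst Λ X (Fin m → Λ) ∘ₗ E.symm.toLinearMap
  have hri : ∀ x, r (i x) = x := fun x => by simp [r, i]
  have hX : NoTwoTorsion X := (hΛ.pi (m + n)).of_injective i
    (Function.LeftInverse.injective hri)
  -- `X` is a direct summand of a free module, so it inherits the annihilator conditions
  -- coordinatewise.
  have key : ∀ t s : Λ, (∀ a : Λ, t * a = 0 → ∃ b, a = s * b) →
      ∀ x : X, t • x = 0 → ∃ w : X, x = s • w := by
    intro t s hts x hx
    have : t • i x = 0 := by rw [← map_smul, hx, map_zero]
    choose b hb using fun j => hts (i x j) (congrFun this j)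
    refine ⟨r b, ?_⟩
    rw [← map_smul, ← hri x]
    exact congrArg r (funext hb)
  obtain ⟨Y, Z, M, _, _, _, _, _, _, α, β, hY, hZ, hα, hβ, ⟨g⟩⟩ := D.exists_glue_equiv X hX
    (key _ _ fun _ => D.exists_eq_t₂_mul h₁) (key _ _ fun _ => D.symm.exists_eq_t₂_mul h₂)
  obtain ⟨φ₁, φ₂, -⟩ := Glue.exists_equivs
    (hα.semiProd (.semiPi D.red₁ m)) (hβ.semiProd (.semiPi D.red₂ m))
    ((IsReduction.semiPi D.red₁ n).semiProd (.semiPi D.red₁ m))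
    ((IsReduction.semiPi D.red₂ n).semiProd (.semiPi D.red₂ m))
    (hY.prod (h₁.pi m)) ((h₁.pi n).prod (h₁.pi m)) (hZ.prod (h₂.pi m)) ((h₂.pi n).prod (h₂.pi m))
    (Glue.prodPiEquiv m |>.trans <| (g.symm.prodCongr (LinearEquiv.refl Λ _)).trans <|
      E.trans <| (finAddEquiv Λ m n).trans <|
      ((Glue.piEquiv D n).symm.prodCongr (LinearEquiv.refl Λ _)).trans (Glue.prodPiEquiv m).symm)
  obtain ⟨y⟩ := hΛ₁ Y (Module.Finite.of_surjective
    (LinearMap.fst Λ₁ Y (Fin m → Λ₁) ∘ₗ φ₁.symm.toLinearMap)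
    (Prod.fst_surjective.comp φ₁.symm.surjective)) m n ⟨φ₁.trans (finAddEquiv Λ₁ m n).symm⟩
  obtain ⟨z⟩ := hΛ₂ Z (Module.Finite.of_surjective
    (LinearMap.fst Λ₂ Z (Fin m → Λ₂) ∘ₗ φ₂.symm.toLinearMap)
    (Prod.fst_surjective.comp φ₂.symm.surjective)) m n ⟨φ₂.trans (finAddEquiv Λ₂ m n).symm⟩
  obtain ⟨a₁, ha₁⟩ := hα.exists_equiv (.semiPi D.red₁ n) D.red₁.surjective y
  obtain ⟨a₂, ha₂⟩ := hβ.exists_equiv (.semiPi D.red₂ n) D.red₂.surjective z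
  have e₁ : X ≃ₗ[Λ] D.Glue (semiPi D.q₁ n) (semiComp (a₂.symm.trans a₁) (semiPi D.q₂ n)) :=
    g.trans (Glue.congr y z a₁ ha₁ fun w => by simp [ha₂])
  generalize a₂.symm.trans a₁ = k at e₁
  obtain _ | n := n
  · rw [Subsingleton.elim k (LinearEquiv.refl R (Fin 0 → R))] at e₁
    exact ⟨e₁.trans (Glue.piEquiv D 0)⟩
  obtain ⟨a, ⟨e₂⟩⟩ := exists_equiv_glue_prod (D := D) k
  have s : D.Glue D.q₁.toSemilinearMap (semiComp 1 D.q₂.toSemilinearMap) ≃ₗ[Λ] Λ :=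
    Glue.selfEquiv D
  -- The n split-off free summands join the m given ones, so the rank one gluing along a is stably
  -- isomorphic to Λ and a is a stable unit.
  have hst : StablyIsomorphic Λ (D.Glue D.q₁.toSemilinearMap (semiComp a D.q₂.toSemilinearMap))
      (D.Glue D.q₁.toSemilinearMap (semiComp 1 D.q₂.toSemilinearMap)) := by
    refine ⟨m + n, ⟨?_⟩⟩
    exact ((LinearEquiv.refl Λ _).prodCongr (finAddEquiv Λ m n)).trans <|
      (LinearEquiv.prodAssoc Λ _ (Fin n → Λ) (Fin m → Λ)).symm.trans <|
      ((e₁.trans e₂).symm.prodCongr (LinearEquiv.refl Λ _)).trans <|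
      E.trans <| (finAddEquiv Λ m (n + 1)).trans <|
      ((finConsEquiv Λ n).prodCongr (LinearEquiv.refl Λ _)).trans <|
      (LinearEquiv.prodAssoc Λ Λ (Fin n → Λ) (Fin m → Λ)).trans <|
      s.symm.prodCongr (finAddEquiv Λ m n).symm
  have ha := inv_mul_mem_stableUnits h₁ h₂ h₁ h₂ D.red₁ D.red₂ hst
  rw [inv_one, one_mul] at ha
  obtain ⟨B, hB⟩ := hW ((sup_le hP le_rfl : D.stableUnits ≤ _) ha)
  have e₃ : D.Glue D.q₁.toSemilinearMap (semiComp a D.q₂.toSemilinearMap) ≃ₗ[Λ]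
      D.Glue D.q₁.toSemilinearMap D.q₂.toSemilinearMap :=
    Glue.congr (LinearEquiv.refl _ _) B (LinearEquiv.refl R R) (fun _ => rfl) hB
  exact ⟨e₁.trans <| e₂.trans <| ((e₃.trans (Glue.selfEquiv D)).prodCongr
    (LinearEquiv.refl Λ _)).trans (finConsEquiv Λ n).symm⟩

end Units

end FiberSquare

/-! ### Locally free modules of rank one -/

/-- An elementary form of local freeness of rank one: for every prime `p` there are maps
`Λ → X → Λ` that are mutually inverse up to an integer prime to `p`. -/
def LocFree (Λ : Type u) [Ring Λ] (X : Type v) [AddCommGroup X] [Module Λ X] : Prop :=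
  ∀ p : ℕ, p.Prime → ∃ (f : Λ →ₗ[Λ] X) (g : X →ₗ[Λ] Λ) (s : ℤ), ¬ (p : ℤ) ∣ s ∧
    (∀ a, g (f a) = s • a) ∧ ∀ x, f (g x) = s • x

section BaseChange

variable {Λ : Type u} [Ring Λ] {X Y : Type v} [AddCommGroup X] [Module Λ X] [AddCommGroup Y]
  [Module Λ Y]

/-- The canonical map `X → Z ⊗ X`. -/
noncomputable def toBaseChange (Z : Type) [CommRing Z] (X : Type v) [AddCommGroup X] :
    X →+ BaseChangeMod Z X :=
  (TensorProduct.mk ℤ Z X 1).toAddMonoidHom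

theorem tmul_smul_toBaseChange (Z : Type) [CommRing Z] (l : Λ) (x : X) :
    ((1 : Z) ⊗ₜ[ℤ] l : BaseChangeRing Z Λ) • toBaseChange Z X x = toBaseChange Z X (l • x) :=
  (BaseChangeMod.smul_tmul Z Λ X 1 1 l x).trans (by rw [one_mul]; rfl)

theorem tmul_smul_eq_zsmul (Z : Type) [CommRing Z] (n : ℤ) (w : BaseChangeMod Z X) :
    ((n : Z) ⊗ₜ[ℤ] (1 : Λ) : BaseChangeRing Z Λ) • w = n • w := by
  have : ((n : Z) ⊗ₜ[ℤ] (1 : Λ) : BaseChangeRing Z Λ) = (n : BaseChangeRing Z Λ) := by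
    rw [show (n : Z) = n • (1 : Z) by simp, ← TensorProduct.smul_tmul',
      ← Algebra.TensorProduct.one_def, zsmul_one]
  rw [this, Int.cast_smul_eq_zsmul]

/-- The pure tensor `a ⊗ x` as an element of the base change. -/
noncomputable def BaseChangeMod.tmul {Z : Type} [CommRing Z] (a : Z) (x : X) : BaseChangeMod Z X :=
  a ⊗ₜ[ℤ] x

theorem BaseChangeMod.tmul_smul_tmul {Z : Type} [CommRing Z] (a b : Z) (l : Λ) (x : X) :
    (a ⊗ₜ[ℤ] l : BaseChangeRing Z Λ) • BaseChangeMod.tmul b x = .tmul (a * b) (l • x) := rfl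

theorem BaseChangeMod.induction {Z : Type} [CommRing Z] {motive : BaseChangeMod Z X → Prop}
    (zero : motive 0) (tmul : ∀ (a : Z) (x : X), motive (.tmul a x))
    (add : ∀ w w', motive w → motive w' → motive (w + w')) (w : BaseChangeMod Z X) : motive w :=
  TensorProduct.induction_on w zero tmul add

theorem isLocalizedModule_mk_one (Z : Type) [CommRing Z] (P : Ideal ℤ) [P.IsPrime]
    [IsLocalization P.primeCompl Z] :
    IsLocalizedModule P.primeCompl (TensorProduct.mk ℤ Z X 1) :=
  (isLocalizedModule_iff_isBaseChange P.primeCompl Z _).mpr (TensorProduct.isBaseChange ℤ X Z)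

theorem exists_smul_eq_toBaseChange (Z : Type) [CommRing Z] (P : Ideal ℤ) [P.IsPrime]
    [IsLocalization P.primeCompl Z] (s : Finset (BaseChangeMod Z X)) :
    ∃ t : ℤ, t ∉ P ∧ ∀ w ∈ s, ∃ x, t • w = toBaseChange Z X x := by
  have := isLocalizedModule_mk_one (X := X) Z P
  obtain ⟨⟨t, ht⟩, h⟩ := IsLocalizedModule.exist_integer_multiples_of_finset P.primeCompl
    (TensorProduct.mk ℤ Z X 1) s
  refine ⟨t, ht, fun w hw => ?_⟩
  obtain ⟨x, hx⟩ := h w hw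
  exact ⟨x, hx.symm⟩

theorem toBaseChange_injective [Module.IsTorsionFree ℤ X] (Z : Type) [CommRing Z] (P : Ideal ℤ)
    [P.IsPrime] [IsLocalization P.primeCompl Z] : Function.Injective (toBaseChange Z X) := by
  have := isLocalizedModule_mk_one (X := X) Z P
  refine (IsLocalizedModule.injective_iff_isRegular P.primeCompl
    (TensorProduct.mk ℤ Z X 1)).mpr ?_
  rintro ⟨c, hc⟩
  have hc0 : c ≠ 0 := fun h => hc (h ▸ P.zero_mem)
  exact Module.IsTorsionFree.isSMulRegular (IsRegular.of_ne_zero hc0)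

/-- The tensor products use the canonical ℤ-algebra structure, the localisation carries its own;
ℤ-algebra structures are unique. -/
theorem isLocalization_atPrime_int (P : Ideal ℤ) [P.IsPrime] :
    @IsLocalization ℤ _ P.primeCompl (Localization.AtPrime P) _ (Ring.toIntAlgebra _) := by
  rw [Subsingleton.elim (Ring.toIntAlgebra (Localization.AtPrime P)) OreLocalization.instAlgebra]
  infer_instance

/-- A map between localisations comes, up to a denominator, from a map of lattices. -/
theorem exists_map_of_baseChange [Module.Finite ℤ X] [Module.IsTorsionFree ℤ Y] (Z : Type)
    [CommRing Z] (P : Ideal ℤ) [P.IsPrime] [IsLocalization P.primeCompl Z]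
    (φ : BaseChangeMod Z X →ₗ[BaseChangeRing Z Λ] BaseChangeMod Z Y) :
    ∃ (t : ℤ) (g : X →ₗ[Λ] Y), t ∉ P ∧ ∀ x, toBaseChange Z Y (g x) =
      t • φ (toBaseChange Z X x) := by
  classical
  obtain ⟨s, hs⟩ := (Module.Finite.fg_top : (⊤ : Submodule ℤ X).FG)
  obtain ⟨t, ht, h⟩ := exists_smul_eq_toBaseChange Z P
    (s.image fun x => φ (toBaseChange Z X x))
  have hx : ∀ x : X, ∃ y, toBaseChange Z Y y =
      t • φ (toBaseChange Z X x) := by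
    intro x
    have hmem : x ∈ Submodule.span ℤ (s : Set X) := hs ▸ Submodule.mem_top
    induction hmem using Submodule.span_induction with
    | mem x hx =>
      obtain ⟨y, hy⟩ := h _ (Finset.mem_image_of_mem _ hx)
      exact ⟨y, hy.symm⟩
    | zero => exact ⟨0, by simp⟩
    | add x y _ _ ihx ihy =>
      obtain ⟨a, ha⟩ := ihx
      obtain ⟨b, hb⟩ := ihy
      exact ⟨a + b, by rw [map_add, ha, hb, map_add, map_add, smul_add]⟩
    | smul n x _ ih =>
      obtain ⟨a, ha⟩ := ih
      exact ⟨n • a, by rw [map_zsmul, ha, map_zsmul, map_zsmul, smul_comm]⟩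
  choose g hg using hx
  -- Torsion-freeness makes the chosen preimages unique, hence linear in x.
  have hinj := toBaseChange_injective (X := Y) Z P
  refine ⟨t, { toFun := g, map_add' := fun x y => hinj ?_, map_smul' := fun l x => hinj ?_ }, ht, hg⟩
  · rw [map_add, hg, hg, hg, map_add, map_add, smul_add]
  · rw [RingHom.id_apply, hg, ← tmul_smul_toBaseChange, map_smul, ← tmul_smul_toBaseChange, hg,
      smul_comm]

theorem exists_maps_of_isoAfterBaseChange {X : Type u} [AddCommGroup X] [Module Λ X]
    [Module.Finite ℤ X] [Module.IsTorsionFree ℤ X] [Module.Finite ℤ Λ] [Module.IsTorsionFree ℤ Λ]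
    (Z : Type) [CommRing Z] (P : Ideal ℤ) [P.IsPrime] [IsLocalization P.primeCompl Z]
    (h : IsoAfterBaseChange Z Λ X Λ) :
    ∃ (f : Λ →ₗ[Λ] X) (g : X →ₗ[Λ] Λ) (s : ℤ), s ∉ P ∧
      (∀ a, g (f a) = s • a) ∧ ∀ x, f (g x) = s • x := by
  obtain ⟨φ⟩ := h
  obtain ⟨t, g, ht, hg⟩ := exists_map_of_baseChange Z P φ.toLinearMap
  obtain ⟨t', f, ht', hf⟩ := exists_map_of_baseChange Z P φ.symm.toLinearMap
  refine ⟨f, g, t * t', ?_, fun a => ?_, fun x => ?_⟩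
  · exact fun h => (Ideal.IsPrime.mem_or_mem ‹_› h).elim ht ht'
  · apply toBaseChange_injective Z P
    rw [hg, hf, map_zsmul, map_zsmul, LinearEquiv.coe_coe, LinearEquiv.coe_coe,
      LinearEquiv.apply_symm_apply, smul_smul]
  · apply toBaseChange_injective Z P
    rw [hf, hg, map_zsmul, map_zsmul, LinearEquiv.coe_coe, LinearEquiv.coe_coe,
      LinearEquiv.symm_apply_apply, smul_smul, mul_comm]

theorem SameGenus.locFree {X : Type u} [AddCommGroup X] [Module Λ X] [Module.Finite ℤ X]
    [Module.IsTorsionFree ℤ X] [Module.Finite ℤ Λ] [Module.IsTorsionFree ℤ Λ]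
    (h : SameGenus Λ X Λ) : LocFree Λ X := by
  intro p hp
  have hprime : Prime (p : ℤ) := Nat.prime_iff_prime_int.mp hp
  have : (Ideal.span {(p : ℤ)}).IsMaximal := PrincipalIdealRing.isMaximal_of_irreducible
    hprime.irreducible
  have := isLocalization_atPrime_int (Ideal.span {(p : ℤ)})
  obtain ⟨f, g, s, hs, h₁, h₂⟩ := exists_maps_of_isoAfterBaseChange _ (Ideal.span {(p : ℤ)})
    (h (Ideal.span {(p : ℤ)}))
  exact ⟨f, g, s, fun h => hs (Ideal.mem_span_singleton.mpr h), h₁, h₂⟩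

/-- The base change of a linear map. -/
noncomputable def baseChangeMap (Z : Type) [CommRing Z] (f : X →ₗ[Λ] Y) :
    BaseChangeMod Z X →+ BaseChangeMod Z Y :=
  (TensorProduct.map (LinearMap.id : Z →ₗ[ℤ] Z) f.toAddMonoidHom.toIntLinearMap).toAddMonoidHom

theorem baseChangeMap_tmul (Z : Type) [CommRing Z] (f : X →ₗ[Λ] Y) (a : Z) (x : X) :
    baseChangeMap Z f (.tmul a x) = .tmul a (f x) := rfl

theorem baseChangeMap_smul (Z : Type) [CommRing Z] (f : X →ₗ[Λ] Y) (r : BaseChangeRing Z Λ)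
    (w : BaseChangeMod Z X) : baseChangeMap Z f (r • w) = r • baseChangeMap Z f w := by
  induction r using TensorProduct.induction_on with
  | zero =>
    exact ((congrArg _ (zero_smul (BaseChangeRing Z Λ) w)).trans (map_zero _)).trans
      (zero_smul (BaseChangeRing Z Λ) (baseChangeMap Z f w)).symm
  | add r r' h h' => rw [add_smul, map_add, h, h', add_smul]
  | tmul a l =>
    induction w using BaseChangeMod.induction with
    | zero => simp
    | add w w' h h' => rw [smul_add, map_add, h, h', map_add, smul_add]
    | tmul b x =>
      rw [BaseChangeMod.tmul_smul_tmul, baseChangeMap_tmul, baseChangeMap_tmul,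
        BaseChangeMod.tmul_smul_tmul, map_smul]

theorem baseChangeMap_comp (Z : Type) [CommRing Z] (f : X →ₗ[Λ] Y) (g : Y →ₗ[Λ] X) (s : ℤ)
    (h : ∀ x, g (f x) = s • x) (w : BaseChangeMod Z X) :
    baseChangeMap Z g (baseChangeMap Z f w) = s • w := by
  induction w using BaseChangeMod.induction with
  | zero => simp
  | add w w' h h' => rw [map_add, map_add, h, h', smul_add]
  | tmul a x =>
    rw [baseChangeMap_tmul, baseChangeMap_tmul, h]
    exact TensorProduct.tmul_smul s a x

theorem isoAfterBaseChange_of_maps {X : Type u} [AddCommGroup X] [Module Λ X]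
    (Z : Type) [CommRing Z] {s : ℤ} (hunit : IsUnit (s : Z)) (f : Λ →ₗ[Λ] X) (g : X →ₗ[Λ] Λ)
    (hgf : ∀ a, g (f a) = s • a) (hfg : ∀ x, f (g x) = s • x) : IsoAfterBaseChange Z Λ X Λ := by
  obtain ⟨z, hz⟩ := hunit.exists_left_inv
  have hcancel : ∀ {V : Type u} [AddCommGroup V] [Module Λ V] (w : BaseChangeMod Z V),
      (z ⊗ₜ[ℤ] (1 : Λ) : BaseChangeRing Z Λ) • s • w = w := by
    intro V _ _ w
    rw [← tmul_smul_eq_zsmul (Λ := Λ), smul_smul, Algebra.TensorProduct.tmul_mul_tmul, hz, mul_one,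
      ← Algebra.TensorProduct.one_def, one_smul]
  refine ⟨LinearEquiv.ofBijective
    { toFun := baseChangeMap Z g
      map_add' := map_add _
      map_smul' := baseChangeMap_smul Z g } ⟨?_, ?_⟩⟩
  · intro w w' hw
    have hw : baseChangeMap Z g w = baseChangeMap Z g w' := hw
    rw [← hcancel (V := X) w, ← hcancel (V := X) w', ← baseChangeMap_comp Z g f s hfg,
      ← baseChangeMap_comp Z g f s hfg, hw]
  · intro w
    refine ⟨(z ⊗ₜ[ℤ] (1 : Λ) : BaseChangeRing Z Λ) • baseChangeMap Z f w, ?_⟩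
    change baseChangeMap Z g _ = w
    rw [baseChangeMap_smul, baseChangeMap_comp Z f g s hgf]
    exact hcancel (V := Λ) w

theorem LocFree.sameGenus {X : Type u} [AddCommGroup X] [Module Λ X] (h : LocFree Λ X) :
    SameGenus Λ X Λ := by
  intro P hP
  obtain ⟨p, rfl⟩ : ∃ p, P = Ideal.span {p} :=
    ⟨_, (Submodule.IsPrincipal.span_singleton_generator P).symm⟩
  have hp0 : p ≠ 0 := by
    rintro rfl
    exact Ring.ne_bot_of_isMaximal_of_not_isField hP Int.not_isField (by simp)
  have hp : Prime p := (Ideal.span_singleton_prime hp0).mp hP.isPrime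
  obtain ⟨f, g, s, hs, hgf, hfg⟩ := h p.natAbs (Int.prime_iff_natAbs_prime.mp hp)
  have hsP : s ∈ (Ideal.span {p}).primeCompl := fun hmem =>
    hs (Int.natAbs_dvd.mpr (Ideal.mem_span_singleton.mp hmem))
  refine isoAfterBaseChange_of_maps _ ?_ f g hgf hfg
  have := IsLocalization.map_units (Localization.AtPrime (Ideal.span {p}))
    (⟨s, hsP⟩ : (Ideal.span {p}).primeCompl)
  simpa using this

end BaseChange

theorem Int.eq_top_of_forall_prime {I : Ideal ℤ}
    (h : ∀ p : ℕ, p.Prime → ∃ s ∈ I, ¬ (p : ℤ) ∣ s) : I = ⊤ := by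
  obtain ⟨n, rfl⟩ : ∃ n, I = Ideal.span {n} :=
    ⟨_, (Submodule.IsPrincipal.span_singleton_generator I).symm⟩
  rw [Ideal.span_singleton_eq_top, Int.isUnit_iff_natAbs_eq]
  by_contra hn
  obtain ⟨p, hp, hpn⟩ := Nat.exists_prime_and_dvd hn
  obtain ⟨s, hs, hps⟩ := h p hp
  exact hps ((Int.natCast_dvd.mpr hpn).trans (Ideal.mem_span_singleton.mp hs))

section LocFree

variable {Λ : Type u} [Ring Λ] {X : Type v} [AddCommGroup X] [Module Λ X]

/-- The integers s for which multiplication by s on `X` lifts through a free cover form an ideal of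
ℤ. Local freeness gives it, for each prime p, an element prime to p; so it contains 1. -/
theorem LocFree.projective (h : LocFree Λ X) : Module.Projective Λ X := by
  refine Module.Projective.of_lifting_property'' fun π hπ => ?_
  let I : Ideal ℤ :=
    { carrier := {s | ∃ k : X →ₗ[Λ] (X →₀ Λ), ∀ x, π (k x) = s • x}
      add_mem' := by
        rintro a b ⟨k, hk⟩ ⟨l, hl⟩
        exact ⟨k + l, fun x => by rw [LinearMap.add_apply, map_add, hk, hl, add_smul]⟩
      zero_mem' := ⟨0, by simp⟩
      smul_mem' := by
        rintro c a ⟨k, hk⟩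
        exact ⟨c • k, fun x => by
          rw [LinearMap.smul_apply, map_zsmul, hk, smul_smul, smul_eq_mul]⟩ }
  have hI : I = ⊤ := by
    refine Int.eq_top_of_forall_prime fun p hp => ?_
    obtain ⟨f, g, s, hs, -, hfg⟩ := h p hp
    obtain ⟨w, hw⟩ := hπ (f 1)
    refine ⟨s, ⟨(LinearMap.toSpanSingleton Λ _ w).comp g, fun x => ?_⟩, hs⟩
    rw [LinearMap.comp_apply, LinearMap.toSpanSingleton_apply, map_smul, hw, ← map_smul,
      smul_eq_mul, mul_one, hfg]
  obtain ⟨k, hk⟩ := (Ideal.eq_top_iff_one I).mp hI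
  exact ⟨k, LinearMap.ext fun x => by rw [LinearMap.comp_apply, hk, one_smul]; rfl⟩

/-- At p = 2 the integer s is odd, hence acts as 1 on R; the reduction is `g` followed by `q`. -/
theorem LocFree.exists_reduction {R : Type u} [Ring R] {q : Λ →+* R} (hq : IsModTwo q)
    (h : LocFree Λ X) : ∃ α : X →ₛₗ[q] R, IsReduction α := by
  obtain ⟨f, g, s, hs, hgf, hfg⟩ := h 2 Nat.prime_two
  obtain ⟨k, rfl⟩ : Odd s := Int.not_even_iff_odd.mp fun he => hs he.two_dvd
  have h2 : ∀ r : R, r + r = 0 := fun r => by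
    obtain ⟨a, rfl⟩ := hq.surjective r
    exact (map_add q a a).symm.trans ((hq.map_eq_zero _).mpr ⟨a, rfl⟩)
  refine ⟨q.toSemilinearMap.comp g, fun r => ?_, fun x => ?_⟩
  · obtain ⟨a, rfl⟩ := hq.surjective r
    refine ⟨f a, ?_⟩
    simp only [LinearMap.comp_apply, hgf, add_smul, mul_smul, one_smul, two_smul, map_add, h2,
      zero_add]
  · refine (hq.map_eq_zero (g x)).trans ⟨?_, ?_⟩
    · rintro ⟨w, hw⟩
      have := hfg x
      rw [hw, map_add, add_smul, one_smul, mul_smul, two_smul] at this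
      exact ⟨f w - k • x, by
        rw [sub_add_sub_comm, this, add_sub_cancel_left]⟩
    · rintro ⟨w, rfl⟩
      exact ⟨g w, map_add _ _ _⟩

/-- Any reduction of a lattice to `R` comes from an isomorphism with `Λ` up to an odd integer. -/
theorem IsReduction.exists_maps [Module.Finite ℤ X] [Module.IsTorsionFree ℤ X] [Module.Finite ℤ Λ]
    [Module.IsTorsionFree ℤ Λ] {R : Type u} [Ring R] {q : Λ →+* R} (hq : IsModTwo q)
    {α : X →ₛₗ[q] R} (hα : IsReduction α) :
    ∃ (f : Λ →ₗ[Λ] X) (g : X →ₗ[Λ] Λ) (s : ℤ), Odd s ∧ (∀ a, g (f a) = s • a) ∧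
      (∀ x, f (g x) = s • x) ∧ (∀ a, α (f a) = q a) ∧ ∀ x, q (g x) = α x := by
  obtain ⟨f, hf⟩ := hα.exists_lift q.toSemilinearMap LinearMap.id
  have hf : ∀ a, α (f a) = q a := hf
  have odd_of : ∀ r : ℤ, r - 1 ∈ Ideal.span {(2 : ℤ)} → Odd r := fun r hr => by
    obtain ⟨k, hk⟩ := Ideal.mem_span_singleton.mp hr
    exact ⟨k, by omega⟩
  have odd_ne : ∀ r : ℤ, Odd r → r ≠ 0 := by rintro _ ⟨k, rfl⟩; omega
  let F : Λ →ₗ[ℤ] X := f.toAddMonoidHom.toIntLinearMap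
  have hinj : Function.Injective f := by
    -- The lift f is an isomorphism modulo two. Its kernel satisfies N = 2N, so Nakayama's lemma
    -- gives an odd integer killing it; the cokernel is treated likewise.
    have hle : LinearMap.ker F ≤ Ideal.span {(2 : ℤ)} • LinearMap.ker F := by
      intro a ha
      have ha : f a = 0 := ha
      obtain ⟨b, rfl⟩ := (hq.map_eq_zero a).mp (by
        change q a = 0; rw [← hf, ha, map_zero])
      rw [← two_smul ℤ b, map_zsmul] at ha
      rw [← two_smul ℤ b]
      exact Submodule.smul_mem_smul (Ideal.mem_span_singleton_self _)
        ((smul_eq_zero.mp ha).resolve_left two_ne_zero)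
    obtain ⟨r, hr, hr0⟩ := Submodule.exists_sub_one_mem_and_smul_eq_zero_of_fg_of_le_smul _ _
      (IsNoetherian.noetherian _) hle
    rw [injective_iff_map_eq_zero]
    intro a ha
    exact (smul_eq_zero.mp (hr0 a ha)).resolve_left (odd_ne r (odd_of r hr))
  obtain ⟨r, hr, hr0⟩ : ∃ r : ℤ, Odd r ∧ ∀ x, ∃ a, f a = r • x := by
    let C := X ⧸ LinearMap.range F
    have hle : (⊤ : Submodule ℤ C) ≤ Ideal.span {(2 : ℤ)} • (⊤ : Submodule ℤ C) := by
      intro c _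
      obtain ⟨x, rfl⟩ := Submodule.mkQ_surjective _ c
      obtain ⟨a, ha⟩ := hq.surjective (α x)
      have ha : q a = α x := ha
      obtain ⟨w, hw⟩ := (hα.map_eq_zero (x - f a)).mp (by rw [map_sub, hf, ha, sub_self])
      have h0 : (LinearMap.range F).mkQ (f a) = 0 :=
        (Submodule.Quotient.mk_eq_zero _).mpr ⟨a, rfl⟩
      have : (LinearMap.range F).mkQ x = (2 : ℤ) • (LinearMap.range F).mkQ w := by
        rw [two_smul, ← map_add, ← hw, map_sub, h0, sub_zero]
      rw [this]
      exact Submodule.smul_mem_smul (Ideal.mem_span_singleton_self _) trivial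
    obtain ⟨r, hr, hr0⟩ := Submodule.exists_sub_one_mem_and_smul_eq_zero_of_fg_of_le_smul _ _
      Module.Finite.fg_top hle
    refine ⟨r, odd_of r hr, fun x => ?_⟩
    have := hr0 ((LinearMap.range F).mkQ x) trivial
    rw [← map_smul] at this
    exact (Submodule.Quotient.mk_eq_zero _).mp this
  choose g hg using hr0
  let G : X →ₗ[Λ] Λ :=
    { toFun := g
      map_add' := fun x y => hinj (by rw [map_add, hg, hg, hg, smul_add])
      map_smul' := fun a x => hinj (by
        rw [RingHom.id_apply, map_smul, hg, hg, smul_comm]) }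
  refine ⟨f, G, r, hr, fun a => hinj ?_, hg, hf, fun x => ?_⟩
  · rw [map_zsmul]; exact hg _
  · rw [← hf]
    change α (f (g x)) = α x
    obtain ⟨k, rfl⟩ := hr
    rw [hg, add_smul, one_smul, mul_smul, two_smul, map_add,
      (hα.map_eq_zero _).mpr ⟨k • x, rfl⟩, zero_add]

end LocFree

/-! ### The class number of a fibre product -/

theorem NoTwoTorsion.of_isTorsionFree (X : Type*) [AddCommGroup X] [Module.IsTorsionFree ℤ X] :
    NoTwoTorsion X := fun x hx => by
  rw [← two_smul ℤ x] at hx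
  exact (smul_eq_zero.mp hx).resolve_left two_ne_zero

theorem isTorsionFree_int_of_forall {X : Type*} [AddCommGroup X]
    (h : ∀ (n : ℤ) (x : X), n ≠ 0 → n • x = 0 → x = 0) : Module.IsTorsionFree ℤ X where
  isSMulRegular n hn x y hxy := by
    have hxy : n • x = n • y := hxy
    rw [← sub_eq_zero]
    exact h n _ hn.ne_zero (by rw [smul_sub, hxy, sub_self])

theorem StablyIsomorphic.exists_le {Λ : Type u} [Ring Λ] {X Y : Type v} [AddCommGroup X]
    [Module Λ X] [AddCommGroup Y] [Module Λ Y] {m : ℕ}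
    (h : Nonempty ((X × (Fin m → Λ)) ≃ₗ[Λ] (Y × (Fin m → Λ)))) (k : ℕ) :
    Nonempty ((X × (Fin (m + k) → Λ)) ≃ₗ[Λ] (Y × (Fin (m + k) → Λ))) := by
  obtain ⟨e⟩ := h
  let s := (finAddEquiv Λ m k).trans (LinearEquiv.prodComm Λ _ _)
  exact ⟨((LinearEquiv.refl Λ X).prodCongr s).trans <|
    (LinearEquiv.prodAssoc Λ X _ _).symm.trans <|
    (e.prodCongr (LinearEquiv.refl Λ _)).trans <|
    (LinearEquiv.prodAssoc Λ Y _ _).trans ((LinearEquiv.refl Λ Y).prodCongr s.symm)⟩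

namespace FiberSquare

variable {Λ Λ₁ Λ₂ R : Type u} [Ring Λ] [Ring Λ₁] [Ring Λ₂] [Ring R] {D : FiberSquare Λ Λ₁ Λ₂ R}

section Lattices

variable {Y Z M : Type u} [AddCommGroup Y] [Module Λ₁ Y] [AddCommGroup Z] [Module Λ₂ Z]
  [AddCommGroup M] [Module R M]

theorem glue_isLattice (α : Y →ₛₗ[D.q₁] M) (β : Z →ₛₗ[D.q₂] M) (hY : IsLatticeOver Λ₁ Y)
    (hZ : IsLatticeOver Λ₂ Z) : IsLatticeOver Λ (D.Glue α β) := by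
  obtain ⟨_, _⟩ := hY
  obtain ⟨_, _⟩ := hZ
  constructor
  · let f : D.Glue α β →ₗ[ℤ] Y × Z := (D.glueSubgroup α β).subtype.toIntLinearMap
    exact Module.Finite.of_injective f Subtype.val_injective
  · refine isTorsionFree_int_of_forall fun n x hn hx => ?_
    have h₁ : n • x.fst = 0 := congrArg Glue.fst hx
    have h₂ : n • x.snd = 0 := congrArg Glue.snd hx
    exact Glue.ext ((smul_eq_zero.mp h₁).resolve_left hn) ((smul_eq_zero.mp h₂).resolve_left hn)

/-- Local maps on the two components must agree over R. At 2 they are chosen compatible with the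
reductions; at odd p doubling makes all their reductions zero, at the cost of a factor 4 prime to p.
-/
theorem glue_locFree [Module.Finite ℤ Λ₁] [Module.IsTorsionFree ℤ Λ₁] [Module.Finite ℤ Λ₂]
    [Module.IsTorsionFree ℤ Λ₂] {α : Y →ₛₗ[D.q₁] R} {β : Z →ₛₗ[D.q₂] R} (hα : IsReduction α)
    (hβ : IsReduction β) (hY : IsLatticeOver Λ₁ Y) (hZ : IsLatticeOver Λ₂ Z)
    (fY : LocFree Λ₁ Y) (fZ : LocFree Λ₂ Z) : LocFree Λ (D.Glue α β) := by
  obtain ⟨_, _⟩ := hY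
  obtain ⟨_, _⟩ := hZ
  have two₁ : ∀ y : Y, α ((2 : ℤ) • y) = 0 := fun y =>
    (hα.map_eq_zero _).mpr ⟨y, two_smul ℤ y⟩
  have two₂ : ∀ z : Z, β ((2 : ℤ) • z) = 0 := fun z =>
    (hβ.map_eq_zero _).mpr ⟨z, two_smul ℤ z⟩
  have two₁' : ∀ a : Λ₁, D.q₁ ((2 : ℤ) • a) = 0 := fun y =>
    (D.red₁.map_eq_zero _).mpr ⟨y, two_smul ℤ y⟩
  have two₂' : ∀ a : Λ₂, D.q₂ ((2 : ℤ) • a) = 0 := fun z =>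
    (D.red₂.map_eq_zero _).mpr ⟨z, two_smul ℤ z⟩
  intro p hp
  have hp' : Prime (p : ℤ) := Nat.prime_iff_prime_int.mp hp
  obtain ⟨f₁, g₁, s₁, f₂, g₂, s₂, hs₁, hs₂, e₁, e₁', e₂, e₂', hf, hg⟩ :
      ∃ (f₁ : Λ₁ →ₗ[Λ₁] Y) (g₁ : Y →ₗ[Λ₁] Λ₁) (s₁ : ℤ) (f₂ : Λ₂ →ₗ[Λ₂] Z) (g₂ : Z →ₗ[Λ₂] Λ₂)
        (s₂ : ℤ), ¬ (p : ℤ) ∣ s₁ ∧ ¬ (p : ℤ) ∣ s₂ ∧ (∀ a, g₁ (f₁ a) = s₁ • a) ∧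
        (∀ x, f₁ (g₁ x) = s₁ • x) ∧ (∀ a, g₂ (f₂ a) = s₂ • a) ∧ (∀ x, f₂ (g₂ x) = s₂ • x) ∧
        (∀ a b, D.q₁ a = D.q₂ b → α (f₁ a) = β (f₂ b)) ∧
        (∀ y z, α y = β z → D.q₁ ((s₂ • g₁) y) = D.q₂ ((s₁ • g₂) z)) := by
    obtain rfl | hp2 := eq_or_ne p 2
    · obtain ⟨f₁, g₁, s₁, hs₁, e₁, e₁', hf₁, hg₁⟩ := hα.exists_maps D.red₁
      obtain ⟨f₂, g₂, s₂, hs₂, e₂, e₂', hf₂, hg₂⟩ := hβ.exists_maps D.red₂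
      have hodd : ∀ s : ℤ, Odd s → ¬ ((2 : ℕ) : ℤ) ∣ s := by rintro _ ⟨k, rfl⟩; omega
      refine ⟨f₁, g₁, s₁, f₂, g₂, s₂, hodd _ hs₁, hodd _ hs₂, e₁, e₁', e₂, e₂', ?_, ?_⟩
      · intro a b h
        rw [hf₁, hf₂, h]
      · intro y z h
        obtain ⟨k, rfl⟩ := hs₁
        obtain ⟨l, rfl⟩ := hs₂
        rw [LinearMap.smul_apply, LinearMap.smul_apply]
        simp only [add_smul, mul_smul, one_smul, map_add, two₁', two₂', zero_add, hg₁, hg₂, h]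
    · obtain ⟨f₁, g₁, s₁, hs₁, e₁, e₁'⟩ := fY p hp
      obtain ⟨f₂, g₂, s₂, hs₂, e₂, e₂'⟩ := fZ p hp
      have h2 : ¬ (p : ℤ) ∣ 2 * 2 := fun h => by
        have : p ∣ 2 := by
          have := (hp'.dvd_or_dvd h)
          rw [or_self] at this
          exact_mod_cast this
        exact hp2 ((Nat.prime_dvd_prime_iff_eq hp Nat.prime_two).mp this)
      have hs : ∀ s : ℤ, ¬ (p : ℤ) ∣ s → ¬ (p : ℤ) ∣ (2 * 2) * s := fun s hs h =>
        (hp'.dvd_or_dvd h).elim h2 hs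
      refine ⟨(2 : ℤ) • f₁, (2 : ℤ) • g₁, (2 * 2) * s₁, (2 : ℤ) • f₂, (2 : ℤ) • g₂, (2 * 2) * s₂,
        hs _ hs₁, hs _ hs₂, ?_, ?_, ?_, ?_, ?_, ?_⟩
      · intro a; simp only [LinearMap.smul_apply, map_zsmul, e₁, mul_smul]
      · intro a; simp only [LinearMap.smul_apply, map_zsmul, e₁', mul_smul]
      · intro a; simp only [LinearMap.smul_apply, map_zsmul, e₂, mul_smul]
      · intro a; simp only [LinearMap.smul_apply, map_zsmul, e₂', mul_smul]
      · intro a b _; rw [LinearMap.smul_apply, LinearMap.smul_apply, two₁, two₂]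
      · intro y z _
        simp only [LinearMap.smul_apply, smul_comm _ (2 : ℤ), two₁', two₂']
  let F : D.Glue D.q₁.toSemilinearMap D.q₂.toSemilinearMap →ₗ[Λ] D.Glue α β := Glue.map f₁ f₂ hf
  -- Scaling by s₂ and s₁ crosswise makes both composites multiplication by the same integer s₁s₂.
  let G : D.Glue α β →ₗ[Λ] D.Glue D.q₁.toSemilinearMap D.q₂.toSemilinearMap :=
    Glue.map (s₂ • g₁) (s₁ • g₂) hg
  have hzs : ∀ (n : ℤ) (x : D.Glue α β), (n • x).fst = n • x.fst ∧ (n • x).snd = n • x.snd :=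
    fun _ _ => ⟨rfl, rfl⟩
  have hGF : ∀ x, G (F x) = (s₁ * s₂) • x := fun x => Glue.ext
    ((congrArg (s₂ • ·) (e₁ x.fst)).trans (by rw [smul_smul, mul_comm]; rfl))
    ((congrArg (s₁ • ·) (e₂ x.snd)).trans (by rw [smul_smul]; rfl))
  have hFG : ∀ x, F (G x) = (s₁ * s₂) • x := fun x => Glue.ext
    ((map_zsmul f₁ _ _).trans ((congrArg (s₂ • ·) (e₁' x.fst)).trans
      (by rw [smul_smul, mul_comm]; rfl)))
    ((map_zsmul f₂ _ _).trans ((congrArg (s₁ • ·) (e₂' x.snd)).trans (by rw [smul_smul]; rfl)))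
  refine ⟨F ∘ₗ (Glue.selfEquiv D).symm.toLinearMap, (Glue.selfEquiv D).toLinearMap ∘ₗ G, s₁ * s₂,
    fun h => (hp'.dvd_or_dvd h).elim hs₁ hs₂, fun a => ?_, fun x => ?_⟩
  · simp [hGF]
  · simp [hFG]

theorem locFree_fst {α : Y →ₛₗ[D.q₁] M} {β : Z →ₛₗ[D.q₂] M} (hβ : Function.Surjective β)
    (h₁ : NoTwoTorsion Λ₁) (hY : NoTwoTorsion Y) (h : LocFree Λ (D.Glue α β)) : LocFree Λ₁ Y := by
  intro p hp
  obtain ⟨f, g, s, hs, hgf, hfg⟩ := h p hp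
  obtain ⟨f₁, hf₁⟩ := Glue.exists_fst (β := D.q₂.toSemilinearMap) D.red₂.surjective hY
    (f ∘ₗ (Glue.selfEquiv D).toLinearMap)
  obtain ⟨g₁, hg₁⟩ := Glue.exists_fst (α' := D.q₁.toSemilinearMap) (β' := D.q₂.toSemilinearMap) hβ h₁
    ((Glue.selfEquiv D).symm.toLinearMap ∘ₗ g)
  refine ⟨f₁, g₁, s, hs, fun a => ?_, fun y => ?_⟩
  · obtain ⟨b, hb⟩ := D.red₂.surjective (D.q₁ a)
    let x : D.Glue D.q₁.toSemilinearMap D.q₂.toSemilinearMap := Glue.mk a b hb.symm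
    have := hf₁ x
    change _ = f₁ a at this
    rw [← this, ← hg₁]
    simp only [LinearMap.comp_apply, LinearEquiv.coe_coe, hgf, map_zsmul,
      LinearEquiv.symm_apply_apply]
    rfl
  · obtain ⟨z, hz⟩ := hβ (α y)
    let x : D.Glue α β := Glue.mk y z hz.symm
    have := hg₁ x
    change _ = g₁ y at this
    rw [← this, ← hf₁]
    simp only [LinearMap.comp_apply, LinearEquiv.coe_coe, hfg, LinearEquiv.apply_symm_apply]
    rfl

theorem isLattice_fst {α : Y →ₛₗ[D.q₁] M} {β : Z →ₛₗ[D.q₂] M} (hβ : Function.Surjective β)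
    (hY : NoTwoTorsion Y) (h : IsLatticeOver Λ (D.Glue α β)) : IsLatticeOver Λ₁ Y := by
  obtain ⟨_, _⟩ := h
  have hs : ∀ y, ∃ x : D.Glue α β, x.fst = y := fun y => by
    obtain ⟨z, hz⟩ := hβ (α y)
    exact ⟨Glue.mk y z hz.symm, rfl⟩
  constructor
  · let f : D.Glue α β →ₗ[ℤ] Y :=
      ((AddMonoidHom.fst Y Z).comp (D.glueSubgroup α β).subtype).toIntLinearMap
    exact Module.Finite.of_surjective f hs
  · refine isTorsionFree_int_of_forall fun n y hn hy => ?_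
    obtain ⟨x, rfl⟩ := hs y
    -- Multiplying by (2, 0) clears the second component, which turns torsion of the first component
    -- into torsion of the glued module.
    have e : n • (D.t₁ • x) = 0 := Glue.ext
      (by
        change n • (D.p₁ D.t₁ • x.fst) = 0
        rw [smul_comm, hy, smul_zero])
      (by
        change n • (D.p₂ D.t₁ • x.snd) = 0
        rw [p₂_t₁, zero_smul, smul_zero])
    have := congrArg Glue.fst ((smul_eq_zero.mp e).resolve_left hn)
    rw [Glue.fst_smul, p₁_t₁, two_smul] at this
    exact hY _ this

theorem exists_glue_equiv_of_locFree [Module.IsTorsionFree ℤ Λ₁] [Module.IsTorsionFree ℤ Λ₂]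
    (X : Type u) [AddCommGroup X]
    [Module Λ X] (hX : IsLatticeOver Λ X) (fX : LocFree Λ X) :
    ∃ (Y Z : Type u) (_ : AddCommGroup Y) (_ : Module Λ₁ Y) (_ : AddCommGroup Z)
      (_ : Module Λ₂ Z) (α : Y →ₛₗ[D.q₁] R) (β : Z →ₛₗ[D.q₂] R), IsLatticeOver Λ₁ Y ∧
      IsLatticeOver Λ₂ Z ∧ LocFree Λ₁ Y ∧ LocFree Λ₂ Z ∧ IsReduction α ∧ IsReduction β ∧
      Nonempty (X ≃ₗ[Λ] D.Glue α β) := by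
  have h₁ := NoTwoTorsion.of_isTorsionFree Λ₁
  have h₂ := NoTwoTorsion.of_isTorsionFree Λ₂
  obtain ⟨_, _⟩ := id hX
  obtain ⟨f, g, s, hs, hgf, hfg⟩ := fX 2 Nat.prime_two
  obtain ⟨k, rfl⟩ : Odd s := Int.not_even_iff_odd.mp fun he => hs he.two_dvd
  -- If tx = 0, then 2x = t'x, and g(x) = t'b gives (2k + 1)x = t'f(b); hence x = t'(f(b) - kx).
  have key : ∀ t t' : Λ, t + t' = 1 + 1 → (∀ a, t * a = 0 → ∃ b, a = t' * b) →
      ∀ x : X, t • x = 0 → ∃ w : X, x = t' • w := by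
    intro t t' htt h x hx
    obtain ⟨b, hb⟩ := h (g x) (by rw [← smul_eq_mul, ← map_smul, hx, map_zero])
    have h1 := hfg x
    rw [hb, ← smul_eq_mul, map_smul, add_smul, one_smul, mul_comm, mul_smul, two_smul] at h1
    have h2 : x + x = t' • x := by
      rw [← zero_add (t' • x), ← hx, ← add_smul, htt, add_smul, one_smul]
    refine ⟨f b - k • x, ?_⟩
    rw [smul_sub, h1, smul_comm t' k x, ← h2]
    abel
  obtain ⟨Y, Z, M, iY, iY', iZ, iZ', iM, iM', α, β, hY, hZ, hα, hβ, ⟨e⟩⟩ :=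
    D.exists_glue_equiv X (NoTwoTorsion.of_isTorsionFree X)
      (key _ _ D.t₁_add_t₂ fun _ => D.exists_eq_t₂_mul h₁)
      (key _ _ (by rw [add_comm, D.t₁_add_t₂]) fun _ => D.symm.exists_eq_t₂_mul h₂)
  have fG : LocFree Λ (D.Glue α β) := fun p hp => by
    obtain ⟨f, g, s, hs, hgf, hfg⟩ := fX p hp
    exact ⟨e.toLinearMap ∘ₗ f, g ∘ₗ e.symm.toLinearMap, s, hs, fun a => by simp [hgf],
      fun x => by simp [hfg]⟩
  have lG : ∀ {N : Type u} [AddCommGroup N] [Module Λ N] (e : X ≃ₗ[Λ] N), IsLatticeOver Λ N := by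
    intro N _ _ e
    let e' : X ≃ₗ[ℤ] N := e.toAddEquiv.toIntLinearEquiv
    refine ⟨Module.Finite.equiv e', isTorsionFree_int_of_forall fun n x hn hx => ?_⟩
    have : n • e.symm x = 0 := by rw [← map_zsmul, hx, map_zero]
    simpa using (smul_eq_zero.mp this).resolve_left hn
  have fY := locFree_fst hβ.surjective h₁ hY fG
  have fG' : LocFree Λ (D.symm.Glue β α) := fun p hp => by
    obtain ⟨f, g, s, hs, hgf, hfg⟩ := fG p hp
    exact ⟨Glue.swap.toLinearMap ∘ₗ f, g ∘ₗ Glue.swap.symm.toLinearMap, s, hs,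
      fun a => by simp [hgf], fun x => by simp [hfg]⟩
  have fZ := locFree_fst (D := D.symm) hα.surjective h₂ hZ fG'
  -- The abstract common reduction is Y/2Y, which is isomorphic to R because `Y` is locally free.
  obtain ⟨α', hα'⟩ := fY.exists_reduction D.red₁
  obtain ⟨c, hc⟩ := hα.exists_equiv hα' D.red₁.surjective (LinearEquiv.refl Λ₁ Y)
  refine ⟨Y, Z, iY, iY', iZ, iZ', semiComp c α, semiComp c β,
    isLattice_fst hβ.surjective hY (lG e),
    isLattice_fst (D := D.symm) hα.surjective hZ (lG (e.trans Glue.swap)), fY, fZ, hα.semiComp c,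
    hβ.semiComp c, ⟨e.trans (Glue.congr (LinearEquiv.refl _ _) (LinearEquiv.refl _ _) c
      (fun _ => rfl) fun _ => rfl)⟩⟩

end Lattices

section ClassNumber

variable [Module.Finite ℤ Λ₁] [Module.IsTorsionFree ℤ Λ₁] [Module.Finite ℤ Λ₂]
    [Module.IsTorsionFree ℤ Λ₂]

theorem _root_.PrincipalGenus.locFree {S : Type u} [Ring S] [Module.Finite ℤ S]
    [Module.IsTorsionFree ℤ S] (X : PrincipalGenus S) : LocFree S X.carrier :=
  have := X.isLattice.1
  have := X.isLattice.2
  X.sameGenus.locFree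

/-- A chosen reduction modulo two of a locally free lattice of rank one. -/
noncomputable def _root_.PrincipalGenus.reduction {S R : Type u} [Ring S] [Ring R]
    [Module.Finite ℤ S] [Module.IsTorsionFree ℤ S] {q : S →+* R} (hq : IsModTwo q)
    (X : PrincipalGenus S) : X.carrier →ₛₗ[q] R :=
  (X.locFree.exists_reduction hq).choose

theorem _root_.PrincipalGenus.isReduction {S R : Type u} [Ring S] [Ring R]
    [Module.Finite ℤ S] [Module.IsTorsionFree ℤ S] {q : S →+* R} (hq : IsModTwo q)
    (X : PrincipalGenus S) : IsReduction (X.reduction hq) :=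
  (X.locFree.exists_reduction hq).choose_spec

theorem _root_.PrincipalGenus.finite {S : Type u} [Ring S] (X : PrincipalGenus S) :
    Module.Finite S X.carrier := by
  have := X.isLattice.1
  obtain ⟨s, hs⟩ := (Module.Finite.fg_top : (⊤ : Submodule ℤ X.carrier).FG)
  refine ⟨⟨s, eq_top_iff.mpr fun x _ => ?_⟩⟩
  have hx : x ∈ Submodule.span ℤ (s : Set X.carrier) := hs ▸ Submodule.mem_top
  exact Submodule.span_induction (fun y hy => Submodule.subset_span hy) (zero_mem _)
    (fun _ _ _ _ h h' => add_mem h h') (fun n _ _ h => zsmul_mem h n) hx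

theorem _root_.PrincipalGenus.noTwoTorsion {S : Type u} [Ring S] (X : PrincipalGenus S) :
    NoTwoTorsion X.carrier :=
  have := X.isLattice.2
  NoTwoTorsion.of_isTorsionFree _

variable (D) in
/-- The locally free lattice glued from two locally free lattices along an automorphism of `R`. -/
noncomputable def glueGenus (Y : PrincipalGenus Λ₁) (Z : PrincipalGenus Λ₂) (a : R ≃ₗ[R] R) :
    PrincipalGenus Λ where
  carrier := D.Glue (Y.reduction D.red₁) (semiComp a (Z.reduction D.red₂))
  isLattice := glue_isLattice _ _ Y.isLattice Z.isLattice
  sameGenus := (glue_locFree (Y.isReduction D.red₁) ((Z.isReduction D.red₂).semiComp a)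
    Y.isLattice Z.isLattice Y.locFree Z.locFree).sameGenus

theorem glueGenus_injective [Finite R] {Y Y' : PrincipalGenus Λ₁} {Z Z' : PrincipalGenus Λ₂}
    {a a' : R ≃ₗ[R] R}
    (h : StablyIsomorphic Λ (D.glueGenus Y Z a).carrier (D.glueGenus Y' Z' a').carrier) :
    StablyIsomorphic Λ₁ Y.carrier Y'.carrier ∧ StablyIsomorphic Λ₂ Z.carrier Z'.carrier := by
  have h₁ := NoTwoTorsion.of_isTorsionFree Λ₁
  have h₂ := NoTwoTorsion.of_isTorsionFree Λ₂
  obtain ⟨m, ⟨e⟩⟩ := h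
  obtain ⟨φ₁, φ₂, -⟩ := Glue.exists_equivs
    ((Y.isReduction D.red₁).semiProd (.semiPi D.red₁ m))
    (((Z.isReduction D.red₂).semiComp a).semiProd (.semiPi D.red₂ m))
    ((Y'.isReduction D.red₁).semiProd (.semiPi D.red₁ m))
    (((Z'.isReduction D.red₂).semiComp a').semiProd (.semiPi D.red₂ m))
    (Y.noTwoTorsion.prod (h₁.pi m)) (Y'.noTwoTorsion.prod (h₁.pi m))
    (Z.noTwoTorsion.prod (h₂.pi m)) (Z'.noTwoTorsion.prod (h₂.pi m))
    ((Glue.prodPiEquiv m).trans (e.trans (Glue.prodPiEquiv m).symm))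
  exact ⟨⟨m, ⟨φ₁⟩⟩, ⟨m, ⟨φ₂⟩⟩⟩

/-- `X` is glued from some `Y` and `Z`. Stable isomorphisms to `Y'` and `Z'` carry the gluing to an
automorphism of R × Rⁿ, which stable range one reduces to a unit. -/
theorem exists_stablyIsomorphic_glueGenus [Finite R] (X : PrincipalGenus Λ)
    [Module.Finite ℤ Λ] [Module.IsTorsionFree ℤ Λ] :
    ∃ (Y : PrincipalGenus Λ₁) (Z : PrincipalGenus Λ₂), ∀ (Y' : PrincipalGenus Λ₁)
      (Z' : PrincipalGenus Λ₂), StablyIsomorphic Λ₁ Y.carrier Y'.carrier →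
      StablyIsomorphic Λ₂ Z.carrier Z'.carrier →
      ∃ a, StablyIsomorphic Λ X.carrier (D.glueGenus Y' Z' a).carrier := by
  obtain ⟨Y, Z, _, _, _, _, α, β, hY, hZ, fY, fZ, hα, hβ, ⟨e⟩⟩ :=
    exists_glue_equiv_of_locFree (D := D) X.carrier X.isLattice X.locFree
  refine ⟨⟨Y, hY, fY.sameGenus⟩, ⟨Z, hZ, fZ.sameGenus⟩, ?_⟩
  rintro Y' Z' ⟨m, hm⟩ ⟨k, hk⟩
  obtain ⟨e₁⟩ := StablyIsomorphic.exists_le hm k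
  obtain ⟨e₂⟩ := StablyIsomorphic.exists_le hk m
  rw [add_comm k m] at e₂
  generalize m + k = n at e₁ e₂
  have hY' := Y'.locFree.projective
  have rY := Y'.isReduction D.red₁
  have rZ := Z'.isReduction D.red₂
  obtain ⟨c₁, hc₁⟩ := (hα.semiProd (.semiPi D.red₁ n)).exists_equiv
    (rY.semiProd (.semiPi D.red₁ n)) D.red₁.surjective e₁
  obtain ⟨c₂, hc₂⟩ := (hβ.semiProd (.semiPi D.red₂ n)).exists_equiv
    (rZ.semiProd (.semiPi D.red₂ n)) D.red₂.surjective e₂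
  obtain ⟨h, hh, a, ha⟩ := exists_univLiftable_mul_eq (M := R) 1 LinearMap.id rfl n
    (c₂.symm.trans c₁)
  obtain ⟨A, hA⟩ := hh D.q₁ D.red₁ _ rY
  let F := Glue.congr (D := D) (α := semiProd α (semiPi D.q₁ n)) (β := semiProd β (semiPi D.q₂ n))
    (α' := semiProd (Y'.reduction D.red₁) (semiPi D.q₁ n))
    (β' := semiProd (semiComp a (Z'.reduction D.red₂)) (semiPi D.q₂ n))
    (e₁.trans A) e₂ (c₁.trans h) (fun y => by
      rw [LinearEquiv.trans_apply, hA, hc₁, LinearEquiv.trans_apply]) (fun z => by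
      have h1 := ha ((Z'.reduction D.red₂) (e₂ z).1) (semiPi D.q₂ n (e₂ z).2)
      have h2 : ((Z'.reduction D.red₂) (e₂ z).1, semiPi D.q₂ n (e₂ z).2) =
          c₂ (semiProd β (semiPi D.q₂ n) z) := hc₂ z
      rw [h2, LinearEquiv.trans_apply, LinearEquiv.symm_apply_apply] at h1
      exact h1.symm)
  exact ⟨a, n, ⟨(e.prodCongr (LinearEquiv.refl Λ _)).trans <| (Glue.prodPiEquiv n).symm.trans <|
    F.trans (Glue.prodPiEquiv n)⟩⟩

/-- The class number of a fibre product. -/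
theorem card_locallyFreeClassGroup (D : FiberSquare Λ Λ₁ Λ₂ R) [Finite R] [Module.Finite ℤ Λ]
    [Module.IsTorsionFree ℤ Λ] :
    Nat.card (LocallyFreeClassGroup Λ) = Nat.card (LocallyFreeClassGroup Λ₁) *
      Nat.card (LocallyFreeClassGroup Λ₂) * D.stableUnits.index := by
  -- With representatives of the two component classes fixed, the remaining freedom is exactly the
  -- coset of the gluing unit modulo the stable units.
  let F : LocallyFreeClassGroup Λ₁ × LocallyFreeClassGroup Λ₂ × ((R ≃ₗ[R] R) ⧸ D.stableUnits) →
      LocallyFreeClassGroup Λ := fun x =>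
    Quotient.mk (PrincipalGenus.setoid Λ)
      (D.glueGenus (Quotient.out x.1) (Quotient.out x.2.1) (Quotient.out x.2.2))
  have hF : Function.Bijective F := by
    constructor
    · rintro ⟨c₁, c₂, a⟩ ⟨c₁', c₂', a'⟩ h
      have h : StablyIsomorphic Λ _ _ := Quotient.exact h
      obtain ⟨i₁, i₂⟩ := glueGenus_injective h
      obtain rfl : c₁ = c₁' := Quotient.out_equiv_out.mp i₁
      obtain rfl : c₂ = c₂' := Quotient.out_equiv_out.mp i₂
      have := (Quotient.out c₁).locFree.projective
      have := (Quotient.out c₁).finite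
      have := (Quotient.out c₂).locFree.projective
      have := (Quotient.out c₂).finite
      have := inv_mul_mem_stableUnits (NoTwoTorsion.of_isTorsionFree Λ₁)
        (NoTwoTorsion.of_isTorsionFree Λ₂) (Quotient.out c₁).noTwoTorsion
        (Quotient.out c₂).noTwoTorsion ((Quotient.out c₁).isReduction D.red₁)
        ((Quotient.out c₂).isReduction D.red₂) h
      rw [← QuotientGroup.eq, QuotientGroup.out_eq', QuotientGroup.out_eq'] at this
      have this : a' = a := this
      rw [this]
    · intro c
      obtain ⟨X, rfl⟩ := Quotient.exists_rep c
      obtain ⟨Y, Z, h⟩ := exists_stablyIsomorphic_glueGenus (D := D) X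
      let c₁ : LocallyFreeClassGroup Λ₁ := Quotient.mk _ Y
      let c₂ : LocallyFreeClassGroup Λ₂ := Quotient.mk _ Z
      obtain ⟨a, ha⟩ := h (Quotient.out c₁) (Quotient.out c₂)
        (Setoid.symm (Quotient.mk_out Y)) (Setoid.symm (Quotient.mk_out Z))
      refine ⟨(c₁, c₂, QuotientGroup.mk a), Quotient.sound ?_⟩
      have := (Quotient.out c₁).locFree.projective
      have := (Quotient.out c₂).locFree.projective
      refine StablyIsomorphic.trans ?_ ((PrincipalGenus.setoid Λ).iseqv.symm ha)
      refine stablyIsomorphic_of_mem ((Quotient.out c₁).isReduction D.red₁)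
        ((Quotient.out c₂).isReduction D.red₂) ?_
      rw [← QuotientGroup.eq]
      exact (QuotientGroup.out_eq' _).symm
  rw [← Nat.card_congr (Equiv.ofBijective F hF), Nat.card_prod, Nat.card_prod, mul_assoc]
  rfl

end ClassNumber

end FiberSquare

/-! ### Minimal vectors of integral norms -/

section Minimal

variable {n : ℕ}

/-- An integral norm on `ℤⁿ`. -/
structure IsIntNorm (Q : (Fin n → ℤ) → ℤ) : Prop where
  add_le : ∀ x y, Q (x + y) ≤ Q x + Q y
  smul : ∀ (a : ℤ) x, Q (a • x) = |a| * Q x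
  abs_le : ∀ x i, |x i| ≤ Q x

namespace IsIntNorm

variable {Q : (Fin n → ℤ) → ℤ} (hQ : IsIntNorm Q)
include hQ

theorem zero : Q 0 = 0 := by
  simpa using hQ.smul 0 0

theorem sum_le {ι : Type*} (s : Finset ι) (f : ι → Fin n → ℤ) :
    Q (∑ i ∈ s, f i) ≤ ∑ i ∈ s, Q (f i) := by
  classical
  induction s using Finset.induction_on with
  | empty => simp [hQ.zero]
  | insert a s ha ih =>
    rw [Finset.sum_insert ha, Finset.sum_insert ha]
    exact (hQ.add_le _ _).trans (by gcongr)

theorem sub_le (x y : Fin n → ℤ) : Q (x - y) ≤ Q x + Q y := by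
  have h := hQ.add_le x ((-1 : ℤ) • y)
  rw [hQ.smul] at h
  simpa [sub_eq_add_neg] using h

theorem pos {x : Fin n → ℤ} (hx : x ≠ 0) : 0 < Q x := by
  obtain ⟨i, hi⟩ := Function.ne_iff.mp hx
  exact (abs_pos.mpr hi).trans_le (hQ.abs_le x i)

theorem finite_le (c : ℤ) : {x | Q x ≤ c}.Finite := by
  refine (Set.Finite.pi' fun _ : Fin n => Set.finite_Icc (-c) c).subset fun x hx i => ?_
  exact Set.mem_Icc.mpr (_root_.abs_le.mp ((hQ.abs_le x i).trans hx))

theorem mulVec_le {A : Matrix (Fin n) (Fin n) ℤ} {m c : ℤ} (hA : ∀ j, Q (A.col j) ≤ m)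
    (hc : 0 ≤ c) {y : Fin n → ℤ} (hy : ∀ j, |y j| ≤ c) : Q (A.mulVec y) ≤ n * (c * m) := by
  rw [Matrix.mulVec_eq_sum]
  refine (hQ.sum_le _ _).trans ?_
  have : ∀ j ∈ Finset.univ, Q (MulOpposite.op (y j) • A.transpose j) ≤ c * m := by
    intro j _
    have h : MulOpposite.op (y j) • A.transpose j = y j • A.col j := by
      ext i; simp [Matrix.col, mul_comm]
    rw [h, hQ.smul]
    have h0 : 0 ≤ Q (A.col j) := by
      have := (abs_nonneg _).trans (hQ.abs_le (A.col j) j)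
      exact this
    exact mul_le_mul (hy j) (hA j) h0 hc
  refine (Finset.sum_le_sum this).trans ?_
  simp

/-- A sublattice of full rank spanned by minimal vectors has exponent bounded in terms of `n`. -/
theorem exists_mulVec_eq {A : Matrix (Fin n) (Fin n) ℤ} (hdet : A.det ≠ 0) {m : ℤ} (hm : 0 < m)
    (hA : ∀ j, Q (A.col j) ≤ m) (hmin : ∀ x, x ≠ 0 → m ≤ Q x) (w : Fin n → ℤ) :
    ∃ y, A.mulVec y = (((2 * n + 1) ^ n).factorial : ℤ) • w := by
  set d := A.det with hd
  set k := 2 * n + 1 with hk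
  -- With Ac = dw, rounding jc/d down leaves remainders r j = jw - A(q j) of norm at most nm. Two of
  -- kⁿ + 1 remainders agree modulo k = 2n + 1. Their difference is ku with k Q(u) ≤ 2nm < km, so u
  -- = 0 by minimality of m. Hence (j - j')w lies in the image of A, and 0 < |j - j'| ≤ kⁿ.
  let c := A.cramer w
  have hc : A.mulVec c = d • w := A.mulVec_cramer w
  let q : ℤ → Fin n → ℤ := fun j i => j * c i / d
  let r : ℤ → Fin n → ℤ := fun j => j • w - A.mulVec (q j)
  have hr : ∀ j, d • r j = A.mulVec fun i => j * c i % d := by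
    intro j
    have h1 : (fun i => j * c i % d) = j • c - d • q j := by
      ext i
      simp only [Pi.sub_apply, Pi.smul_apply, smul_eq_mul, q]
      have := Int.emod_add_mul_ediv (j * c i) d
      linarith
    rw [h1, Matrix.mulVec_sub, Matrix.mulVec_smul, Matrix.mulVec_smul, hc]
    simp only [r, smul_sub]
    rw [smul_comm]
  have hQr : ∀ j, Q (r j) ≤ n * m := by
    intro j
    have h := hQ.mulVec_le hA (abs_nonneg d) (y := fun i => j * c i % d) fun i => by
      rw [abs_of_nonneg (Int.emod_nonneg _ hdet)]
      exact (Int.emod_lt_abs _ hdet).le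
    rw [← hr, hQ.smul] at h
    have hd' : 0 < |d| := abs_pos.mpr hdet
    refine le_of_mul_le_mul_left ?_ hd'
    linarith
  have : NeZero k := ⟨by omega⟩
  let F : Fin (k ^ n + 1) → Fin n → ZMod k := fun j i => (r (j : ℕ) i : ZMod k)
  obtain ⟨j, j', hne, hF⟩ : ∃ j j', j ≠ j' ∧ F j = F j' := by
    refine Fintype.exists_ne_map_eq_of_card_lt F ?_
    simp [ZMod.card]
  have heq : r (j : ℕ) = r (j' : ℕ) := by
    have hdvd : ∀ i, ∃ u : ℤ, (r (j : ℕ) - r (j' : ℕ)) i = k * u := by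
      intro i
      have h : ((r (j : ℕ) i : ℤ) : ZMod k) = (r (j' : ℕ) i : ℤ) := congrFun hF i
      obtain ⟨u, hu⟩ := (ZMod.intCast_eq_intCast_iff_dvd_sub _ _ _).mp h
      exact ⟨-u, by rw [Pi.sub_apply]; linarith⟩
    choose u hu using hdvd
    have hu' : r (j : ℕ) - r (j' : ℕ) = (k : ℤ) • u := funext hu
    by_contra hcon
    have hu0 : u ≠ 0 := by
      rintro rfl
      rw [smul_zero] at hu'
      exact hcon (sub_eq_zero.mp hu')
    have h1 := hQ.sub_le (r (j : ℕ)) (r (j' : ℕ))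
    rw [hu', hQ.smul, Nat.abs_cast] at h1
    have h2 := hQr (j : ℕ)
    have h3 := hQr (j' : ℕ)
    have h4 := hmin u hu0
    have h5 : (k : ℤ) * m ≤ k * Q u := by gcongr
    have h6 : (k : ℤ) * m = 2 * (n * m) + m := by rw [hk]; push_cast; ring
    linarith
  have hw : ((j : ℕ) - (j' : ℕ) : ℤ) • w = A.mulVec (q (j : ℕ) - q (j' : ℕ)) := by
    rw [Matrix.mulVec_sub, sub_smul]
    simp only [r] at heq
    rw [sub_eq_sub_iff_add_eq_add] at heq ⊢
    rw [heq, add_comm]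
  have hdiv : ((j : ℕ) - (j' : ℕ) : ℤ) ∣ ((k ^ n).factorial : ℤ) := by
    rw [← Int.natAbs_dvd_natAbs, Int.natAbs_natCast]
    refine Nat.dvd_factorial ?_ ?_
    · have : (j : ℕ) ≠ j' := fun h => hne (Fin.ext h)
      omega
    · have := j.2
      have := j'.2
      omega
  obtain ⟨t, ht⟩ := hdiv
  refine ⟨t • (q (j : ℕ) - q (j' : ℕ)), ?_⟩
  rw [Matrix.mulVec_smul, ← hw, ht, smul_smul, mul_comm]

end IsIntNorm

end Minimal

section Minimal

variable {n : ℕ}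

/-- The hypothesis says that S spans ℚⁿ, so S contains a ℚ-basis. -/
theorem exists_matrix_col_mem (S : Set (Fin n → ℤ))
    (hS : ∀ x, ∃ a : ℤ, a ≠ 0 ∧ a • x ∈ Submodule.span ℤ S) :
    ∃ A : Matrix (Fin n) (Fin n) ℤ, A.det ≠ 0 ∧ ∀ j, A.col j ∈ S := by
  let φ : (Fin n → ℤ) →ₗ[ℤ] (Fin n → ℚ) := (Algebra.linearMap ℤ ℚ).compLeft (Fin n)
  have hφ : ∀ x i, φ x i = (x i : ℚ) := fun x i => rfl
  have hle : ∀ x ∈ Submodule.span ℤ S, φ x ∈ Submodule.span ℚ (φ '' S) := by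
    intro x hx
    induction hx using Submodule.span_induction with
    | mem x hx => exact Submodule.subset_span ⟨x, hx, rfl⟩
    | zero => rw [map_zero]; exact Submodule.zero_mem _
    | add x y _ _ hx hy => rw [map_add]; exact Submodule.add_mem _ hx hy
    | smul a x _ hx => rw [map_smul]; exact Submodule.smul_of_tower_mem _ a hx
  have htop : ⊤ ≤ Submodule.span ℚ (φ '' S) := by
    rw [← (Pi.basisFun ℚ (Fin n)).span_eq, Submodule.span_le]
    rintro _ ⟨i, rfl⟩
    obtain ⟨a, ha, hmem⟩ := hS (Pi.single i 1)
    have h := hle _ hmem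
    have ha' : (a : ℚ) ≠ 0 := by exact_mod_cast ha
    have he : φ (a • Pi.single i 1) = (a : ℚ) • (Pi.basisFun ℚ (Fin n)) i := by
      ext j
      rw [hφ]
      by_cases hj : j = i
      · subst hj; simp
      · simp [Pi.single_eq_of_ne hj]
    rw [he] at h
    exact (Submodule.smul_mem_iff _ ha').mp h
  obtain ⟨b, hbS, hspan, hli⟩ := exists_linearIndependent ℚ (φ '' S)
  let B := Module.Basis.mk hli (by rw [Subtype.range_coe, hspan]; exact htop)
  have : Finite b := Module.Finite.finite_basis B
  have := Fintype.ofFinite b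
  have hcard : Fintype.card b = n := by
    rw [← Module.finrank_eq_card_basis B, Module.finrank_fin_fun]
  let e : Fin n ≃ b := (Fintype.equivFinOfCardEq hcard).symm
  choose s hsS hs using fun j => hbS (e j).2
  refine ⟨Matrix.of fun i j => s j i, ?_, hsS⟩
  have hli' : LinearIndependent ℚ (((Matrix.of fun i j => s j i).map (Int.cast : ℤ → ℚ)).col) := by
    have h : ((Matrix.of fun i j => s j i).map (Int.cast : ℤ → ℚ)).col = Subtype.val ∘ e := by
      ext j i
      rw [Function.comp_apply, ← hs]
      rfl
    rw [h]
    exact hli.comp e e.injective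
  rw [Matrix.linearIndependent_cols_iff_isUnit, Matrix.isUnit_iff_isUnit_det] at hli'
  intro h0
  have h := Int.cast_det (R := ℚ) (Matrix.of fun i j => s j i)
  rw [h0] at h
  rw [Matrix.map] at hli'
  have h' := hli'.ne_zero
  apply h'
  rw [← Int.cast_zero, h]
  rfl

end Minimal

/-! ### Integral representations: reducible or bounded -/

section Representation

variable {n : ℕ} {G : Type u} [Group G]

/-- The invariant `ℓ¹`-norm of an integral representation. -/
def invNorm [Fintype G] (ρ : Representation ℤ G (Fin n → ℤ)) (x : Fin n → ℤ) : ℤ :=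
  ∑ g, ∑ i, |ρ g x i|

theorem isIntNorm_invNorm [Fintype G] (ρ : Representation ℤ G (Fin n → ℤ)) :
    IsIntNorm (invNorm ρ) where
  add_le x y := by
    simp only [invNorm, ← Finset.sum_add_distrib, map_add, Pi.add_apply]
    exact Finset.sum_le_sum fun g _ => Finset.sum_le_sum fun i _ => abs_add_le _ _
  smul a x := by
    simp only [invNorm, Finset.mul_sum, map_smul, Pi.smul_apply, smul_eq_mul, abs_mul]
  abs_le x i := by
    have h1 : |x i| ≤ ∑ i, |ρ 1 x i| := by
      rw [map_one]
      exact Finset.single_le_sum (f := fun i => |x i|) (fun i _ => abs_nonneg _)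
        (Finset.mem_univ i)
    exact h1.trans (Finset.single_le_sum (f := fun g => ∑ i, |ρ g x i|)
      (fun g _ => Finset.sum_nonneg fun i _ => abs_nonneg _) (Finset.mem_univ 1))

theorem invNorm_apply [Fintype G] (ρ : Representation ℤ G (Fin n → ℤ)) (h : G) (x : Fin n → ℤ) :
    invNorm ρ (ρ h x) = invNorm ρ x := by
  unfold invNorm
  refine Fintype.sum_equiv (Equiv.mulRight h) _ _ fun g => ?_
  simp [map_mul]

/-- An integral representation either has a nontrivial pure invariant sublattice, or it embeds
in `ℤⁿ` with an image of bounded exponent and with bounded matrices. -/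
theorem exists_pure_or_exists_bounded [Finite G] (ρ : Representation ℤ G (Fin n → ℤ)) :
    (∃ W : Submodule ℤ (Fin n → ℤ), (∀ g, ∀ x ∈ W, ρ g x ∈ W) ∧
      (∀ (a : ℤ) x, a ≠ 0 → a • x ∈ W → x ∈ W) ∧ W ≠ ⊥ ∧ W ≠ ⊤) ∨
    ∃ (ψ : (Fin n → ℤ) →ₗ[ℤ] (Fin n → ℤ)) (B : G → Matrix (Fin n) (Fin n) ℤ),
      Function.Injective ψ ∧ (∀ z, ∃ x, ψ x = (((2 * n + 1) ^ n).factorial : ℤ) • z) ∧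
      (∀ g i j, |B g i j| ≤ ((2 * n + 1) ^ n).factorial) ∧
      ∀ g x, (((2 * n + 1) ^ n).factorial : ℤ) • ψ (ρ g x) = (B g).mulVec (ψ x) := by
  classical
  obtain rfl | hn := Nat.eq_zero_or_pos n
  · exact .inr ⟨0, 0, Function.injective_of_subsingleton _, fun _ => ⟨0, Subsingleton.elim _ _⟩,
      fun _ i => i.elim0, fun _ _ => Subsingleton.elim _ _⟩
  have := Fintype.ofFinite G
  set E : ℤ := (((2 * n + 1) ^ n).factorial : ℤ) with hE
  have hE0 : E ≠ 0 := Nat.cast_ne_zero.mpr (Nat.factorial_ne_zero _)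
  have hQ := isIntNorm_invNorm ρ
  set Q := invNorm ρ
  obtain ⟨x₀, hx₀, hmin⟩ : ∃ x₀, x₀ ≠ 0 ∧ ∀ x, x ≠ 0 → Q x₀ ≤ Q x := by
    let y : Fin n → ℤ := fun _ => 1
    have hy : y ≠ 0 := fun h => one_ne_zero (congrFun h ⟨0, hn⟩)
    obtain ⟨x₀, ⟨h0, _⟩, h⟩ := Set.exists_min_image {x | x ≠ 0 ∧ Q x ≤ Q y} Q
      ((hQ.finite_le (Q y)).subset fun x hx => hx.2) ⟨y, hy, le_rfl⟩
    refine ⟨x₀, h0, fun x hx => ?_⟩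
    rcases le_total (Q x) (Q y) with hle | hle
    · exact h x ⟨hx, hle⟩
    · exact (h y ⟨hy, le_rfl⟩).trans hle
  set m := Q x₀
  have hm : 0 < m := hQ.pos hx₀
  let S : Set (Fin n → ℤ) := {x | Q x = m}
  have hSfin : S.Finite := (hQ.finite_le m).subset fun x hx => le_of_eq hx
  have hSρ : ∀ g, ∀ x ∈ S, ρ g x ∈ S := fun g x hx => (invNorm_apply ρ g x).trans hx
  have hspan : ∀ g, ∀ x ∈ Submodule.span ℤ S, ρ g x ∈ Submodule.span ℤ S := by
    intro g x hx
    induction hx using Submodule.span_induction with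
    | mem x hx => exact Submodule.subset_span (hSρ g x hx)
    | zero => rw [map_zero]; exact Submodule.zero_mem _
    | add x y _ _ hx hy => rw [map_add]; exact Submodule.add_mem _ hx hy
    | smul a x _ hx => rw [map_smul]; exact Submodule.smul_mem _ a hx
  -- The minimal vectors form a finite invariant set S. Either they span a sublattice of full rank,
  -- or the saturation of their span is a proper nonzero pure invariant sublattice.
  by_cases hfull : ∀ x, ∃ a : ℤ, a ≠ 0 ∧ a • x ∈ Submodule.span ℤ S
  · right
    -- Maximality of |det A| bounds every Cramer determinant, so each minimal vector has coordinates
    -- at most E in absolute value under ψ = E A⁻¹.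
    obtain ⟨A, hA, hdet, hmax⟩ : ∃ A : Matrix (Fin n) (Fin n) ℤ, (∀ j, A.col j ∈ S) ∧ A.det ≠ 0 ∧
        ∀ A' : Matrix (Fin n) (Fin n) ℤ, (∀ j, A'.col j ∈ S) → |A'.det| ≤ |A.det| := by
      obtain ⟨A₀, h0, hA₀⟩ := exists_matrix_col_mem S hfull
      have hfin : {A : Matrix (Fin n) (Fin n) ℤ | ∀ j, A.col j ∈ S}.Finite :=
        Set.Finite.of_injOn (f := Matrix.transpose) (t := {B : Fin n → Fin n → ℤ | ∀ j, B j ∈ S})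
          (fun A hA => hA) (Matrix.transpose_injective.injOn)
          (Set.Finite.pi' fun _ => hSfin)
      obtain ⟨A, hA, h⟩ := Set.exists_max_image _ (fun A => |A.det|) hfin ⟨A₀, hA₀⟩
      refine ⟨A, hA, fun h0' => ?_, h⟩
      have := h A₀ hA₀
      simp only [h0', abs_zero] at this
      exact h0 (abs_nonpos_iff.mp this)
    have hinj : Function.Injective A.mulVec := Matrix.mulVec_injective_of_det_ne_zero hdet
    choose c hc using hQ.exists_mulVec_eq hdet hm (fun j => le_of_eq (hA j)) hmin
    let ψ : (Fin n → ℤ) →ₗ[ℤ] (Fin n → ℤ) :=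
      { toFun := c
        map_add' := fun x y => hinj (by rw [Matrix.mulVec_add, hc, hc, hc, smul_add])
        map_smul' := fun a x => hinj (by
          rw [Matrix.mulVec_smul, hc, hc, RingHom.id_apply, smul_comm]) }
    have hψ : ∀ x, A.mulVec (ψ x) = E • x := hc
    have hbound : ∀ w ∈ S, ∀ i, |ψ w i| ≤ E := by
      intro w hw i
      have h1 : A.det • ψ w = E • A.cramer w := hinj (by
        rw [Matrix.mulVec_smul, Matrix.mulVec_smul, hψ, Matrix.mulVec_cramer, smul_comm])
      have h2 : |A.cramer w i| ≤ |A.det| := by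
        rw [Matrix.cramer_apply]
        refine hmax _ fun j => ?_
        by_cases hj : j = i
        · subst hj
          have : (A.updateCol j w).col j = w := by ext k; simp [Matrix.col]
          rwa [this]
        · have : (A.updateCol i w).col j = A.col j := by
            ext k; simp [Matrix.col, Matrix.updateCol_ne hj]
          rw [this]
          exact hA j
      have h3 := congrArg abs (congrFun h1 i)
      simp only [Pi.smul_apply, smul_eq_mul, abs_mul] at h3
      have hd : 0 < |A.det| := abs_pos.mpr hdet
      have hE' : |E| = E := abs_of_nonneg (by positivity)
      rw [hE'] at h3
      refine le_of_mul_le_mul_left ?_ hd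
      rw [h3, mul_comm |A.det|]
      exact mul_le_mul_of_nonneg_left h2 (by positivity)
    refine ⟨ψ, fun g => Matrix.of fun i j => ψ (ρ g (A.col j)) i, ?_, ?_, ?_, ?_⟩
    · intro x y hxy
      have : E • x = E • y := by rw [← hψ, ← hψ, hxy]
      exact smul_right_injective _ hE0 this
    · exact fun z => ⟨A.mulVec z, hinj (by rw [hψ, Matrix.mulVec_smul])⟩
    · exact fun g i j => hbound _ (hSρ g _ (hA j)) i
    · intro g x
      have h1 : E • ψ (ρ g x) = ψ (ρ g (A.mulVec (ψ x))) := by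
        rw [hψ, map_smul, map_smul]
      have h2 : A.mulVec (ψ x) = ∑ j, ψ x j • A.col j := by
        ext i
        simp [Matrix.mulVec, dotProduct, Matrix.col, mul_comm]
      rw [h1, h2]
      simp only [map_sum, map_smul]
      ext i
      simp [Matrix.mulVec, dotProduct, mul_comm]
  · left
    let W : Submodule ℤ (Fin n → ℤ) :=
      { carrier := {x | ∃ a : ℤ, a ≠ 0 ∧ a • x ∈ Submodule.span ℤ S}
        zero_mem' := ⟨1, one_ne_zero, by rw [smul_zero]; exact Submodule.zero_mem _⟩
        add_mem' := by
          rintro x y ⟨a, ha, hx⟩ ⟨b, hb, hy⟩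
          refine ⟨a * b, mul_ne_zero ha hb, ?_⟩
          rw [smul_add, mul_comm, mul_smul, mul_comm, mul_smul]
          exact Submodule.add_mem _ (Submodule.smul_mem _ b hx) (Submodule.smul_mem _ a hy)
        smul_mem' := by
          rintro c x ⟨a, ha, hx⟩
          refine ⟨a, ha, ?_⟩
          rw [smul_comm]
          exact Submodule.smul_mem _ c hx }
    refine ⟨W, ?_, ?_, ?_, ?_⟩
    · rintro g x ⟨a, ha, hx⟩
      refine ⟨a, ha, ?_⟩
      rw [← map_smul]
      exact hspan g _ hx
    · rintro a x ha ⟨b, hb, hx⟩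
      exact ⟨b * a, mul_ne_zero hb ha, by rwa [mul_smul]⟩
    · refine (Submodule.ne_bot_iff _).mpr ⟨x₀, ⟨1, one_ne_zero, ?_⟩, hx₀⟩
      rw [one_smul]
      exact Submodule.subset_span rfl
    · intro htop
      exact hfull fun x => (htop ▸ Submodule.mem_top : x ∈ W)

end Representation

/-! ### The Jordan–Zassenhaus theorem -/

/-- A lattice with an action of the group `G`. -/
structure GLattice (G : Type u) [Group G] where
  carrier : Type v
  [addCommGroup : AddCommGroup carrier]
  [finite : Module.Finite ℤ carrier]
  [free : Module.Free ℤ carrier]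
  ρ : Representation ℤ G carrier

namespace GLattice

variable {G : Type u} [Group G]

attribute [instance] addCommGroup finite free

/-- `X` and `Y` are isomorphic as lattices with `G`-action. -/
def Iso (X Y : GLattice.{u, v} G) : Prop :=
  ∃ e : X.carrier ≃ₗ[ℤ] Y.carrier, ∀ g x, e (X.ρ g x) = Y.ρ g (e x)

theorem exists_finite_representatives (C : GLattice.{u, v} G → Prop) {D : Type*} [Finite D]
    (F : GLattice.{u, v} G → D → Prop) (hF : ∀ X, C X → ∃ d, F X d)
    (hiso : ∀ X Y d, C X → C Y → F X d → F Y d → Iso X Y) :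
    ∃ S : Set (GLattice.{u, v} G), S.Finite ∧ ∀ X, C X → ∃ Y ∈ S, Iso X Y := by
  refine ⟨Set.range fun d : {d // ∃ X, C X ∧ F X d} => d.2.choose, Set.finite_range _, ?_⟩
  intro X hX
  obtain ⟨d, hd⟩ := hF X hX
  let d' : {d // ∃ X, C X ∧ F X d} := ⟨d, X, hX, hd⟩
  exact ⟨_, ⟨d', rfl⟩, hiso _ _ d hX d'.2.choose_spec.1 hd d'.2.choose_spec.2⟩

theorem iso_of_range_eq {X Y : GLattice.{u, v} G} {Z : Type*} [AddCommGroup Z]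
    [Module.IsTorsionFree ℤ Z] {E : ℕ} (hE : E ≠ 0) (B : G → Z → Z)
    {ψ : X.carrier →ₗ[ℤ] Z} {χ : Y.carrier →ₗ[ℤ] Z} (hψ : Function.Injective ψ)
    (hχ : Function.Injective χ) (hr : ψ.range = χ.range)
    (h₁ : ∀ g x, (E : ℤ) • ψ (X.ρ g x) = B g (ψ x))
    (h₂ : ∀ g y, (E : ℤ) • χ (Y.ρ g y) = B g (χ y)) : Iso X Y := by
  let e : X.carrier ≃ₗ[ℤ] Y.carrier := (LinearEquiv.ofInjective ψ hψ).trans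
    ((LinearEquiv.ofEq _ _ hr).trans (LinearEquiv.ofInjective χ hχ).symm)
  have he : ∀ x, χ (e x) = ψ x := fun x => by
    have h := (LinearEquiv.ofInjective χ hχ).apply_symm_apply
      (LinearEquiv.ofEq _ _ hr (LinearEquiv.ofInjective ψ hψ x))
    exact congrArg Subtype.val h
  refine ⟨e, fun g x => hχ ?_⟩
  have hE' : (E : ℤ) ≠ 0 := Nat.cast_ne_zero.mpr hE
  refine smul_right_injective Z hE' ?_
  simp only
  rw [he, h₁, h₂, he]

/-- Both images contain EZ, so each is determined by its image in Z/EZ. -/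
theorem range_eq_of_map_mkQ_eq {A A' Z : Type*} [AddCommGroup A] [AddCommGroup A']
    [AddCommGroup Z] {E : ℕ} {ψ : A →ₗ[ℤ] Z} {χ : A' →ₗ[ℤ] Z}
    (hψ : ∀ z, ∃ x, ψ x = (E : ℤ) • z) (hχ : ∀ z, ∃ x, χ x = (E : ℤ) • z)
    (h : ψ.range.map (LinearMap.lsmul ℤ Z E).range.mkQ =
      χ.range.map (LinearMap.lsmul ℤ Z E).range.mkQ) : ψ.range = χ.range := by
  have h1 : (LinearMap.lsmul ℤ Z E).range ≤ ψ.range := by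
    rintro _ ⟨z, rfl⟩
    exact hψ z
  have h2 : (LinearMap.lsmul ℤ Z E).range ≤ χ.range := by
    rintro _ ⟨z, rfl⟩
    exact hχ z
  have := congrArg (Submodule.comap (LinearMap.lsmul ℤ Z E).range.mkQ) h
  rwa [Submodule.comap_map_mkQ, Submodule.comap_map_mkQ, sup_eq_right.mpr h1,
    sup_eq_right.mpr h2] at this

theorem finite_submodule_modN (Z : Type*) [AddCommGroup Z] [Module.Finite ℤ Z] {E : ℕ}
    (hE : E ≠ 0) : Finite (Submodule ℤ (Z ⧸ (LinearMap.lsmul ℤ Z E).range)) := by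
  have : Finite (Z ⧸ (LinearMap.lsmul ℤ Z E).range) := by
    refine Module.finite_of_fg_torsion _ fun x => ?_
    obtain ⟨z, rfl⟩ := Submodule.Quotient.mk_surjective _ x
    refine ⟨⟨E, mem_nonZeroDivisors_of_ne_zero (Nat.cast_ne_zero.mpr hE)⟩, ?_⟩
    rw [Submonoid.mk_smul, ← Submodule.Quotient.mk_smul, Submodule.Quotient.mk_eq_zero]
    exact ⟨z, rfl⟩
  infer_instance

section Pure

variable (X : GLattice.{u, v} G) (W : Submodule ℤ X.carrier)
  (hW : ∀ g, ∀ x ∈ W, X.ρ g x ∈ W)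

/-- The invariant sublattice `W` as a lattice with `G`-action. -/
def sub : GLattice.{u, v} G where
  carrier := W
  ρ :=
    { toFun := fun g => (X.ρ g).restrict (hW g)
      map_one' := by ext x; simp
      map_mul' := fun g h => by ext x; simp }

/-- The quotient by a pure invariant sublattice `W` as a lattice with `G`-action. -/
def quot (hp : ∀ (a : ℤ) x, a ≠ 0 → a • x ∈ W → x ∈ W) : GLattice.{u, v} G :=
  have : Module.IsTorsionFree ℤ (X.carrier ⧸ W) := isTorsionFree_int_of_forall fun a y ha h => by
    obtain ⟨x, rfl⟩ := Submodule.Quotient.mk_surjective _ y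
    rw [← Submodule.Quotient.mk_smul, Submodule.Quotient.mk_eq_zero] at h
    exact (Submodule.Quotient.mk_eq_zero _).mpr (hp a x ha h)
  { carrier := X.carrier ⧸ W
    ρ :=
      { toFun := fun g => W.mapQ W (X.ρ g) (hW g)
        map_one' := by ext x; simp
        map_mul' := fun g h => by ext x; simp } }

variable (hp : ∀ (a : ℤ) x, a ≠ 0 → a • x ∈ W → x ∈ W)

/-- A lattice embeds, with image of exponent dividing the order of `G`, into the product of a pure
invariant sublattice and the quotient by it. -/
theorem exists_embedding_prod [Finite G] :
    ∃ (r : X.carrier →ₗ[ℤ] (X.sub W hW).carrier) (π : X.carrier →ₗ[ℤ] (X.quot W hW hp).carrier),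
      (∀ x, r x = 0 → π x = 0 → x = 0) ∧
      (∀ a b, ∃ x, r x = (Nat.card G : ℤ) • a ∧ π x = (Nat.card G : ℤ) • b) ∧
      (∀ g x, r (X.ρ g x) = (X.sub W hW).ρ g (r x)) ∧
      ∀ g x, π (X.ρ g x) = (X.quot W hW hp).ρ g (π x) := by
  have := Fintype.ofFinite G
  let Y := X.quot W hW hp
  let π : X.carrier →ₗ[ℤ] Y.carrier := W.mkQ
  have hπρ : ∀ g x, π (X.ρ g x) = Y.ρ g (π x) := fun g x => rfl
  have hπ0 : ∀ x, π x = 0 ↔ x ∈ W := fun x => Submodule.Quotient.mk_eq_zero W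
  obtain ⟨s, hs⟩ := LinearMap.exists_rightInverse_of_surjective π W.range_mkQ
  have hs : ∀ y, π (s y) = y := fun y => LinearMap.congr_fun hs y
  -- Maschke's averaging of a ℤ-linear section without dividing by |G|: t is equivariant with πt =
  -- |G|, and |G| - tπ maps into `W`.
  let t : Y.carrier →ₗ[ℤ] X.carrier := ∑ g : G, X.ρ g ∘ₗ s ∘ₗ Y.ρ g⁻¹
  have ht : ∀ y, t y = ∑ g : G, X.ρ g (s (Y.ρ g⁻¹ y)) := fun y => by
    simp [t, LinearMap.sum_apply]
  have hπt : ∀ y, π (t y) = (Nat.card G : ℤ) • y := by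
    intro y
    rw [ht, map_sum]
    have : ∀ g ∈ Finset.univ, π (X.ρ g (s (Y.ρ g⁻¹ y))) = y := fun g _ => by
      rw [hπρ, hs, ← Module.End.mul_apply, ← map_mul, mul_inv_cancel, map_one,
        Module.End.one_apply]
    rw [Finset.sum_congr rfl this, Finset.sum_const, Finset.card_univ, Nat.card_eq_fintype_card,
      natCast_zsmul]
  have htρ : ∀ h y, t (Y.ρ h y) = X.ρ h (t y) := by
    intro h y
    rw [ht, ht, map_sum]
    symm
    refine Fintype.sum_equiv (Equiv.mulLeft h) _ _ fun g => ?_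
    rw [Equiv.coe_mulLeft, mul_inv_rev, map_mul, map_mul, Module.End.mul_apply,
      Module.End.mul_apply, ← Module.End.mul_apply (Y.ρ h⁻¹), ← map_mul, inv_mul_cancel, map_one,
      Module.End.one_apply]
  let r₀ : X.carrier →ₗ[ℤ] X.carrier := (Nat.card G : ℤ) • LinearMap.id - t ∘ₗ π
  have hr₀ : ∀ x, r₀ x = (Nat.card G : ℤ) • x - t (π x) := fun x => rfl
  have hr₀W : ∀ x, r₀ x ∈ W := fun x => by
    rw [← hπ0, hr₀, map_sub, hπt, map_smul, sub_self]
  have hG : (Nat.card G : ℤ) ≠ 0 := Nat.cast_ne_zero.mpr Nat.card_pos.ne'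
  refine ⟨r₀.codRestrict W hr₀W, π, ?_, ?_, ?_, hπρ⟩
  · intro x hr hx
    have hr : r₀ x = 0 := congrArg Subtype.val hr
    rw [hr₀, hx, map_zero, sub_zero] at hr
    exact (smul_eq_zero.mp hr).resolve_left hG
  · intro a b
    have ha : π a.1 = 0 := (hπ0 _).mpr a.2
    refine ⟨a.1 + t b, Subtype.ext ?_, ?_⟩
    · change r₀ (a.1 + t b) = (Nat.card G : ℤ) • a.1
      rw [hr₀, map_add, ha, hπt, zero_add, map_smul, smul_add, add_sub_cancel_right]
    · rw [map_add, ha, hπt, zero_add]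
  · intro g x
    refine Subtype.ext ?_
    change r₀ (X.ρ g x) = X.ρ g (r₀ x)
    rw [hr₀, hr₀, hπρ, htρ, map_sub, map_smul]

end Pure

/-- **Jordan–Zassenhaus theorem** for lattices with an action of a finite group. -/
theorem exists_finite_representatives_of_finrank (G : Type u) [Group G] [Finite G] (n : ℕ) :
    ∃ S : Set (GLattice.{u, v} G), S.Finite ∧
      ∀ X, Module.finrank ℤ X.carrier = n → ∃ Y ∈ S, Iso X Y := by
  induction n using Nat.strong_induction_on with
  | _ n ih =>
  choose! S hSfin hS using ih
  let T : Set (GLattice.{u, v} G) := ⋃ k ∈ Set.Iio n, S k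
  have hTfin : T.Finite := (Set.finite_Iio n).biUnion fun k hk => hSfin k hk
  have hT : ∀ X : GLattice.{u, v} G, Module.finrank ℤ X.carrier < n → ∃ Y ∈ T, Iso X Y := by
    intro X hX
    obtain ⟨Y, hY, h⟩ := hS _ hX X rfl
    exact ⟨Y, Set.mem_biUnion (Set.mem_Iio.mpr hX) hY, h⟩
  have : Finite T := hTfin
  set E := ((2 * n + 1) ^ n).factorial with hE
  have hE0 : E ≠ 0 := Nat.factorial_ne_zero _
  have hG0 : Nat.card G ≠ 0 := Nat.card_pos.ne'
  have : Finite (Submodule ℤ ((Fin n → ℤ) ⧸ (LinearMap.lsmul ℤ (Fin n → ℤ) E).range)) :=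
    finite_submodule_modN _ hE0
  have (p : T × T) : Finite (Submodule ℤ ((p.1.1.carrier × p.2.1.carrier) ⧸
      (LinearMap.lsmul ℤ (p.1.1.carrier × p.2.1.carrier) (Nat.card G)).range)) :=
    finite_submodule_modN _ hG0
  -- Datum when no proper nonzero pure invariant sublattice is used: bounded action matrices and the
  -- image of the lattice in ℤⁿ modulo E.
  let F₁ : GLattice.{u, v} G → Submodule ℤ ((Fin n → ℤ) ⧸ (LinearMap.lsmul ℤ _ (E : ℤ)).range) ×
      (G → Fin n → Fin n → Set.Icc (-E : ℤ) E) → Prop := fun X d =>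
    ∃ ψ : X.carrier →ₗ[ℤ] (Fin n → ℤ), Function.Injective ψ ∧ (∀ z, ∃ x, ψ x = (E : ℤ) • z) ∧
      (∀ g x, (E : ℤ) • ψ (X.ρ g x) = (Matrix.of fun i j => (d.2 g i j : ℤ)).mulVec (ψ x)) ∧
      ψ.range.map (LinearMap.lsmul ℤ _ (E : ℤ)).range.mkQ = d.1
  -- Datum in the reducible case: representatives of smaller rank for the sublattice and the
  -- quotient, and the image of the lattice in their product modulo |G|.
  let F₂ : GLattice.{u, v} G → (Σ p : T × T, Submodule ℤ ((p.1.1.carrier × p.2.1.carrier) ⧸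
      (LinearMap.lsmul ℤ (p.1.1.carrier × p.2.1.carrier) (Nat.card G : ℤ)).range)) → Prop :=
    fun X d => ∃ ψ : X.carrier →ₗ[ℤ] d.1.1.1.carrier × d.1.2.1.carrier,
      Function.Injective ψ ∧ (∀ z, ∃ x, ψ x = (Nat.card G : ℤ) • z) ∧
      (∀ g x, ψ (X.ρ g x) = (d.1.1.1.ρ g (ψ x).1, d.1.2.1.ρ g (ψ x).2)) ∧
      ψ.range.map (LinearMap.lsmul ℤ _ (Nat.card G : ℤ)).range.mkQ = d.2
  refine exists_finite_representatives _ (fun X d => Sum.elim (F₁ X) (F₂ X) d) ?_ ?_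
  · intro X hX
    let b : X.carrier ≃ₗ[ℤ] (Fin n → ℤ) := (Module.finBasisOfFinrankEq ℤ X.carrier hX).equivFun
    let ρ' : Representation ℤ G (Fin n → ℤ) :=
      { toFun := fun g => b.toLinearMap ∘ₗ X.ρ g ∘ₗ b.symm.toLinearMap
        map_one' := by ext; simp
        map_mul' := fun g h => by ext; simp }
    have hρ' : ∀ g x, ρ' g (b x) = b (X.ρ g x) := fun g x => by simp [ρ']
    rcases exists_pure_or_exists_bounded ρ' with ⟨W', h1, h2, h3, h4⟩ | ⟨ψ, B, h1, h2, h3, h4⟩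
    · let W : Submodule ℤ X.carrier := W'.comap b.toLinearMap
      have hW : ∀ g, ∀ x ∈ W, X.ρ g x ∈ W := fun g x hx => by
        change b (X.ρ g x) ∈ W'
        rw [← hρ']
        exact h1 g _ hx
      have hp : ∀ (a : ℤ) x, a ≠ 0 → a • x ∈ W → x ∈ W := fun a x ha hx => by
        have hx : b (a • x) ∈ W' := hx
        rw [map_smul] at hx
        exact h2 a _ ha hx
      have hW1 : W ≠ ⊥ := fun h => h3 (by
        rw [← Submodule.map_comap_eq_of_surjective (f := b.toLinearMap) b.surjective W']
        change W.map _ = ⊥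
        rw [h, Submodule.map_bot])
      have hW2 : W ≠ ⊤ := fun h => h4 (by
        rw [← Submodule.map_comap_eq_of_surjective (f := b.toLinearMap) b.surjective W']
        change W.map _ = ⊤
        rw [h, Submodule.map_top]
        exact b.range)
      have hrank := W.finrank_quotient_add_finrank
      rw [hX] at hrank
      have hpos₁ : 0 < Module.finrank ℤ (X.sub W hW).carrier := by
        rw [Module.finrank_pos_iff]
        exact Submodule.nontrivial_iff_ne_bot.mpr hW1
      have hpos₂ : 0 < Module.finrank ℤ (X.quot W hW hp).carrier := by
        rw [Module.finrank_pos_iff]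
        exact Submodule.Quotient.nontrivial_iff.mpr hW2
      obtain ⟨Y, hY, e, he⟩ := hT (X.sub W hW) (by
        change 0 < Module.finrank ℤ (X.carrier ⧸ W) at hpos₂
        change Module.finrank ℤ W < n
        omega)
      obtain ⟨Z, hZ, f, hf⟩ := hT (X.quot W hW hp) (by
        change 0 < Module.finrank ℤ W at hpos₁
        change Module.finrank ℤ (X.carrier ⧸ W) < n
        omega)
      obtain ⟨r, π, i1, i2, i3, i4⟩ := X.exists_embedding_prod W hW hp
      let ψ : X.carrier →ₗ[ℤ] Y.carrier × Z.carrier :=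
        (e.toLinearMap ∘ₗ r).prod (f.toLinearMap ∘ₗ π)
      refine ⟨.inr ⟨(⟨Y, hY⟩, ⟨Z, hZ⟩),
        ψ.range.map (LinearMap.lsmul ℤ _ (Nat.card G : ℤ)).range.mkQ⟩, ψ, ?_, ?_, ?_, rfl⟩
      · rw [← LinearMap.ker_eq_bot, LinearMap.ker_eq_bot']
        intro x hx
        obtain ⟨hx1, hx2⟩ := Prod.mk.inj hx
        exact i1 x (e.map_eq_zero_iff.mp hx1) (f.map_eq_zero_iff.mp hx2)
      · rintro ⟨y, z⟩
        obtain ⟨x, hx1, hx2⟩ := i2 (e.symm y) (f.symm z)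
        refine ⟨x, Prod.ext ?_ ?_⟩
        · change e (r x) = (Nat.card G : ℤ) • y
          rw [hx1, map_smul, e.apply_symm_apply]
        · change f (π x) = (Nat.card G : ℤ) • z
          rw [hx2, map_smul, f.apply_symm_apply]
      · intro g x
        refine Prod.ext ?_ ?_
        · change e (r (X.ρ g x)) = Y.ρ g (e (r x))
          rw [i3, he]
        · change f (π (X.ρ g x)) = Z.ρ g (f (π x))
          rw [i4, hf]
    · refine ⟨.inl ⟨_, fun g i j => ⟨B g i j, abs_le.mp (h3 g i j)⟩⟩, ψ ∘ₗ b.toLinearMap,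
        h1.comp b.injective, ?_, ?_, rfl⟩
      · intro z
        obtain ⟨x, hx⟩ := h2 z
        exact ⟨b.symm x, by simpa using hx⟩
      · intro g x
        change (E : ℤ) • ψ (b (X.ρ g x)) = (B g).mulVec (ψ (b x))
        rw [← hρ', h4]
  · rintro X Y (⟨P, B⟩ | ⟨p, P⟩) hX hY ⟨ψ, h1, h2, h3, h4⟩ ⟨χ, k1, k2, k3, k4⟩
    · exact iso_of_range_eq hE0 _ h1 k1 (range_eq_of_map_mkQ_eq h2 k2 (h4.trans k4.symm)) h3 k3
    · exact iso_of_range_eq (Z := p.1.1.carrier × p.2.1.carrier) (E := 1) one_ne_zero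
        (fun g z => (p.1.1.ρ g z.1, p.2.1.ρ g z.2)) h1 k1
        (range_eq_of_map_mkQ_eq h2 k2 (h4.trans k4.symm))
        (fun g x => by rw [Nat.cast_one, one_smul]; exact h3 g x)
        (fun g x => by rw [Nat.cast_one, one_smul]; exact k3 g x)

end GLattice

/-! ### Finiteness of locally free class groups -/

section Finiteness

variable {G : Type v} [Group G] {Λ : Type u} [Ring Λ]

/-- A locally free lattice over a quotient of a group ring, as a lattice with group action. -/
noncomputable def PrincipalGenus.toGLattice (f : MonoidAlgebra ℤ G →+* Λ) (X : PrincipalGenus Λ) :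
    GLattice.{v, u} G :=
  have := X.isLattice.1
  have := X.isLattice.2
  { carrier := X.carrier
    ρ := ((Module.toModuleEnd ℤ X.carrier : Λ →+* Module.End ℤ X.carrier).comp f :
      MonoidAlgebra ℤ G →* Module.End ℤ X.carrier).comp (MonoidAlgebra.of ℤ G) }

theorem PrincipalGenus.nonempty_equiv_of_iso {f : MonoidAlgebra ℤ G →+* Λ}
    (hf : Function.Surjective f) {X Y : PrincipalGenus Λ} {Z : GLattice.{v, u} G}
    (hX : (X.toGLattice f).Iso Z) (hY : (Y.toGLattice f).Iso Z) :
    Nonempty (X.carrier ≃ₗ[Λ] Y.carrier) := by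
  obtain ⟨e, he⟩ := hX
  obtain ⟨e', he'⟩ := hY
  let i : X.carrier ≃+ Y.carrier := e.toAddEquiv.trans e'.symm.toAddEquiv
  have hi : ∀ x, e' (i x) = e x := fun x => e'.apply_symm_apply _
  have he : ∀ g (x : X.carrier), e (f (MonoidAlgebra.of ℤ G g) • x) = Z.ρ g (e x) := he
  have he' : ∀ g (x : Y.carrier), e' (f (MonoidAlgebra.of ℤ G g) • x) = Z.ρ g (e' x) := he'
  refine ⟨i.toLinearEquiv fun c x => ?_⟩
  obtain ⟨a, rfl⟩ := hf c
  induction a using MonoidAlgebra.induction_on with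
  | of g =>
    apply e'.injective
    rw [hi, he, he', hi]
  | add a b ha hb => rw [map_add, add_smul, map_add, ha, hb, add_smul]
  | smul r a ha => rw [map_zsmul, smul_assoc, map_zsmul, ha, smul_assoc]

theorem LocFree.self (Λ : Type u) [Ring Λ] : LocFree Λ Λ := fun p hp =>
  ⟨LinearMap.id, LinearMap.id, 1, fun h => hp.not_dvd_one (by exact_mod_cast h),
    fun a => (one_smul ℤ a).symm, fun a => (one_smul ℤ a).symm⟩

theorem LocFree.finrank_eq [Module.Finite ℤ Λ] [Module.IsTorsionFree ℤ Λ] {X : Type u}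
    [AddCommGroup X] [Module Λ X] (hX : IsLatticeOver Λ X) (h : LocFree Λ X) :
    Module.finrank ℤ X = Module.finrank ℤ Λ := by
  have := hX.1
  have := hX.2
  obtain ⟨f, g, s, hs, h1, h2⟩ := h 2 Nat.prime_two
  have hs0 : s ≠ 0 := by rintro rfl; exact hs (dvd_zero _)
  apply le_antisymm
  · refine LinearMap.finrank_le_finrank_of_injective (f := g.toAddMonoidHom.toIntLinearMap) ?_
    intro x y hxy
    have hxy : g x = g y := hxy
    exact smul_right_injective X hs0 (by simp only [← h2, hxy])
  · refine LinearMap.finrank_le_finrank_of_injective (f := f.toAddMonoidHom.toIntLinearMap) ?_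
    intro x y hxy
    have hxy : f x = f y := hxy
    exact smul_right_injective Λ hs0 (by simp only [← h1, hxy])

/-- Locally free lattices of rank one have the ℤ-rank of Λ, and since `f` is surjective an
isomorphism respecting the action of G is Λ-linear; so Jordan–Zassenhaus applies. -/
theorem finite_locallyFreeClassGroup [Finite G] [Module.Finite ℤ Λ] [Module.IsTorsionFree ℤ Λ]
    (f : MonoidAlgebra ℤ G →+* Λ) (hf : Function.Surjective f) :
    Finite (LocallyFreeClassGroup Λ) := by
  obtain ⟨S, hSfin, hS⟩ := GLattice.exists_finite_representatives_of_finrank.{v, u} G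
    (Module.finrank ℤ Λ)
  choose! r hrS hr using hS
  have := hSfin.to_subtype
  have hrank : ∀ X : PrincipalGenus Λ, Module.finrank ℤ (X.toGLattice f).carrier =
      Module.finrank ℤ Λ := fun X =>
    LocFree.finrank_eq (X := X.carrier) X.isLattice X.locFree
  refine Finite.of_injective (β := S)
    (fun c : LocallyFreeClassGroup Λ =>
      ⟨r ((Quotient.out c).toGLattice f), hrS _ (hrank _)⟩) fun c c' h => ?_
  have h : r ((Quotient.out c).toGLattice f) = r ((Quotient.out c').toGLattice f) :=
    congrArg Subtype.val h
  obtain ⟨e⟩ := PrincipalGenus.nonempty_equiv_of_iso hf (hr _ (hrank (Quotient.out c)))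
    (h ▸ hr _ (hrank (Quotient.out c')))
  exact Quotient.out_equiv_out.mp ⟨0, ⟨e.prodCongr (LinearEquiv.refl Λ _)⟩⟩

theorem card_locallyFreeClassGroup_ne_zero [Finite G] [Module.Finite ℤ Λ]
    [Module.IsTorsionFree ℤ Λ] (f : MonoidAlgebra ℤ G →+* Λ) (hf : Function.Surjective f) :
    Nat.card (LocallyFreeClassGroup Λ) ≠ 0 := by
  have := finite_locallyFreeClassGroup f hf
  have : Nonempty (LocallyFreeClassGroup Λ) :=
    ⟨Quotient.mk _ ⟨Λ, ⟨inferInstance, inferInstance⟩, (LocFree.self Λ).sameGenus⟩⟩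
  exact Nat.card_pos.ne'

end Finiteness

/-! ### Reduction of group rings modulo two -/

section ModTwo

theorem finite_monoidAlgebra_zmod_two (H : Type u) [Finite H] :
    Finite (MonoidAlgebra (ZMod 2) H) :=
  have : Finite (H →₀ ZMod 2) := Finite.of_injective _ DFunLike.coe_injective
  Finite.of_injective _ MonoidAlgebra.coeff_injective

variable (H : Type u) [Group H]

/-- The reduction `ℤ[H] → 𝔽₂[H]`. -/
noncomputable abbrev redTwo : MonoidAlgebra ℤ H →+* MonoidAlgebra (ZMod 2) H :=
  MonoidAlgebra.mapRingHom H (Int.castRingHom (ZMod 2))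

theorem add_self_eq_zero_of_zmod_two (x : MonoidAlgebra (ZMod 2) H) : x + x = 0 := by
  ext h
  simp [CharTwo.add_self_eq_zero]

theorem isModTwo_redTwo : IsModTwo (redTwo H) where
  surjective := MonoidAlgebra.map_surjective _ (ZMod.intCast_surjective)
  map_eq_zero x := by
    change redTwo H x = 0 ↔ _
    constructor
    · intro hx
      have h : ∀ m, x.coeff m = x.coeff m / 2 + x.coeff m / 2 := fun m => by
        have hm : ((x.coeff m : ℤ) : ZMod 2) = 0 := by
          rw [← eq_intCast (Int.castRingHom (ZMod 2)), ← MonoidAlgebra.coeff_mapRingHom, hx]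
          rfl
        rw [ZMod.intCast_zmod_eq_zero_iff_dvd] at hm
        omega
      refine ⟨.ofCoeff (x.coeff.mapRange (· / 2) (by simp)), ?_⟩
      ext m
      exact h m
    · rintro ⟨w, rfl⟩
      rw [map_add, add_self_eq_zero_of_zmod_two]

end ModTwo

/-! ### The fibre square of ℤ[H × C₂] -/

section ProdTwo

variable (H : Type u) [Group H]

theorem multiplicative_zmod_two_cases (c : Multiplicative (ZMod 2)) :
    c = 1 ∨ c = Multiplicative.ofAdd 1 := by
  revert c
  decide

/-- The homomorphism `ℤ[H × C₂] → ℤ[H]` given by the sign character of `C₂`. -/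
noncomputable def signProj :
    MonoidAlgebra ℤ (H × Multiplicative (ZMod 2)) →+* MonoidAlgebra ℤ H :=
  (MonoidAlgebra.lift ℤ (MonoidAlgebra ℤ H) (H × Multiplicative (ZMod 2))
    { toFun := fun x => (if x.2 = 1 then 1 else -1 : ℤ) • MonoidAlgebra.of ℤ H x.1
      map_one' := by rw [Prod.fst_one, Prod.snd_one, if_pos rfl, one_smul, map_one]
      map_mul' := by
        rintro ⟨a, c⟩ ⟨b, d⟩
        have h : ∀ c d : Multiplicative (ZMod 2), (if c * d = 1 then 1 else -1 : ℤ) =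
          (if c = 1 then 1 else -1) * (if d = 1 then 1 else -1) := by decide
        simp only [Prod.mk_mul_mk, h, map_mul, smul_mul_smul_comm] }).toRingHom

theorem signProj_of (x : H × Multiplicative (ZMod 2)) :
    signProj H (MonoidAlgebra.of ℤ _ x) =
      (if x.2 = 1 then 1 else -1 : ℤ) • MonoidAlgebra.of ℤ H x.1 :=
  MonoidAlgebra.lift_of _ _

/-- The homomorphism `ℤ[H × C₂] → ℤ[H]` given by the projection. -/
noncomputable def fstProj :
    MonoidAlgebra ℤ (H × Multiplicative (ZMod 2)) →+* MonoidAlgebra ℤ H :=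
  MonoidAlgebra.mapDomainRingHom ℤ (MonoidHom.fst H (Multiplicative (ZMod 2)))

theorem fstProj_of (x : H × Multiplicative (ZMod 2)) :
    fstProj H (MonoidAlgebra.of ℤ _ x) = MonoidAlgebra.of ℤ H x.1 := by
  simp [fstProj]

/-- The section of the two projections. -/
noncomputable def inlHom :
    MonoidAlgebra ℤ H →+* MonoidAlgebra ℤ (H × Multiplicative (ZMod 2)) :=
  MonoidAlgebra.mapDomainRingHom ℤ (MonoidHom.inl H (Multiplicative (ZMod 2)))

theorem inlHom_of (h : H) : inlHom H (MonoidAlgebra.of ℤ _ h) = MonoidAlgebra.of ℤ _ (h, 1) := by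
  simp [inlHom]

theorem fstProj_inlHom (a : MonoidAlgebra ℤ H) : fstProj H (inlHom H a) = a := by
  induction a using MonoidAlgebra.induction_on with
  | of h => rw [inlHom_of, fstProj_of]
  | add a b ha hb => rw [map_add, map_add, ha, hb]
  | smul r a ha => rw [map_zsmul, map_zsmul, ha]

theorem signProj_inlHom (a : MonoidAlgebra ℤ H) : signProj H (inlHom H a) = a := by
  induction a using MonoidAlgebra.induction_on with
  | of h => rw [inlHom_of, signProj_of, if_pos rfl, one_smul]
  | add a b ha hb => rw [map_add, map_add, ha, hb]
  | smul r a ha => rw [map_zsmul, map_zsmul, ha]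

/-- In the form a + cb, with c the generator of C₂, the two projections become a + b and a - b, so
the axioms of the square are immediate. -/
theorem exists_eq_inlHom_add (x : MonoidAlgebra ℤ (H × Multiplicative (ZMod 2))) :
    ∃ a b, x = inlHom H a + MonoidAlgebra.of ℤ _ (1, Multiplicative.ofAdd 1) * inlHom H b := by
  induction x using MonoidAlgebra.induction_on with
  | of y =>
    obtain ⟨h, c⟩ := y
    obtain rfl | rfl := multiplicative_zmod_two_cases c
    · exact ⟨MonoidAlgebra.of ℤ H h, 0, by rw [inlHom_of, map_zero, mul_zero, add_zero]⟩
    · refine ⟨0, MonoidAlgebra.of ℤ H h, ?_⟩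
      rw [inlHom_of, map_zero, zero_add, ← map_mul, Prod.mk_mul_mk, one_mul, mul_one]
  | add x y hx hy =>
    obtain ⟨a, b, rfl⟩ := hx
    obtain ⟨c, d, rfl⟩ := hy
    exact ⟨a + c, b + d, by rw [map_add, map_add, mul_add]; abel⟩
  | smul r x hx =>
    obtain ⟨a, b, rfl⟩ := hx
    exact ⟨r • a, r • b, by rw [map_zsmul, map_zsmul, mul_smul_comm, smul_add]⟩

theorem fstProj_inlHom_add (a b : MonoidAlgebra ℤ H) :
    fstProj H (inlHom H a + MonoidAlgebra.of ℤ _ (1, Multiplicative.ofAdd 1) * inlHom H b) =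
      a + b := by
  rw [map_add, map_mul, fstProj_inlHom, fstProj_inlHom, fstProj_of,
    (MonoidAlgebra.of ℤ H).map_one, one_mul]

theorem signProj_inlHom_add (a b : MonoidAlgebra ℤ H) :
    signProj H (inlHom H a + MonoidAlgebra.of ℤ _ (1, Multiplicative.ofAdd 1) * inlHom H b) =
      a - b := by
  have h : (Multiplicative.ofAdd 1 : Multiplicative (ZMod 2)) ≠ 1 := by decide
  rw [map_add, map_mul, signProj_inlHom, signProj_inlHom, signProj_of, if_neg h,
    (MonoidAlgebra.of ℤ H).map_one, neg_one_smul, neg_one_mul, sub_eq_add_neg]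

/-- The fibre square `ℤ[H × C₂] = ℤ[H] ×_{𝔽₂[H]} ℤ[H]`. -/
noncomputable def prodTwoSquare : FiberSquare (MonoidAlgebra ℤ (H × Multiplicative (ZMod 2)))
    (MonoidAlgebra ℤ H) (MonoidAlgebra ℤ H) (MonoidAlgebra (ZMod 2) H) where
  p₁ := fstProj H
  p₂ := signProj H
  q₁ := redTwo H
  q₂ := redTwo H
  comm x := by
    obtain ⟨a, b, rfl⟩ := exists_eq_inlHom_add H x
    rw [fstProj_inlHom_add, signProj_inlHom_add, map_add, map_sub, eq_sub_iff_add_eq, add_assoc,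
      add_self_eq_zero_of_zmod_two, add_zero]
  inj x h₁ h₂ := by
    obtain ⟨a, b, rfl⟩ := exists_eq_inlHom_add H x
    rw [fstProj_inlHom_add] at h₁
    rw [signProj_inlHom_add, sub_eq_zero] at h₂
    subst h₂
    rw [NoTwoTorsion.of_isTorsionFree _ a h₁, map_zero, mul_zero, add_zero]
  lift a b h := by
    rw [← sub_eq_zero, ← map_sub] at h
    obtain ⟨w, hw⟩ := ((isModTwo_redTwo H).map_eq_zero (a - b)).mp h
    refine ⟨_, (fstProj_inlHom_add H (b + w) w).trans ?_,
      (signProj_inlHom_add H (b + w) w).trans ?_⟩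
    · rw [add_assoc, ← hw, add_sub_cancel]
    · rw [add_sub_cancel_right]
  red₁ := isModTwo_redTwo H
  red₂ := isModTwo_redTwo H

end ProdTwo

/-! ### The projection ℤ[G] → ℤ[G/N] for a central involution -/

section Quotient

theorem traceElement_eq {G : Type u} [Group G] (N : Subgroup G) {z : G} (hz : z ≠ 1) (hmem : ∀ g, g ∈ N ↔ g = 1 ∨ g = z) :
    traceElement N = 1 + MonoidAlgebra.of ℤ G z := by
  have h : (N : Set G) = {1, z} := Set.ext hmem
  rw [traceElement]
  refine (finsum_set_coe_eq_finsum_mem (f := fun g => MonoidAlgebra.of ℤ G g) (N : Set G)).trans ?_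
  rw [h, finsum_mem_pair hz.symm, map_one]

variable {G : Type u} [Group G] (N : Subgroup G) [N.Normal]

theorem exists_generator_of_card_eq_two (hN : Nat.card N = 2) :
    ∃ z : G, z ≠ 1 ∧ z * z = 1 ∧ (∀ g, g * z = z * g) ∧ ∀ g, g ∈ N ↔ g = 1 ∨ g = z := by
  obtain ⟨⟨z, hz⟩, hz1, huniq⟩ := (Nat.card_eq_two_iff' (1 : N)).mp hN
  have hz1 : z ≠ 1 := fun h => hz1 (Subtype.ext h)
  have huniq : ∀ g ∈ N, g ≠ 1 → g = z := fun g hg h =>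
    congrArg Subtype.val (huniq ⟨g, hg⟩ fun h' => h (congrArg Subtype.val h'))
  refine ⟨z, hz1, ?_, fun g => ?_, fun g => ⟨fun hg => ?_, ?_⟩⟩
  · by_contra h
    have := huniq _ (mul_mem hz hz) h
    exact hz1 (mul_eq_left.mp this)
  · have := huniq _ (‹N.Normal›.conj_mem z hz g) fun h => hz1 (conj_eq_one_iff.mp h)
    exact mul_inv_eq_iff_eq_mul.mp this
  · by_cases h : g = 1
    · exact .inl h
    · exact .inr (huniq g hg h)
  · rintro (rfl | rfl)
    · exact one_mem _
    · exact hz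

/-- The projection `ℤ[G] → ℤ[G/N]`. -/
noncomputable def quotProj : MonoidAlgebra ℤ G →+* MonoidAlgebra ℤ (G ⧸ N) :=
  MonoidAlgebra.mapDomainRingHom ℤ (QuotientGroup.mk' N)

theorem quotProj_of (g : G) :
    quotProj N (MonoidAlgebra.of ℤ G g) = MonoidAlgebra.of ℤ (G ⧸ N) (g : G ⧸ N) := by
  simp [quotProj]

/-- The additive section of `quotProj` given by a choice of representatives. -/
noncomputable def quotSection : MonoidAlgebra ℤ (G ⧸ N) →ₗ[ℤ] MonoidAlgebra ℤ G :=
  MonoidAlgebra.mapDomainLinearMap ℤ ℤ Quotient.out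

theorem quotSection_of (h : G ⧸ N) :
    quotSection N (MonoidAlgebra.of ℤ _ h) = MonoidAlgebra.of ℤ G (Quotient.out h) := by
  simp [quotSection]

theorem quotProj_quotSection (a : MonoidAlgebra ℤ (G ⧸ N)) : quotProj N (quotSection N a) = a := by
  induction a using MonoidAlgebra.induction_on with
  | of h => rw [quotSection_of, quotProj_of, QuotientGroup.out_eq']
  | add a b ha hb => rw [map_add, map_add, ha, hb]
  | smul r a ha => rw [map_zsmul, map_zsmul, ha]

theorem quotProj_surjective : Function.Surjective (quotProj N) := fun a =>
  ⟨_, quotProj_quotSection N a⟩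

variable {N} {z : G} (hz : z ≠ 1) (hzz : z * z = 1) (hmem : ∀ g, g ∈ N ↔ g = 1 ∨ g = z)

include hmem in
theorem quotProj_of_generator : quotProj N (MonoidAlgebra.of ℤ G z) = 1 := by
  rw [quotProj_of, (QuotientGroup.eq_one_iff z).mpr ((hmem z).mpr (.inr rfl)), map_one]

variable (hcomm : ∀ g, g * z = z * g)

include hzz in
theorem of_generator_mul_self :
    MonoidAlgebra.of ℤ G z * MonoidAlgebra.of ℤ G z = 1 := by
  rw [← map_mul, hzz, map_one]

include hmem hcomm in
theorem exists_eq_quotSection_add (x : MonoidAlgebra ℤ G) :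
    ∃ a b, x = quotSection N a + MonoidAlgebra.of ℤ G z * quotSection N b := by
  induction x using MonoidAlgebra.induction_on with
  | of g =>
    obtain h | h := (hmem _).mp (QuotientGroup.eq.mp (QuotientGroup.out_eq' (g : G ⧸ N)))
    · refine ⟨MonoidAlgebra.of ℤ _ (g : G ⧸ N), 0, ?_⟩
      rw [quotSection_of, map_zero, mul_zero, add_zero]
      rw [inv_mul_eq_one] at h
      exact congrArg _ h.symm
    · refine ⟨0, MonoidAlgebra.of ℤ _ (g : G ⧸ N), ?_⟩
      rw [quotSection_of, map_zero, zero_add, ← map_mul]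
      rw [inv_mul_eq_iff_eq_mul, hcomm] at h
      exact congrArg _ h
  | add x y hx hy =>
    obtain ⟨a, b, rfl⟩ := hx
    obtain ⟨c, d, rfl⟩ := hy
    exact ⟨a + c, b + d, by rw [map_add, map_add, mul_add]; abel⟩
  | smul r x hx =>
    obtain ⟨a, b, rfl⟩ := hx
    exact ⟨r • a, r • b, by rw [map_zsmul, map_zsmul, mul_smul_comm, smul_add]⟩

include hmem hcomm in
theorem exists_eq_of_quotProj_eq_zero {x : MonoidAlgebra ℤ G} (hx : quotProj N x = 0) :
    ∃ y, x = (1 - MonoidAlgebra.of ℤ G z) * y := by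
  obtain ⟨a, b, rfl⟩ := exists_eq_quotSection_add hmem hcomm x
  rw [map_add, map_mul, quotProj_of_generator hmem, one_mul, quotProj_quotSection,
    quotProj_quotSection, add_comm, add_eq_zero_iff_eq_neg] at hx
  subst hx
  exact ⟨quotSection N a, by rw [map_neg, sub_mul, one_mul, mul_neg, sub_eq_add_neg]⟩

include hz hmem in
-- Keeping only coefficients at the chosen coset representatives inverts c ↦ (1 - z)s(c), because z
-- times a representative is not a representative.
theorem quotSection_eq_zero {c : MonoidAlgebra ℤ (G ⧸ N)}
    (hc : (1 - MonoidAlgebra.of ℤ G z) * quotSection N c = 0) : c = 0 := by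
  classical
  let κ : MonoidAlgebra ℤ G →ₗ[ℤ] MonoidAlgebra ℤ (G ⧸ N) :=
    (MonoidAlgebra.basis G ℤ).constr ℤ fun g =>
      if g = Quotient.out (g : G ⧸ N) then MonoidAlgebra.of ℤ _ (g : G ⧸ N) else 0
  have hκ : ∀ g, κ (MonoidAlgebra.of ℤ G g) =
      if g = Quotient.out (g : G ⧸ N) then MonoidAlgebra.of ℤ _ (g : G ⧸ N) else 0 := fun g => by
    have := (MonoidAlgebra.basis G ℤ).constr_basis ℤ (fun g =>
      if g = Quotient.out (g : G ⧸ N) then MonoidAlgebra.of ℤ _ (g : G ⧸ N) else 0) g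
    rwa [MonoidAlgebra.basis_apply] at this
  have key : ∀ c, κ ((1 - MonoidAlgebra.of ℤ G z) * quotSection N c) = c := by
    intro c
    induction c using MonoidAlgebra.induction_on with
    | of h =>
      have h1 : ((Quotient.out h : G) : G ⧸ N) = h := QuotientGroup.out_eq' h
      have h2 : ((z * Quotient.out h : G) : G ⧸ N) = h := by
        rw [QuotientGroup.mk_mul, (QuotientGroup.eq_one_iff z).mpr ((hmem z).mpr (.inr rfl)),
          one_mul, h1]
      rw [quotSection_of, sub_mul, one_mul, ← map_mul, map_sub, hκ, hκ, h1, h2, if_pos rfl,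
        if_neg (fun h => hz (mul_eq_right.mp h)), sub_zero]
    | add a b ha hb => rw [map_add, mul_add, map_add, ha, hb]
    | smul r a ha => rw [map_zsmul, mul_smul_comm, map_zsmul, ha]
  rw [← key c, hc, map_zero]

include hz hzz hmem hcomm in
-- Write x = s(a) + z s(b). As (1 - z)z = -(1 - z), the hypothesis becomes (1 - z)s(a - b) = 0, so a
-- = b and x = (1 + z)s(a).
theorem exists_eq_of_mul_eq_zero {x : MonoidAlgebra ℤ G}
    (hx : (1 - MonoidAlgebra.of ℤ G z) * x = 0) : ∃ y, (1 + MonoidAlgebra.of ℤ G z) * y = x := by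
  obtain ⟨a, b, rfl⟩ := exists_eq_quotSection_add hmem hcomm x
  have h : (1 - MonoidAlgebra.of ℤ G z) * quotSection N (a - b) = 0 := by
    rw [← hx, map_sub, mul_add, ← mul_assoc, sub_mul 1 _ (MonoidAlgebra.of ℤ G z),
      of_generator_mul_self hzz, one_mul, mul_sub, sub_eq_add_neg _ (_ * quotSection N b),
      ← neg_mul, neg_sub]
  have h := sub_eq_zero.mp (quotSection_eq_zero hz hmem h)
  subst h
  exact ⟨quotSection N a, by rw [add_mul, one_mul]⟩

include hzz in
theorem one_sub_mul_one_add (y : MonoidAlgebra ℤ G) :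
    (1 - MonoidAlgebra.of ℤ G z) * ((1 + MonoidAlgebra.of ℤ G z) * y) = 0 := by
  rw [← mul_assoc, sub_mul, one_mul, mul_add, mul_one, of_generator_mul_self hzz,
    add_comm (MonoidAlgebra.of ℤ G z), sub_self, zero_mul]

include hzz in
theorem one_add_mul_one_sub (y : MonoidAlgebra ℤ G) :
    (1 + MonoidAlgebra.of ℤ G z) * ((1 - MonoidAlgebra.of ℤ G z) * y) = 0 := by
  rw [← mul_assoc, add_mul, one_mul, mul_sub, mul_one, of_generator_mul_self hzz,
    sub_add_sub_cancel, sub_self, zero_mul]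

include hmem in
theorem quotProj_one_add_mul (y : MonoidAlgebra ℤ G) :
    quotProj N ((1 + MonoidAlgebra.of ℤ G z) * y) = quotProj N y + quotProj N y := by
  rw [map_mul, map_add, map_one, quotProj_of_generator hmem, add_mul, one_mul]

end Quotient

/-! ### The ring Γ and the fibre square of ℤ[G] -/

section GammaRing

variable {G : Type u} [Group G] [Finite G] (N : Subgroup G) [N.Normal]

instance GammaRing.finite_int : Module.Finite ℤ (GammaRing N) :=
  Module.Finite.of_surjective (Ideal.Quotient.mk (traceIdeal N)).toAddMonoidHom.toIntLinearMap
    Ideal.Quotient.mk_surjective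

variable {N} {z : G} (hz : z ≠ 1) (hzz : z * z = 1) (hcomm : ∀ g, g * z = z * g)
  (hmem : ∀ g, g ∈ N ↔ g = 1 ∨ g = z)

include hz hmem in
theorem GammaRing.mk_eq_zero_iff (x : MonoidAlgebra ℤ G) :
    Ideal.Quotient.mk (traceIdeal N) x = 0 ↔ ∃ y, (1 + MonoidAlgebra.of ℤ G z) * y = x := by
  rw [Ideal.Quotient.eq_zero_iff_mem, mem_traceIdeal, traceElement_eq N hz hmem]

include hz hzz hmem hcomm in
-- Tr_N ℤ[G] is the annihilator of 1 - z in the torsion-free group ℤ[G], hence a pure subgroup.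
theorem GammaRing.isTorsionFree : Module.IsTorsionFree ℤ (GammaRing N) := by
  refine isTorsionFree_int_of_forall fun n x hn h => ?_
  obtain ⟨x, rfl⟩ := Ideal.Quotient.mk_surjective x
  rw [← map_zsmul, mk_eq_zero_iff hz hmem] at h
  obtain ⟨y, hy⟩ := h
  rw [mk_eq_zero_iff hz hmem]
  refine exists_eq_of_mul_eq_zero hz hzz hmem hcomm ?_
  have h := one_sub_mul_one_add hzz y
  rw [hy, mul_smul_comm] at h
  exact (smul_eq_zero.mp h).resolve_left hn

variable (N) in
/-- The reduction of `ℤ[G]` to `𝔽₂[G/N]`. -/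
noncomputable abbrev quotRed : MonoidAlgebra ℤ G →+* MonoidAlgebra (ZMod 2) (G ⧸ N) :=
  (redTwo (G ⧸ N)).comp (quotProj N)

include hz hmem in
theorem quotRed_eq_zero_of_mem {x : MonoidAlgebra ℤ G} (hx : x ∈ traceIdeal N) :
    quotRed N x = 0 := by
  rw [← Ideal.Quotient.eq_zero_iff_mem, GammaRing.mk_eq_zero_iff hz hmem] at hx
  obtain ⟨y, rfl⟩ := hx
  rw [RingHom.comp_apply, quotProj_one_add_mul hmem, map_add, add_self_eq_zero_of_zmod_two]

/-- The fibre square `ℤ[G] = Γ ×_{𝔽₂[G/N]} ℤ[G/N]`. -/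
noncomputable def gammaSquare : FiberSquare (MonoidAlgebra ℤ G) (GammaRing N)
    (MonoidAlgebra ℤ (G ⧸ N)) (MonoidAlgebra (ZMod 2) (G ⧸ N)) where
  p₁ := Ideal.Quotient.mk (traceIdeal N)
  p₂ := quotProj N
  q₁ := Ideal.Quotient.lift (traceIdeal N) (quotRed N) fun _ => quotRed_eq_zero_of_mem hz hmem
  q₂ := redTwo (G ⧸ N)
  comm _ := rfl
  inj x h₁ h₂ := by
    obtain ⟨y, rfl⟩ := (GammaRing.mk_eq_zero_iff hz hmem x).mp h₁
    rw [quotProj_one_add_mul hmem] at h₂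
    obtain ⟨w, rfl⟩ := exists_eq_of_quotProj_eq_zero hmem hcomm
      (NoTwoTorsion.of_isTorsionFree _ _ h₂)
    exact one_add_mul_one_sub hzz w
  lift a b h := by
    obtain ⟨x, rfl⟩ := Ideal.Quotient.mk_surjective a
    have h : redTwo (G ⧸ N) (quotProj N x) = redTwo (G ⧸ N) b := h
    rw [eq_comm, ← sub_eq_zero, ← map_sub] at h
    obtain ⟨w, hw⟩ := ((isModTwo_redTwo _).map_eq_zero _).mp h
    obtain ⟨w, rfl⟩ := quotProj_surjective N w
    -- The correction (1 + z)w vanishes in Γ and becomes w + w in ℤ[G/N].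
    refine ⟨x + (1 + MonoidAlgebra.of ℤ G z) * w, ?_, ?_⟩
    · rw [map_add, (GammaRing.mk_eq_zero_iff hz hmem _).mpr ⟨w, rfl⟩, add_zero]
    · rw [map_add, quotProj_one_add_mul hmem, ← hw, add_sub_cancel]
  red₁ :=
    { surjective := fun r => by
        obtain ⟨a, rfl⟩ := (isModTwo_redTwo (G ⧸ N)).surjective r
        obtain ⟨x, rfl⟩ := quotProj_surjective N a
        exact ⟨Ideal.Quotient.mk _ x, rfl⟩
      map_eq_zero := fun a => by
        constructor
        · intro h
          obtain ⟨x, rfl⟩ := Ideal.Quotient.mk_surjective a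
          obtain ⟨w, hw⟩ := ((isModTwo_redTwo (G ⧸ N)).map_eq_zero (quotProj N x)).mp h
          obtain ⟨w, rfl⟩ := quotProj_surjective N w
          obtain ⟨y, hy⟩ := exists_eq_of_quotProj_eq_zero hmem hcomm (x := x - (w + w))
            (by rw [map_sub, hw, map_add, sub_self])
          have hy' : Ideal.Quotient.mk (traceIdeal N) (MonoidAlgebra.of ℤ G z * y) =
              - Ideal.Quotient.mk (traceIdeal N) y := by
            rw [eq_neg_iff_add_eq_zero, add_comm, ← map_add,
              GammaRing.mk_eq_zero_iff hz hmem]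
            exact ⟨y, by rw [add_mul, one_mul]⟩
          -- In Γ the involution z acts as -1, so x = 2w + (1 - z)y becomes 2(w + y).
          refine ⟨Ideal.Quotient.mk _ (w + y), ?_⟩
          rw [sub_eq_iff_eq_add.mp hy, sub_mul, one_mul, map_add, map_sub, hy', map_add, map_add]
          abel
        · rintro ⟨w, rfl⟩
          rw [map_add, add_self_eq_zero_of_zmod_two] }
  red₂ := isModTwo_redTwo (G ⧸ N)

end GammaRing

theorem mainTheorem10 {G : Type u} [Group G] [Finite G] (N : Subgroup G) [N.Normal]
    (hN : Nat.card N = 2)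
    (hSFC : HasSFC (MonoidAlgebra ℤ ((G ⧸ N) × Multiplicative (ZMod 2))))
    (hCl :
      (Nat.card (LocallyFreeClassGroup
          (MonoidAlgebra ℤ ((G ⧸ N) × Multiplicative (ZMod 2)))) : ℚ) /
        (Nat.card (LocallyFreeClassGroup (MonoidAlgebra ℤ (G ⧸ N))) : ℚ) =
      (Nat.card (LocallyFreeClassGroup (MonoidAlgebra ℤ G)) : ℚ) /
        (Nat.card (LocallyFreeClassGroup (GammaRing N)) : ℚ)) :
    HasSFC (MonoidAlgebra ℤ G) ↔ HasSFC (GammaRing N) := by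
  obtain ⟨z, hz, hzz, hcomm, hmem⟩ := exists_generator_of_card_eq_two N hN
  have := GammaRing.isTorsionFree hz hzz hcomm hmem
  have := finite_monoidAlgebra_zmod_two (G ⧸ N)
  have nΓ := NoTwoTorsion.of_isTorsionFree (GammaRing N)
  have nH := NoTwoTorsion.of_isTorsionFree (MonoidAlgebra ℤ (G ⧸ N))
  let A := gammaSquare hz hzz hcomm hmem
  let B := prodTwoSquare (G ⧸ N)
  refine ⟨A.hasSFC_fst nΓ, fun hΓ => ?_⟩
  have hH : HasSFC (MonoidAlgebra ℤ (G ⧸ N)) := B.hasSFC_fst nH hSFC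
  -- Both maps to R in the square of ℤ[H × C₂] are the reduction of ℤ[H], which is also the second
  -- map in the square of ℤ[G]; both suprema collapse.
  have hW : stablyLiftable A.q₂ A.red₂ ≤ liftable A.q₂.toSemilinearMap :=
    (FiberSquare.stablyLiftable_le_of_hasSFC (D := B) nH nH hSFC).trans (sup_idem _).le
  have hBunits : B.stableUnits = stablyLiftable A.q₂ A.red₂ := sup_idem _
  have : Finite (MonoidAlgebra (ZMod 2) (G ⧸ N) ≃ₗ[MonoidAlgebra (ZMod 2) (G ⧸ N)]
      MonoidAlgebra (ZMod 2) (G ⧸ N)) := Finite.of_injective _ DFunLike.coe_injective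
  have hindex : A.stableUnits.index = (stablyLiftable A.q₂ A.red₂).index := by
    have h0 := card_locallyFreeClassGroup_ne_zero (RingHom.id (MonoidAlgebra ℤ (G ⧸ N)))
      Function.surjective_id
    have h1 := card_locallyFreeClassGroup_ne_zero (Ideal.Quotient.mk (traceIdeal N))
      Ideal.Quotient.mk_surjective
    have h0' : (Nat.card (LocallyFreeClassGroup (MonoidAlgebra ℤ (G ⧸ N))) : ℚ) ≠ 0 :=
      Nat.cast_ne_zero.mpr h0
    have h1' : (Nat.card (LocallyFreeClassGroup (GammaRing N)) : ℚ) ≠ 0 := Nat.cast_ne_zero.mpr h1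
    rw [A.card_locallyFreeClassGroup, B.card_locallyFreeClassGroup, hBunits,
      div_eq_div_iff h0' h1'] at hCl
    push_cast at hCl
    have h2 := mul_ne_zero (mul_ne_zero h0' h0') h1'
    -- After inserting the class number formulas, both sides carry the nonzero factor |Cl(ℤ[H])|²
    -- |Cl(Γ)|.
    have h3 : (A.stableUnits.index : ℚ) = (stablyLiftable A.q₂ A.red₂).index :=
      mul_left_cancel₀ h2 (by linear_combination -hCl)
    exact_mod_cast h3
  have hle : stablyLiftable A.q₂ A.red₂ ≤ A.stableUnits := le_sup_right
  -- Nested subgroups of equal finite index coincide, so P(Γ)P(ℤ[H]) = P(ℤ[H]).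
  have hP : stablyLiftable A.q₁ A.red₁ ≤ stablyLiftable A.q₂ A.red₂ := by
    have h := Subgroup.relIndex_mul_index hle
    rw [hindex] at h
    have h1 : (stablyLiftable A.q₂ A.red₂).relIndex A.stableUnits = 1 :=
      (Nat.mul_eq_right Subgroup.index_ne_zero_of_finite).mp h
    exact le_sup_left.trans (Subgroup.relIndex_eq_one.mp h1)
  exact A.hasSFC_of_factors nΓ nH hΓ hH hP hW
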